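/- Let $M$ be a finite-dimensional $C^\infty$ manifold (Hausdorff, without boundary). **Conventions.** For a vector bundle $A$ over $M$ with a bilinear skew-symmetric bracket $[\cdot,\cdot]$ on $\Gamma(A)$ and a bundle map $a:A\to TM$ such that $[X,fY]=f[X,Y]+(a(X)f)Y$, let $d$ be the (quasi-)differential on $\Gamma(\bigwedge A^*)$ given by $$d\beta(X_0,\dots,X_k)=\sum_i(-1)^i a(X_i)\,\beta(\dots,\hat X_i,\dots)+\sum_{i<j}(-1)^{i+j}\beta([X_i,X_j],\dots,\hat X_i,\dots,\hat X_j,\dots),$$ and extend the bracket to the Schouten bracket on $\Gamma(\bigwedge A)$, with $[f,g]=0$, $[X,f]=a(X)f$, and $[X_1\wedge\dots\wedge X_p,Y_1\wedge\dots\wedge Y_q]=\sum_{i,j}(-1)^{i+j}[X_i,Y_j]\wedge X_1\wedge\dots\hat X_i\dots\wedge X_p\wedge Y_1\wedge\dots\hat Y_j\dots\wedge Y_q$. The bracket of $P\in\Gamma(\bigwedge^p A)$, $p\ge 1$, with a function $f$ is given by $[P,f](\alpha_1,\dots,\alpha_{p-1})=P(\alpha_1,\dots,\alpha_{p-1},df)$,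 and $[f,Q](\alpha_1,\dots,\alpha_{q-1})=-Q(df,\alpha_1,\dots,\alpha_{q-1})$. For $\phi\in\Gamma(A^*)$ put $d^\phi\beta=d\beta+\phi\wedge\beta$ and, for $P\in\Gamma(\bigwedge^pA)$, $Q\in\Gamma(\bigwedge^qA)$, $$[P,Q]^\phi=[P,Q]+(p-1)P\wedge i_\phi Q+(-1)^p(q-1)\,i_\phi P\wedge Q .$$ Here wedge products of forms and multivectors are normalised by $(\alpha\wedge\beta)(X,Y)=\alpha(X)\beta(Y)-\alpha(Y)\beta(X)$ and contraction is in the first argument. **Quasi-Jacobi bialgebroids.** Let $(A,A^*)$ be dual vector bundles over $M$. A quasi-Jacobi bialgebroid $((A,\phi),(A^*,W),\varphi)$ consists of a Lie algebroid structure $([\cdot,\cdot]_*,a_*)$ on $A^*$, with differential $d_*$ on $\Gamma(\bigwedge A)$, and a 1-cocycle $W\in\Gamma(A)$ of it ($d_*W=0$); a bundle map $a:A\to TM$; a skew-symmetric operation $[\cdot,\cdot]$ on $\Gamma(A)$; $\phi\in\Gamma(A^*)$; and $\varphi\in\Gamma(\bigwedge^3A^*)$; such that, with $d_*^W=d_*+W\wedge\cdot$,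 for all $X,Y,Z\in\Gamma(A)$ and $f\in C^\infty(M)$: 1. $[X,fY]=f[X,Y]+(a(X)f)Y$; 2. $a([X,Y])=[a(X),a(Y)]-a_*(\varphi(X,Y,\cdot))$; 3. $[[X,Y],Z]+\text{c.p.}=-d_*^W(\varphi(X,Y,Z))-\big(i_{\varphi(X,Y,\cdot)}d_*^WZ+\text{c.p.}\big)$; 4. $d\phi-\varphi(W,\cdot,\cdot)=0$; 5. $d^\phi\varphi=0$; 6. $d_*^W[P,Q]^\phi=[d_*^WP,Q]^\phi+(-1)^{p+1}[P,d_*^WQ]^\phi$ for all $P\in\Gamma(\bigwedge^pA)$, $Q\in\Gamma(\bigwedge^q A)$, $p,q\ge 0$. **Twisted Jacobi structures.** The bundle $TM\times\mathbb R$ carries the projection $\pi:TM\times\mathbb R\to TM$ and the bracket $[(X,f),(Y,g)]=([X,Y],X\cdot g-Y\cdot f)$; let $\mathrm d$ be its differential. It is dual to $T^*M\times\mathbb R$ through $\langle(\alpha,f),(X,g)\rangle=\alpha(X)+fg$. A pair $(P,Q)$ of a $k$-vector (or $k$-form) and a $(k-1)$-vector (or form) is the section $(P,Q)((a_1,f_1),\dots,(a_k,f_k))=P(a_1,\dots,a_k)+\sum_i(-1)^{i+1}f_iQ(a_1,\dots,\hat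 a_i,\dots,a_k)$ of the $k$-th exterior power. Let $\Lambda$ be a bivector field, $E$ a vector field and $\omega$ a 2-form on $M$. Put $\langle\beta,\Lambda^\#\alpha\rangle=\Lambda(\alpha,\beta)$ and $(\Lambda,E)^\#(\alpha,f)=(\Lambda^\#\alpha+fE,-\alpha(E))$. Then $(M,(\Lambda,E),\omega)$ is a twisted Jacobi manifold if $$[(\Lambda,E),(\Lambda,E)]^{(0,1)}(u_1,u_2,u_3)=-2\,(d\omega,\omega)\big((\Lambda,E)^\#u_1,(\Lambda,E)^\#u_2,(\Lambda,E)^\#u_3\big)$$ for all sections $u_1,u_2,u_3$ of $T^*M\times\mathbb R$. **Theorem.** Let $(M,(\Lambda,E),\omega)$ be a twisted Jacobi manifold. Equip $TM\times\mathbb R$ with the projection $\pi$ and the bracket $$[u,v]'=[u,v]-(\Lambda,E)^\#\big((d\omega,\omega)(u,v,\cdot)\big),$$ and $T^*M\times\mathbb R$ with the anchor $\pi\circ(\Lambda,E)^\#$ and the bracket $$\{u,v\}^\omega=\{u,v\}+(d\omega,\omega)\big((\Lambda,E)^\#u,(\Lambda,E)^\#v,\cdot\big),$$ where $\{(\alpha,f),(\beta,g)\}=(\gamma,r)$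 with $\gamma=\mathcal L_{\Lambda^\#\alpha}\beta-\mathcal L_{\Lambda^\#\beta}\alpha-d(\Lambda(\alpha,\beta))+f\mathcal L_E\beta-g\mathcal L_E\alpha-i_E(\alpha\wedge\beta)$ and $r=-\Lambda(\alpha,\beta)+\Lambda(\alpha,dg)-\Lambda(\beta,df)+fE(g)-gE(f)$. Then $((TM\times\mathbb R,(0,1)),(T^*M\times\mathbb R,(-E,0)),(d\omega,\omega))$ is a quasi-Jacobi bialgebroid over $M$. Moreover the quasi-differential of $(TM\times\mathbb R,[\cdot,\cdot]',\pi)$ is the graded derivation $\mathrm d'$ of $\Gamma(\bigwedge(T^*M\times\mathbb R))$ with $\mathrm d'f=(df,0)$ and $\mathrm d'(\alpha,f)=\mathrm d(\alpha,f)-(d\omega,\omega)((\Lambda,E)^\#(\alpha,f),\cdot,\cdot)$. -/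

import Mathlib

open scoped Manifold ContDiff

noncomputable section

namespace TwistedJacobi

/-! ### Algebraic calculus of multilinear fields

Let `N` be the module of sections of a vector bundle over `M`, over the ring `R` of smooth functions.
A section of the `k`-th exterior power of the dual bundle is an alternating `R`-multilinear map
`N [⋀^Fin k]→ₗ[R] R`. The operators below are given by their classical formulas on arbitrary
functions `(Fin k → N) → R`; they are applied to alternating multilinear ones. -/

section Calculus

variable {R : Type*} [CommRing R] [Algebra ℝ R]
variable {N : Type*}

/-- The wedge product of a `p`-form and a `q`-form:
`(P ∧ Q)(a₁, …, a_{p+q}) = 1/(p! q!) ∑_σ sgn(σ) P(a_{σ1}, …, a_{σp}) Q(a_{σ(p+1)}, …, a_{σ(p+q)})`. -/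
def wedge {p q k : ℕ} (h : p + q = k) (P : (Fin p → N) → R) (Q : (Fin q → N) → R)
    (a : Fin k → N) : R :=
  ((p.factorial * q.factorial : ℝ)⁻¹) • ∑ σ : Equiv.Perm (Fin k),
    Equiv.Perm.sign σ •
      (P (fun i => a (σ ⟨i, by omega⟩)) * Q (fun j => a (σ ⟨p + j, by omega⟩)))

/-- The wedge product of the 1-form `θ` and a `k`-form, `∑ᵢ (-1)^i θ(aᵢ) P(a₀, …, âᵢ, …, a_k)`. -/
def oneWedge (θ : N → R) {k : ℕ} (P : (Fin k → N) → R) (a : Fin (k + 1) → N) : R :=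
  ∑ i : Fin (k + 1), (-1) ^ (i : ℕ) * (θ (a i) * P (fun j => a (i.succAbove j)))

/-- Contraction in the first argument. -/
def contract (x : N) {k : ℕ} (P : (Fin (k + 1) → N) → R) (a : Fin k → N) : R :=
  P (Fin.cons x a)

/-- `P ∧ i_x Q`, of degree `k = p + q - 1`; it is zero if `q = 0`. -/
def wedgeContract (x : N) : {p q k : ℕ} → p + q = k + 1 →
    ((Fin p → N) → R) → ((Fin q → N) → R) → (Fin k → N) → R
  | _, 0, _, _, _, _ => 0
  | _, _ + 1, _, h, P, Q => wedge (by omega) P (contract x Q)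

/-- `i_x P ∧ Q`, of degree `k = p + q - 1`; it is zero if `p = 0`. -/
def contractWedge (x : N) : {p q k : ℕ} → p + q = k + 1 →
    ((Fin p → N) → R) → ((Fin q → N) → R) → (Fin k → N) → R
  | 0, _, _, _, _, _ => 0
  | _ + 1, _, _, h, P, Q => wedge (by omega) (contract x P) Q

/-- The (quasi-)differential determined by a bracket `br` on sections and the action `act` of
sections on functions (through the anchor):
`(dP)(X₀, …, X_k) = ∑ᵢ (-1)^i Xᵢ · P(X₀, …, X̂ᵢ, …, X_k)
  + ∑_{i<j} (-1)^{i+j} P([Xᵢ, Xⱼ], X₀, …, X̂ᵢ, …, X̂ⱼ, …, X_k)`.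
In the second sum, `[Xᵢ, Xⱼ]` is moved to the `i`-th position, which changes the sign by `(-1)^i`. -/
def differential (act : N → R → R) (br : N → N → N) {k : ℕ} (P : (Fin k → N) → R)
    (X : Fin (k + 1) → N) : R :=
  (∑ i : Fin (k + 1), (-1) ^ (i : ℕ) * act (X i) (P (fun l => X (i.succAbove l)))) +
  ∑ i : Fin (k + 1), ∑ j : Fin (k + 1), if i < j then
    (-1) ^ (j : ℕ) * P (fun l => Function.update X i (br (X i) (X j)) (j.succAbove l)) else 0

/-- The differential `d^θ = d + θ ∧ ·` modified by a 1-form `θ`. -/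
def modDifferential (act : N → R → R) (br : N → N → N) (θ : N → R) {k : ℕ}
    (P : (Fin k → N) → R) (X : Fin (k + 1) → N) : R :=
  differential act br P X + oneWedge θ P X

/-- A section of the `k`-th exterior power of `S* ⊕ ℝ`, with sections of `S` the module `N`,
written as a pair `(P, Q)` of a `k`-form and a `(k-1)`-form:
`(P, Q)((a₁, f₁), …, (a_k, f_k)) = P(a₁, …, a_k) + ∑ᵢ (-1)^{i+1} fᵢ Q(a₁, …, âᵢ, …, a_k)`. -/
def pairField {k : ℕ} (P : (Fin (k + 1) → N) → R) (Q : (Fin k → N) → R)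
    (u : Fin (k + 1) → N × R) : R :=
  P (fun i => (u i).1) + oneWedge (fun v : N × R => v.2) (fun v => Q (fun i => (v i).1)) u

section Dual

variable {A B : Type*} [AddCommGroup A] [Module R A] [AddCommGroup B] [Module R B]

/-- The element of `A` that represents the functional `T` on `B` under the duality `pair`
(unique when `pair` is perfect). -/
def represent (pair : B →ₗ[R] A →ₗ[R] R) (T : B → R) : A :=
  open Classical in
  if h : ∃ X : A, ∀ b : B, pair b X = T b then h.choose else 0

/-- The Schouten bracket `[P, Q]` of a `p`-vector and a `q`-vector (sections of exterior powers of a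
bundle with sections `A` and dual sections `B`), extending the bracket `br` on `A` and the action
`act` of `A` on functions. For `p, q ≥ 1` its value on `α₁, …, α_{p+q-1}` is the sum over the
permutations of the `α`s, written `(a, c, b)` with `a` of length `p - 1`, `c` a single section and `b`
of length `q - 1`, of the sign times
`P(a, d(Q(c, b)))/((p-1)! q!) - Q(d(P(a, c)), b)/(p! (q-1)!)
  - (dc)(P(a, ·), Q(·, b))/((p-1)! (q-1)!)`.
This is the graded biderivation with `[X, f] = X · f`, `[X, Y]` the given bracket and
`[X₁ ∧ … ∧ X_p, Y₁ ∧ … ∧ Y_q] = ∑ (-1)^{i+j} [Xᵢ, Yⱼ] ∧ X₁ ∧ … X̂ᵢ … Ŷⱼ … ∧ Y_q`. -/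
def schouten (pair : B →ₗ[R] A →ₗ[R] R) (act : A → R → R) (br : A → A → A) :
    {p q k : ℕ} → p + q = k + 1 →
      ((Fin p → B) → R) → ((Fin q → B) → R) → (Fin k → B) → R
  | 0, 0, _, _, _, _ => 0
  | p + 1, 0, _, h, P, Q => fun α =>
      P (Fin.snoc (fun i : Fin p => α ⟨i, by omega⟩)
        (represent pair.flip (fun X => act X (Q Fin.elim0))))
  | 0, q + 1, _, h, P, Q => fun α =>
      - Q (Fin.cons (represent pair.flip (fun X => act X (P Fin.elim0)))
        (fun i : Fin q => α ⟨i, by omega⟩))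
  | p + 1, q + 1, k, h, P, Q => fun α =>
      let d : R → B := fun f => represent pair.flip (fun X => act X f)
      let dOne : B → A → A → R := fun c X Y =>
        act X (pair c Y) - act Y (pair c X) - pair c (br X Y)
      ∑ σ : Equiv.Perm (Fin k),
        let a : Fin p → B := fun i => α (σ ⟨i, by omega⟩)
        let c : B := α (σ ⟨p, by omega⟩)
        let b : Fin q → B := fun i => α (σ ⟨p + 1 + i, by omega⟩)
        Equiv.Perm.sign σ •
          ((p.factorial * (q + 1).factorial : ℝ)⁻¹ • P (Fin.snoc a (d (Q (Fin.cons c b))))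
          - ((p + 1).factorial * q.factorial : ℝ)⁻¹ • Q (Fin.cons (d (P (Fin.snoc a c))) b)
          - (p.factorial * q.factorial : ℝ)⁻¹ •
              dOne c (represent pair (fun β => P (Fin.snoc a β)))
                (represent pair (fun β => Q (Fin.cons β b))))

/-- The `φ`-Schouten bracket
`[P, Q]^φ = [P, Q] + (p - 1) P ∧ i_φ Q + (-1)^p (q - 1) i_φ P ∧ Q`. -/
def modSchouten (pair : B →ₗ[R] A →ₗ[R] R) (act : A → R → R) (br : A → A → A) (φ : B)
    {p q k : ℕ} (h : p + q = k + 1) (P : (Fin p → B) → R) (Q : (Fin q → B) → R)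
    (α : Fin k → B) : R :=
  schouten pair act br h P Q α + ((p : ℝ) - 1) • wedgeContract φ h P Q α
    + ((-1) ^ p * ((q : ℝ) - 1)) • contractWedge φ h P Q α

end Dual

end Calculus

/-! ### Smooth functions and vector fields -/

section Manifold

variable (n : ℕ) (M : Type*) [TopologicalSpace M] [ChartedSpace (EuclideanSpace ℝ (Fin n)) M]

/-- The ring of smooth real functions on `M`. -/
abbrev SmoothFun : Type _ := C^∞⟮𝓡 n, M; 𝓘(ℝ, ℝ), ℝ⟯

theorem mdifferentiableAt_fun {n : ℕ} {M : Type*} [TopologicalSpace M]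
    [ChartedSpace (EuclideanSpace ℝ (Fin n)) M] (f : SmoothFun n M) (x : M) :
    MDifferentiableAt (𝓡 n) 𝓘(ℝ, ℝ) f x :=
  f.contMDiff.mdifferentiableAt (by simp)

variable [IsManifold (𝓡 n) ∞ M]

/-- The smooth vector fields on `M`. -/
abbrev VecField : Type _ :=
  Cₛ^∞⟮𝓡 n; EuclideanSpace ℝ (Fin n), (TangentSpace (𝓡 n) : M → Type _)⟯

variable {n M}

/-- Multiplication of a vector field by a smooth function. -/
instance : SMul (SmoothFun n M) (VecField n M) where
  smul f X := ⟨fun x => f x • X x, f.contMDiff.smul_section X.contMDiff⟩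

theorem smul_apply (f : SmoothFun n M) (X : VecField n M) (x : M) : (f • X) x = f x • X x := rfl

instance : Module (SmoothFun n M) (VecField n M) where
  one_smul X := by ext1 x; exact one_smul ℝ (X x)
  mul_smul f g X := by ext1 x; exact mul_smul (f x) (g x) (X x)
  smul_zero f := by ext1 x; exact smul_zero (f x)
  smul_add f X Y := by ext1 x; exact smul_add (f x) (X x) (Y x)
  add_smul f g X := by ext1 x; exact add_smul (f x) (g x) (X x)
  zero_smul X := by ext1 x; exact zero_smul ℝ (X x)

/-- The derivative `X · f` of a function along a vector field. -/
def lieD (X : VecField n M) (f : SmoothFun n M) : SmoothFun n M where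
  val x := mvfderiv (𝓡 n) f x (X x)
  property := by
    have h1 : ContMDiff (𝓡 n).tangent 𝓘(ℝ, ℝ).tangent ∞ (tangentMap (𝓡 n) 𝓘(ℝ, ℝ) f) :=
      f.contMDiff.contMDiff_tangentMap le_rfl
    exact (contMDiff_snd_tangentBundle_modelSpace ℝ 𝓘(ℝ, ℝ)).comp (h1.comp X.contMDiff)

theorem lieD_apply (X : VecField n M) (f : SmoothFun n M) (x : M) :
    lieD X f x = mvfderiv (𝓡 n) f x (X x) := rfl

/-- The Lie bracket of vector fields. -/
def lieBracket (X Y : VecField n M) : VecField n M where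
  toFun := VectorField.mlieBracket (𝓡 n) X Y
  contMDiff_toFun :=
    haveI : IsManifold (𝓡 n) (minSmoothness ℝ 2) M := by
      rw [minSmoothness_of_isRCLikeNormedField]; infer_instance
    haveI : IsManifold (𝓡 n) (((⊤ : ℕ∞) : WithTop ℕ∞) + 1) M :=
      inferInstanceAs (IsManifold (𝓡 n) ∞ M)
    ContDiff.mlieBracket_vectorField (m := ⊤) (n := ⊤) X.contMDiff Y.contMDiff (by simp)

theorem lieBracket_apply (X Y : VecField n M) (x : M) :
    lieBracket X Y x = VectorField.mlieBracket (𝓡 n) X Y x := rfl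

theorem lieD_add (X : VecField n M) (f g : SmoothFun n M) :
    lieD X (f + g) = lieD X f + lieD X g := by
  ext x
  have := mvfderiv_add (mdifferentiableAt_fun f x) (mdifferentiableAt_fun g x)
  exact congrArg (fun L => L (X x)) this

theorem lieD_mul (X : VecField n M) (f g : SmoothFun n M) :
    lieD X (f * g) = f * lieD X g + g * lieD X f := by
  ext x
  have := mvfderiv_mul (mdifferentiableAt_fun f x) (mdifferentiableAt_fun g x)
  exact congrArg (fun L => L (X x)) this

theorem lieBracket_add_right (X Y Z : VecField n M) :
    lieBracket X (Y + Z) = lieBracket X Y + lieBracket X Z := by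
  ext1 x
  exact VectorField.mlieBracket_add_right (Y.contMDiff.mdifferentiableAt (by simp))
    (Z.contMDiff.mdifferentiableAt (by simp))

theorem lieBracket_smul_right (X : VecField n M) (f : SmoothFun n M) (Y : VecField n M) :
    lieBracket X (f • Y) = lieD X f • Y + f • lieBracket X Y := by
  ext1 x
  exact VectorField.mlieBracket_smul_right (mdifferentiableAt_fun f x)
    (Y.contMDiff.mdifferentiableAt (by simp))

variable (n M) in
/-- The 1-forms on `M`, as `C^∞(M)`-linear maps on vector fields. -/
abbrev OneForm : Type _ := Module.Dual (SmoothFun n M) (VecField n M)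

/-- The differential of a function. -/
def dFun (f : SmoothFun n M) : OneForm n M where
  toFun X := lieD X f
  map_add' X Y := by ext x; exact map_add (mvfderiv (𝓡 n) f x) (X x) (Y x)
  map_smul' g X := by ext x; exact map_smul (mvfderiv (𝓡 n) f x) (g x) (X x)

/-- The Lie derivative of a 1-form. -/
def lieDeriv (X : VecField n M) (β : OneForm n M) : OneForm n M where
  toFun Y := lieD X (β Y) - β (lieBracket X Y)
  map_add' Y Z := by
    simp only [map_add, lieD_add, lieBracket_add_right]; ring
  map_smul' f Y := by
    simp only [map_add, map_smul, smul_eq_mul, lieD_mul, lieBracket_smul_right, RingHom.id_apply]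
    ring

/-! ### Lie algebroids and quasi-Jacobi bialgebroids

A vector bundle over `M` enters through its `C^∞(M)`-module of sections. -/

section Bialgebroid

variable {A B : Type*} [AddCommGroup A] [Module (SmoothFun n M) A]
  [AddCommGroup B] [Module (SmoothFun n M) B]

/-- The action of sections on functions through an anchor. -/
def actBy (a : A → VecField n M) (X : A) (f : SmoothFun n M) : SmoothFun n M := lieD (a X) f

/-- A skew-symmetric operation `br` on sections and a bundle map `a` to the tangent bundle, with the
Leibniz rule `[X, fY] = f[X, Y] + (a(X) f) Y` (real bilinearity follows from the last three). -/
structure IsAnchoredBracket (br : A → A → A) (a : A → VecField n M) : Prop where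
  anchor_linear : IsLinearMap (SmoothFun n M) a
  skew : ∀ X Y, br X Y = - br Y X
  add_right : ∀ X Y Z, br X (Y + Z) = br X Y + br X Z
  leibniz : ∀ X (f : SmoothFun n M) Y, br X (f • Y) = f • br X Y + actBy a X f • Y

/-- A Lie algebroid structure over `M`. -/
structure IsLieAlgebroid (br : A → A → A) (a : A → VecField n M) : Prop
    extends IsAnchoredBracket br a where
  jacobi : ∀ X Y Z, br (br X Y) Z + br (br Y Z) X + br (br Z X) Y = 0
  anchor_bracket : ∀ X Y, a (br X Y) = lieBracket (a X) (a Y)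

/-- The data `(br, a, φ)` on `A`, `(brs, as, W)` on the dual `B` and `Φ ∈ Γ(⋀³B)` form a
quasi-Jacobi bialgebroid `((A, φ), (B, W), Φ)`. -/
structure IsQuasiJacobiBialgebroid (pair : B →ₗ[SmoothFun n M] A →ₗ[SmoothFun n M] SmoothFun n M)
    (br : A → A → A) (a : A → VecField n M) (φ : B)
    (brs : B → B → B) (as : B → VecField n M) (W : A)
    (Φ : (Fin 3 → A) → SmoothFun n M) : Prop where
  /-- `A` and `B` are dual to each other. -/
  dual : pair.IsPerfPair
  /-- `B` is a Lie algebroid. -/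
  lieAlgebroid : IsLieAlgebroid brs as
  /-- `W` is a 1-cocycle of `B`: `d_* W = 0`. -/
  cocycle : differential (actBy as) brs (fun b : Fin 1 → B => pair (b 0) W) = 0
  /-- `Φ` is a section of the third exterior power of the dual of `A`. -/
  isForm : ∃ η : A [⋀^Fin 3]→ₗ[SmoothFun n M] SmoothFun n M, ⇑η = Φ
  /-- The bracket on `A` is skew-symmetric, and condition (1), the Leibniz rule. -/
  anchored : IsAnchoredBracket br a
  /-- (2) `a([X, Y]) = [a(X), a(Y)] - a_*(Φ(X, Y, ·))`. -/
  anchor_bracket : ∀ X Y, a (br X Y) =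
    lieBracket (a X) (a Y) - as (represent pair.flip (fun Z => Φ ![X, Y, Z]))
  /-- (3) `[[X, Y], Z] + c.p. = - d_*^W (Φ(X, Y, Z)) - (i_{Φ(X, Y, ·)} d_*^W Z + c.p.)`, an equality
  of sections of `A`, evaluated on an arbitrary `β`. -/
  jacobi : ∀ X Y Z (β : B),
    let dW : {k : ℕ} → ((Fin k → B) → SmoothFun n M) → (Fin (k + 1) → B) → SmoothFun n M :=
      fun P => modDifferential (actBy as) brs (fun b => pair b W) P
    let ι : A → A → A → SmoothFun n M := fun U V T =>
      dW (fun b : Fin 1 → B => pair (b 0) T) ![represent pair.flip (fun S => Φ ![U, V, S]), β]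
    pair β (br (br X Y) Z + br (br Y Z) X + br (br Z X) Y) =
      - dW (fun _ : Fin 0 → B => Φ ![X, Y, Z]) ![β] - (ι X Y Z + ι Y Z X + ι Z X Y)
  /-- (4) `dφ = Φ(W, ·, ·)`. -/
  differential_phi : ∀ X Y,
    differential (actBy a) br (fun x : Fin 1 → A => pair φ (x 0)) ![X, Y] - Φ ![W, X, Y] = 0
  /-- (5) `d^φ Φ = 0`. -/
  differential_form : modDifferential (actBy a) br (fun X => pair φ X) Φ = 0
  /-- (6) `d_*^W [P, Q]^φ = [d_*^W P, Q]^φ + (-1)^{p+1} [P, d_*^W Q]^φ`, for `p + q ≥ 1`. -/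
  derivation : ∀ (p q k : ℕ) (h : p + q = k + 1)
    (P : B [⋀^Fin p]→ₗ[SmoothFun n M] SmoothFun n M)
    (Q : B [⋀^Fin q]→ₗ[SmoothFun n M] SmoothFun n M) (β : Fin (k + 1) → B),
    modDifferential (actBy as) brs (fun b => pair b W)
        (modSchouten pair (actBy a) br φ h P Q) β =
      modSchouten pair (actBy a) br φ (show (p + 1) + q = (k + 1) + 1 by omega)
        (modDifferential (actBy as) brs (fun b => pair b W) P) Q β
      + (-1) ^ (p + 1) * modSchouten pair (actBy a) br φ (show p + (q + 1) = (k + 1) + 1 by omega)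
        P (modDifferential (actBy as) brs (fun b => pair b W) Q) β
  /-- (6) for `p = q = 0`, where `[P, Q]^φ` has degree `-1` and is zero. -/
  derivation_zero : ∀ (P Q : B [⋀^Fin 0]→ₗ[SmoothFun n M] SmoothFun n M) (β : Fin 0 → B),
      modSchouten pair (actBy a) br φ (show 1 + 0 = 0 + 1 by omega)
        (modDifferential (actBy as) brs (fun b => pair b W) P) Q β
      + (-1) ^ (0 + 1) * modSchouten pair (actBy a) br φ (show 0 + 1 = 0 + 1 by omega)
        P (modDifferential (actBy as) brs (fun b => pair b W) Q) β = 0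

end Bialgebroid

/-! ### The bundles `TM × ℝ` and `T*M × ℝ` -/

variable (n M) in
/-- Sections `(X, f)` of `TM × ℝ`. -/
abbrev TanR : Type _ := VecField n M × SmoothFun n M

variable (n M) in
/-- Sections `(α, f)` of `T*M × ℝ`. -/
abbrev CotR : Type _ := OneForm n M × SmoothFun n M

variable (n M) in
/-- The duality `⟨(α, f), (X, g)⟩ = α(X) + f g`. -/
def pairR : CotR n M →ₗ[SmoothFun n M] TanR n M →ₗ[SmoothFun n M] SmoothFun n M :=
  LinearMap.mk₂ (SmoothFun n M) (fun u v => u.1 v.1 + u.2 * v.2)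
    (fun u v w => by simp only [Prod.fst_add, Prod.snd_add, LinearMap.add_apply]; ring)
    (fun c u v => by
      simp only [Prod.smul_fst, Prod.smul_snd, LinearMap.smul_apply, smul_eq_mul]; ring)
    (fun u v w => by simp only [Prod.fst_add, Prod.snd_add, map_add]; ring)
    (fun c u v => by
      simp only [Prod.smul_fst, Prod.smul_snd, map_smul, smul_eq_mul]; ring)

/-- The anchor `π` of `TM × ℝ`, the first projection. -/
def proj (u : TanR n M) : VecField n M := u.1

/-- The bracket `[(X, f), (Y, g)] = ([X, Y], X · g - Y · f)` on sections of `TM × ℝ`. -/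
def bracketR (u v : TanR n M) : TanR n M :=
  (lieBracket u.1 v.1, lieD u.1 v.2 - lieD v.1 u.2)

/-- The exterior derivative of a form on `M`. -/
def dForm {k : ℕ} (η : (Fin k → VecField n M) → SmoothFun n M) :
    (Fin (k + 1) → VecField n M) → SmoothFun n M :=
  differential (lieD (n := n) (M := M)) lieBracket η

/-- The section `(dω, ω)` of the third exterior power of `T*M × ℝ`. -/
def twistForm (om : VecField n M [⋀^Fin 2]→ₗ[SmoothFun n M] SmoothFun n M) :
    (Fin 3 → TanR n M) → SmoothFun n M :=
  pairField (dForm om) om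

/-- The section `(Λ, E)` of the second exterior power of `TM × ℝ`. -/
def biField (Λ : OneForm n M [⋀^Fin 2]→ₗ[SmoothFun n M] SmoothFun n M) (E : VecField n M) :
    (Fin 2 → CotR n M) → SmoothFun n M :=
  pairField Λ (fun α => α 0 E)

/-- `Λ^# : T*M → TM`, `⟨β, Λ^#(α)⟩ = Λ(α, β)`. -/
def sharp (Λ : OneForm n M [⋀^Fin 2]→ₗ[SmoothFun n M] SmoothFun n M) (α : OneForm n M) :
    VecField n M :=
  represent (LinearMap.id : OneForm n M →ₗ[SmoothFun n M] OneForm n M) (fun β => Λ ![α, β])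

/-- `(Λ, E)^#(α, f) = (Λ^#(α) + f E, - α(E))`. -/
def sharpR (Λ : OneForm n M [⋀^Fin 2]→ₗ[SmoothFun n M] SmoothFun n M) (E : VecField n M)
    (u : CotR n M) : TanR n M :=
  (sharp Λ u.1 + u.2 • E, - u.1 E)

/-- `((Λ, E), ω)` is a twisted Jacobi structure on `M`:
`[(Λ, E), (Λ, E)]^{(0,1)} = 2 (Λ, E)^#(dω, ω)`, where
`((Λ, E)^# Φ)(u₁, u₂, u₃) = (-1)³ Φ((Λ, E)^# u₁, (Λ, E)^# u₂, (Λ, E)^# u₃)`. -/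
def IsTwistedJacobi (Λ : OneForm n M [⋀^Fin 2]→ₗ[SmoothFun n M] SmoothFun n M)
    (E : VecField n M) (om : VecField n M [⋀^Fin 2]→ₗ[SmoothFun n M] SmoothFun n M) : Prop :=
  ∀ u : Fin 3 → CotR n M,
    modSchouten (pairR n M) (actBy proj) bracketR (0, 1) (show 2 + 2 = 3 + 1 by norm_num)
        (biField Λ E) (biField Λ E) u =
      2 * ((-1) ^ 3 * twistForm om (fun i => sharpR Λ E (u i)))

/-- The bracket `{(α, f), (β, g)} = (γ, r)` on sections of `T*M × ℝ`, where
`γ = L_{Λ^#α} β - L_{Λ^#β} α - d(Λ(α, β)) + f L_E β - g L_E α - i_E (α ∧ β)` and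
`r = -Λ(α, β) + Λ(α, dg) - Λ(β, df) + f E(g) - g E(f)`. -/
def jacobiBracket (Λ : OneForm n M [⋀^Fin 2]→ₗ[SmoothFun n M] SmoothFun n M)
    (E : VecField n M) (u v : CotR n M) : CotR n M :=
  (lieDeriv (sharp Λ u.1) v.1 - lieDeriv (sharp Λ v.1) u.1 - dFun (Λ ![u.1, v.1])
      + u.2 • lieDeriv E v.1 - v.2 • lieDeriv E u.1 - (u.1 E • v.1 - v.1 E • u.1),
    - Λ ![u.1, v.1] + Λ ![u.1, dFun v.2] - Λ ![v.1, dFun u.2]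
      + u.2 * lieD E v.2 - v.2 * lieD E u.2)

/-- `{u, v}^ω = {u, v} + (dω, ω)((Λ, E)^# u, (Λ, E)^# v, ·)` on sections of `T*M × ℝ`. -/
def twistedBracket (Λ : OneForm n M [⋀^Fin 2]→ₗ[SmoothFun n M] SmoothFun n M)
    (E : VecField n M) (om : VecField n M [⋀^Fin 2]→ₗ[SmoothFun n M] SmoothFun n M)
    (u v : CotR n M) : CotR n M :=
  jacobiBracket Λ E u v +
    represent (pairR n M).flip (fun w => twistForm om ![sharpR Λ E u, sharpR Λ E v, w])

/-- `[u, v]' = [u, v] - (Λ, E)^#((dω, ω)(u, v, ·))` on sections of `TM × ℝ`. -/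
def bracketR' (Λ : OneForm n M [⋀^Fin 2]→ₗ[SmoothFun n M] SmoothFun n M)
    (E : VecField n M) (om : VecField n M [⋀^Fin 2]→ₗ[SmoothFun n M] SmoothFun n M)
    (u v : TanR n M) : TanR n M :=
  bracketR u v -
    sharpR Λ E (represent (pairR n M).flip (fun w => twistForm om ![u, v, w]))

/-- The operator `d` is the derivation `d'` of forms on `TM × ℝ` with `d'f = (df, 0)` and
`d'(α, f) = d(α, f) - (dω, ω)((Λ, E)^#(α, f), ·, ·)`, where the `d` on the right is the exterior
derivative of `(TM × ℝ, [·,·], π)`. -/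
structure IsDPrime (Λ : OneForm n M [⋀^Fin 2]→ₗ[SmoothFun n M] SmoothFun n M)
    (E : VecField n M) (om : VecField n M [⋀^Fin 2]→ₗ[SmoothFun n M] SmoothFun n M)
    (d : (k : ℕ) → ((Fin k → TanR n M) → SmoothFun n M) →
      (Fin (k + 1) → TanR n M) → SmoothFun n M) : Prop where
  on_functions : ∀ (f : SmoothFun n M) (v : TanR n M),
    d 0 (fun _ => f) ![v] = pairR n M (dFun f, 0) v
  on_oneForms : ∀ (u : CotR n M) (v w : TanR n M),
    d 1 (fun x => pairR n M u (x 0)) ![v, w] =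
      differential (actBy proj) bracketR (fun x : Fin 1 → TanR n M => pairR n M u (x 0)) ![v, w]
        - twistForm om ![sharpR Λ E u, v, w]
  additive : ∀ (k : ℕ) (η ζ : TanR n M [⋀^Fin k]→ₗ[SmoothFun n M] SmoothFun n M),
    d k (⇑η + ⇑ζ) = d k η + d k ζ
  graded_leibniz : ∀ (k l : ℕ) (η : TanR n M [⋀^Fin k]→ₗ[SmoothFun n M] SmoothFun n M)
    (ζ : TanR n M [⋀^Fin l]→ₗ[SmoothFun n M] SmoothFun n M) (v : Fin (k + l + 1) → TanR n M),
    d (k + l) (wedge rfl η ζ) v =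
      wedge (show (k + 1) + l = k + l + 1 by omega) (d k η) ζ v
        + (-1) ^ k * wedge (show k + (l + 1) = k + l + 1 by omega) η (d l ζ) v

end Manifold

end TwistedJacobi

end

/-! Write s for (Λ, E)^#, φ = (0,1), W = (-E,0), Φ = (dω, ω), and let a section u of TM × ℝ act on
functions by ρ_u f = u·f + φ(u) f. Since φ is closed, this action is flat, and d^φ is its
differential.

Three geometric facts carry the theorem. (a) Φ = d^φ(ω, 0), so d^φ Φ = 0 (`twistForm_apply`,
`isClosedForm_twistForm`). (b) The untwisted bracket is {x,y} = L_{sx} y - L_{sy} x - d^φ⟨y, sx⟩,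
with Lie derivatives taken for ρ (`pairR_jacobiBracket`), and half of [(Λ,E),(Λ,E)]^φ at (x,y,z) is
⟨z, [sx,sy] - s{x,y}⟩ (`schoutenL_bivector`). The twisted Jacobi condition therefore gives s{x,y}^ω
= [sx,sy]. (c) ⟨x, W⟩ = ⟨φ, sx⟩, so d_*^W is the differential of {·,·}^ω for the action x ↦ ρ_{sx}.
Facts (a) and (b) are packaged in `IsTwistedStructure`; what follows from them is algebra of a
module and its dual.

Let τ x be d^φ x computed with the deformed bracket [·,·]'. Then {x,y}^ω = L_{sx} y - i_{sy} τ x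
(`pair_brB_eq`), where L still uses the undeformed bracket, and τ{x,y}^ω = L_{sx} τ y - L_{sy} τ x
by closedness of Φ (`tau_brB`). The latter gives the Jacobi identity of {·,·}^ω. Condition (2) is
the definition of [·,·]'. Condition (3) combines the Jacobi identity of [·,·] with closedness of Φ
in which one argument is sx (`jacobiator_brA`). Condition (4) is closedness of φ with sφ = -W. In
condition (5) the corrections due to [·,·]' cancel in pairs because s is skew (`closed_brA`).

Condition (6) holds in all degrees because it follows from relations in degrees 0 and 1, listed in
`IsCompatible` and verified in `IsTwistedStructure.isCompatible`. The passage to all degrees is an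
induction on contractions. Multilinear fields are regarded as functions on lists, and d, ∧ and
[·,·]^φ are defined by recursion through i_x: Cartan's formula for d, and i_x[P,Q]^φ = [i_x P, Q]^φ
± [P, i_x Q]^φ ± (τ x)(P,Q) for the bracket. The Lie derivative L_x fails to be a derivation of the
bracket exactly by the failure of d to be a derivation of the pairing with τ x (`lieL_schoutenL`);
in Cartan's formula these failures cancel (`extD_schoutenL`). The theorems `differential_eq_extD`,
`wedge_eq_wedgeL` and `modSchouten_eq_schoutenL` identify the recursive operators with the classical
formulas. -/

namespace TwistedJacobi

/-! ### Cartan calculus by recursion on the list of arguments -/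

section ListCalculus

variable {R N : Type*}

/-! ### Multilinear fields as functions on lists -/

/-- Contraction with `x` in the first argument. -/
def con (x : N) (P : List N → R) : List N → R := fun l => P (x :: l)

@[simp] theorem con_apply (x : N) (P : List N → R) (l : List N) : con x P l = P (x :: l) := rfl

variable [CommRing R]

/-- The parity involution, multiplication by `(-1)^p` in degree `p`. -/
def sg (P : List N → R) : List N → R := fun l => (-1) ^ l.length * P l

/-- The Lie derivative along `x` determined by an action `ρ` on functions and a bracket `br`. -/
def lieL (ρ : N → R → R) (br : N → N → N) (x : N) : (List N → R) → List N → R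
  | P, [] => ρ x (P [])
  | P, y :: l => lieL ρ br x (con y P) l - P (br x y :: l)

/-- The differential determined by Cartan's formula `i_x d = L_x - d i_x`. -/
def extD (ρ : N → R → R) (br : N → N → N) : (List N → R) → List N → R
  | _, [] => 0
  | P, x :: l => lieL ρ br x P l - extD ρ br (con x P) l

theorem con_add (x : N) (P Q : List N → R) : con x (P + Q) = con x P + con x Q := rfl
theorem con_sub (x : N) (P Q : List N → R) : con x (P - Q) = con x P - con x Q := rfl
theorem con_neg (x : N) (P : List N → R) : con x (-P) = -con x P := rfl
theorem con_smul (x : N) (c : R) (P : List N → R) : con x (c • P) = c • con x P := rfl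

theorem con_sg (x : N) (P : List N → R) : con x (sg P) = -sg (con x P) := by
  funext l; simp [sg, pow_succ]

theorem sg_sg (P : List N → R) : sg (sg P) = P := by
  funext l
  simp only [sg]
  rw [← mul_assoc, ← mul_pow]; simp

theorem sg_nil (P : List N → R) : sg P [] = P [] := by simp [sg]

theorem sg_neg (P : List N → R) : sg (-P) = -sg P := by
  funext l; simp [sg]

theorem sg_add (P Q : List N → R) : sg (P + Q) = sg P + sg Q := by
  funext l; simp [sg, mul_add]

variable {ρ a : N → R → R} {br : N → N → N}

theorem con_lieL (x y : N) (P : List N → R) :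
    con y (lieL ρ br x P) = lieL ρ br x (con y P) - con (br x y) P := rfl

theorem con_extD (x : N) (P : List N → R) :
    con x (extD ρ br P) = lieL ρ br x P - extD ρ br (con x P) := rfl

theorem neg_of_additive {F : R → R} (hF : ∀ f g, F (f + g) = F f + F g) (f : R) :
    F (-f) = -F f := (AddMonoidHom.mk' F hF).map_neg f

theorem sub_of_additive {F : R → R} (hF : ∀ f g, F (f + g) = F f + F g) (f g : R) :
    F (f - g) = F f - F g := (AddMonoidHom.mk' F hF).map_sub f g

theorem zero_of_additive {F : R → R} (hF : ∀ f g, F (f + g) = F f + F g) :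
    F 0 = 0 := (AddMonoidHom.mk' F hF).map_zero

theorem lieL_add (h : ∀ x f g, ρ x (f + g) = ρ x f + ρ x g) (x : N) (P Q : List N → R) :
    lieL ρ br x (P + Q) = lieL ρ br x P + lieL ρ br x Q := by
  funext l
  induction l generalizing P Q with
  | nil => exact h _ _ _
  | cons y l ih =>
    simp only [lieL, con_add, Pi.add_apply, ih]; ring

theorem lieL_neg (h : ∀ x f g, ρ x (f + g) = ρ x f + ρ x g) (x : N) (P : List N → R) :
    lieL ρ br x (-P) = -lieL ρ br x P := by
  funext l
  induction l generalizing P with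
  | nil => exact neg_of_additive (h x) _
  | cons y l ih =>
    simp only [lieL, con_neg, Pi.neg_apply, ih]; ring

theorem lieL_sub (h : ∀ x f g, ρ x (f + g) = ρ x f + ρ x g) (x : N) (P Q : List N → R) :
    lieL ρ br x (P - Q) = lieL ρ br x P - lieL ρ br x Q := by
  rw [sub_eq_add_neg, lieL_add h, lieL_neg h, sub_eq_add_neg]

theorem lieL_sg (h : ∀ x f g, ρ x (f + g) = ρ x f + ρ x g) (x : N) (P : List N → R) :
    lieL ρ br x (sg P) = sg (lieL ρ br x P) := by
  funext l
  induction l generalizing P with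
  | nil => simp [lieL, sg]
  | cons y l ih =>
    simp only [lieL, con_sg, lieL_neg h, Pi.neg_apply, ih]
    simp only [sg, lieL, List.length_cons, pow_succ]
    ring

theorem extD_add (h : ∀ x f g, ρ x (f + g) = ρ x f + ρ x g) (P Q : List N → R) :
    extD ρ br (P + Q) = extD ρ br P + extD ρ br Q := by
  funext l
  induction l generalizing P Q with
  | nil => simp [extD]
  | cons y l ih =>
    simp only [extD, con_add, lieL_add h, Pi.add_apply, ih]; ring

theorem extD_neg (h : ∀ x f g, ρ x (f + g) = ρ x f + ρ x g) (P : List N → R) :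
    extD ρ br (-P) = -extD ρ br P := by
  funext l
  induction l generalizing P with
  | nil => simp [extD]
  | cons y l ih =>
    simp only [extD, con_neg, lieL_neg h, Pi.neg_apply, ih]; ring

theorem extD_sub (h : ∀ x f g, ρ x (f + g) = ρ x f + ρ x g) (P Q : List N → R) :
    extD ρ br (P - Q) = extD ρ br P - extD ρ br Q := by
  rw [sub_eq_add_neg, extD_add h, extD_neg h, sub_eq_add_neg]

theorem extD_sg (h : ∀ x f g, ρ x (f + g) = ρ x f + ρ x g) (P : List N → R) :
    extD ρ br (sg P) = -sg (extD ρ br P) := by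
  funext l
  induction l generalizing P with
  | nil => simp [extD, sg]
  | cons y l ih =>
    simp only [extD, con_sg, lieL_sg h, extD_neg h, Pi.neg_apply, ih]
    simp only [sg, extD, List.length_cons, pow_succ]
    ring

/-! ### Alternating multilinear functions on lists -/

variable [AddCommGroup N] [Module R N]

/-- Functions on lists that are alternating and multilinear in each degree. -/
structure IsAlt (P : List N → R) : Prop where
  swap : ∀ l x y l', P (l ++ x :: y :: l') = -P (l ++ y :: x :: l')
  add : ∀ l x y, P (l ++ [x + y]) = P (l ++ [x]) + P (l ++ [y])
  smul : ∀ l (c : R) x, P (l ++ [c • x]) = c * P (l ++ [x])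

namespace IsAlt

variable {P Q : List N → R}

theorem con (hP : IsAlt P) (x : N) : IsAlt (con x P) where
  swap l := hP.swap (x :: l)
  add l := hP.add (x :: l)
  smul l := hP.smul (x :: l)

theorem add' (hP : IsAlt P) (hQ : IsAlt Q) : IsAlt (P + Q) where
  swap l x y l' := by simp only [Pi.add_apply, hP.swap l x, hQ.swap l x]; ring
  add l x y := by simp only [Pi.add_apply, hP.add, hQ.add]; ring
  smul l c x := by simp only [Pi.add_apply, hP.smul, hQ.smul]; ring

theorem neg (hP : IsAlt P) : IsAlt (-P) where
  swap l x y l' := by simp only [Pi.neg_apply, hP.swap l x]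
  add l x y := by simp only [Pi.neg_apply, hP.add]; ring
  smul l c x := by simp only [Pi.neg_apply, hP.smul]; ring

theorem sg (hP : IsAlt P) : IsAlt (sg P) where
  swap l x y l' := by simp [TwistedJacobi.sg, hP.swap l x]
  add l x y := by simp [TwistedJacobi.sg, hP.add, mul_add]
  smul l c x := by simp [TwistedJacobi.sg, hP.smul]; ring

theorem move (hP : IsAlt P) (l : List N) (x : N) (l₁ l₂ : List N) :
    P (l ++ x :: (l₁ ++ l₂)) = (-1) ^ l₁.length * P (l ++ l₁ ++ x :: l₂) := by
  induction l₁ generalizing l with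
  | nil => simp
  | cons y l₁ ih =>
    rw [List.cons_append, hP.swap]
    have := ih (l ++ [y])
    simp only [List.append_assoc, List.singleton_append] at this
    rw [this]
    simp [pow_succ]

theorem cons_eq (hP : IsAlt P) (x : N) (l : List N) :
    P (x :: l) = (-1) ^ l.length * P (l ++ [x]) := by
  simpa using hP.move [] x l []

theorem mid_eq (hP : IsAlt P) (l : List N) (x : N) (l' : List N) :
    P (l ++ x :: l') = (-1) ^ l'.length * P (l ++ l' ++ [x]) := by
  simpa using hP.move l x l' []

theorem mid_add (hP : IsAlt P) (l : List N) (x y : N) (l' : List N) :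
    P (l ++ (x + y) :: l') = P (l ++ x :: l') + P (l ++ y :: l') := by
  rw [hP.mid_eq, hP.mid_eq l x, hP.mid_eq l y, hP.add]; ring

theorem mid_smul (hP : IsAlt P) (l : List N) (c : R) (x : N) (l' : List N) :
    P (l ++ (c • x) :: l') = c * P (l ++ x :: l') := by
  rw [hP.mid_eq, hP.mid_eq l x, hP.smul]; ring

theorem cons_add (hP : IsAlt P) (x y : N) (l : List N) :
    P ((x + y) :: l) = P (x :: l) + P (y :: l) := hP.mid_add [] x y l

theorem cons_smul (hP : IsAlt P) (c : R) (x : N) (l : List N) :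
    P ((c • x) :: l) = c * P (x :: l) := hP.mid_smul [] c x l

theorem cons_neg (hP : IsAlt P) (x : N) (l : List N) : P ((-x) :: l) = -P (x :: l) := by
  rw [← neg_one_smul R x, hP.cons_smul]; ring

theorem cons_sub (hP : IsAlt P) (x y : N) (l : List N) :
    P ((x - y) :: l) = P (x :: l) - P (y :: l) := by
  rw [sub_eq_add_neg, hP.cons_add, hP.cons_neg, sub_eq_add_neg]

theorem con_sub (hP : IsAlt P) (x y : N) :
    TwistedJacobi.con (x - y) P = TwistedJacobi.con x P - TwistedJacobi.con y P :=
  funext fun l => hP.cons_sub x y l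

theorem con_con (hP : IsAlt P) (x y : N) :
    TwistedJacobi.con x (TwistedJacobi.con y P) = -TwistedJacobi.con y (TwistedJacobi.con x P) :=
  funext fun l => hP.swap [] y x l

theorem insertIdx (hP : IsAlt P) (x : N) (l : List N) (m : ℕ) (hm : m ≤ l.length) :
    P (l.insertIdx m x) = (-1) ^ m * P (x :: l) := by
  induction m generalizing P l with
  | zero => simp
  | succ m ih =>
    cases l with
    | nil => simp at hm
    | cons y l =>
      have h := ih (hP.con y) l (by simpa using hm)
      simp only [con_apply] at h
      have h2 := hP.swap [] y x l
      simp only [List.nil_append] at h2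
      rw [List.insertIdx_succ_cons, h, pow_succ, h2]
      ring

theorem eq_zero_of_not_nodup [Algebra ℝ R] (hP : IsAlt P) (l : List N) (h : ¬ l.Nodup) :
    P l = 0 := by
  induction l generalizing P with
  | nil => simp at h
  | cons x l ih =>
    rw [List.nodup_cons, not_and_or, not_not] at h
    rcases h with h | h
    · obtain ⟨l₁, l₂, rfl⟩ := List.append_of_mem h
      have h1 := hP.move [] x l₁ (x :: l₂)
      have h2 := hP.swap l₁ x x l₂
      simp only [List.nil_append] at h1
      rw [h1]
      have h3 : P (l₁ ++ x :: x :: l₂) = 0 := by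
        -- Skew-symmetry only gives 2P = 0; the real algebra structure allows division by 2.
        have h4 : (2 : ℝ) • P (l₁ ++ x :: x :: l₂) = 0 := by
          rw [two_smul]; nth_rewrite 1 [h2]; simp
        have := congrArg (fun z => (2⁻¹ : ℝ) • z) h4
        simpa [smul_smul] using this
      rw [h3, mul_zero]
    · exact ih (hP.con x) h

/-- The alternating map in degree `k` given by an alternating function on lists. -/
theorem exists_alternatingMap [Algebra ℝ R] (hP : IsAlt P) (k : ℕ) :
    ∃ T : N [⋀^Fin k]→ₗ[R] R, ∀ v, T v = P (List.ofFn v) := by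
  have key : ∀ (v : Fin k → N) (i : Fin k) (x : N), ∃ l l', ∀ y,
      List.ofFn (Function.update v i y) = l ++ y :: l' := by
    intro v i x
    refine ⟨(List.ofFn v).take i, (List.ofFn v).drop (i + 1), fun y => ?_⟩
    have h1 : List.ofFn (Function.update v i y) = (List.ofFn v).set i y := by
      apply List.ext_getElem
      · simp
      · intro m h1 h2
        simp only [List.getElem_ofFn, List.getElem_set, Function.update_apply, Fin.ext_iff]
        by_cases h : m = i
        · simp [h]
        · simp [h, Ne.symm h]
    rw [h1, List.set_eq_take_append_cons_drop, if_pos (by simp)]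
  refine ⟨{ toFun := fun v => P (List.ofFn v), map_update_add' := ?_, map_update_smul' := ?_,
            map_eq_zero_of_eq' := ?_ }, fun v => rfl⟩
  · intro inst v i x y
    obtain rfl : inst = instDecidableEqFin k := Subsingleton.elim _ _
    obtain ⟨l, l', h⟩ := key v i x
    simp only [h, hP.mid_add]
  · intro inst v i c x
    obtain rfl : inst = instDecidableEqFin k := Subsingleton.elim _ _
    obtain ⟨l, l', h⟩ := key v i x
    simp only [h, hP.mid_smul, smul_eq_mul]
  · intro v i j h hij
    apply hP.eq_zero_of_not_nodup
    rw [List.nodup_ofFn]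
    exact fun hinj => hij (hinj h)

end IsAlt

/-- The action `ρ` of sections on functions, with symbol `a`, and a skew-symmetric bracket with
anchor `a`. -/
structure IsConnection (a ρ : N → R → R) (br : N → N → N) : Prop where
  add_right : ∀ x f g, ρ x (f + g) = ρ x f + ρ x g
  mul_right : ∀ x f g, ρ x (f * g) = f * ρ x g + a x f * g
  add_left : ∀ x y f, ρ (x + y) f = ρ x f + ρ y f
  smul_left : ∀ (c : R) x f, ρ (c • x) f = c * ρ x f
  skew : ∀ x y, br x y = -br y x
  br_add : ∀ x y z, br x (y + z) = br x y + br x z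
  br_smul : ∀ x (f : R) y, br x (f • y) = f • br x y + a x f • y

variable {P : List N → R}

/-- Linearity over functions holds because the Leibniz terms of the action and of the bracket have
the same symbol `a` and cancel. The zeroth-order part of `ρ` plays no role, so the twisted action is
covered. -/
theorem IsAlt.lieL (h : IsConnection a ρ br) (hP : IsAlt P) (x : N) :
    IsAlt (lieL ρ br x P) where
  swap l := by
    intro y z l'
    induction l generalizing P with
    | nil =>
      simp only [List.nil_append, TwistedJacobi.lieL, hP.con_con z y, lieL_neg h.add_right,
        Pi.neg_apply, con_apply]
      have h1 := hP.swap [] y (br x z) l'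
      have h2 := hP.swap [] (br x y) z l'
      simp only [List.nil_append] at h1 h2
      rw [h1, h2]; ring
    | cons w l ih =>
      have h1 := hP.swap (br x w :: l) y z l'
      simp only [List.cons_append, TwistedJacobi.lieL, ih (hP.con w)] at h1 ⊢
      rw [h1]; ring
  add l y z := by
    induction l generalizing P with
    | nil =>
      simp only [List.nil_append, TwistedJacobi.lieL, con_apply, hP.cons_add, h.add_right, h.br_add]
      ring
    | cons w l ih =>
      have h1 := hP.add (br x w :: l) y z
      simp only [List.cons_append, TwistedJacobi.lieL, ih (hP.con w)] at h1 ⊢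
      rw [h1]; ring
  smul l c y := by
    induction l generalizing P with
    | nil =>
      simp only [List.nil_append, TwistedJacobi.lieL, con_apply, hP.cons_add, hP.cons_smul,
        h.mul_right, h.br_smul]
      ring
    | cons w l ih =>
      have h1 := hP.smul (br x w :: l) c y
      simp only [List.cons_append, TwistedJacobi.lieL, ih (hP.con w)] at h1 ⊢
      rw [h1]; ring

/-- Two applications of Cartan's formula give i_z i_y d = L_y i_z - i_{[y,z]} - L_z i_y + d i_z i_y,
which is visibly skew in y and z. Additivity and linearity need only be checked in the last slot,
where the recursion ends in the action on a function. -/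
theorem IsAlt.extD (h : IsConnection a ρ br) (hP : IsAlt P) : IsAlt (extD ρ br P) where
  swap l := by
    intro y z l'
    induction l generalizing P with
    | nil =>
      simp only [List.nil_append, TwistedJacobi.extD, hP.con_con z y, extD_neg h.add_right, Pi.neg_apply, TwistedJacobi.lieL]
      rw [h.skew y z, hP.cons_neg]; ring
    | cons w l ih =>
      have h1 := (hP.lieL h w).swap l y z l'
      simp only [List.cons_append, TwistedJacobi.extD, ih (hP.con w)] at h1 ⊢
      rw [h1]; ring
  add l y z := by
    induction l generalizing P with
    | nil => simp only [List.nil_append, TwistedJacobi.extD, TwistedJacobi.lieL, h.add_left]; ring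
    | cons w l ih =>
      have h1 := (hP.lieL h w).add l y z
      simp only [List.cons_append, TwistedJacobi.extD, ih (hP.con w)] at h1 ⊢
      rw [h1]; ring
  smul l c y := by
    induction l generalizing P with
    | nil => simp only [List.nil_append, TwistedJacobi.extD, TwistedJacobi.lieL, h.smul_left]; ring
    | cons w l ih =>
      have h1 := (hP.lieL h w).smul l c y
      simp only [List.cons_append, TwistedJacobi.extD, ih (hP.con w)] at h1 ⊢
      rw [h1]; ring

end ListCalculus

end TwistedJacobi

namespace TwistedJacobi

/-! ### The wedge product by contractions -/

section WedgeLists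

variable {R N : Type*} [CommRing R]

/-- The wedge product of functions on lists, defined by its contractions. -/
def wedgeL : (List N → R) → (List N → R) → List N → R
  | P, Q, [] => P [] * Q []
  | P, Q, x :: l => wedgeL (con x P) Q l + wedgeL (sg P) (con x Q) l

theorem wedgeL_add_left (P P' Q : List N → R) (l : List N) :
    wedgeL (P + P') Q l = wedgeL P Q l + wedgeL P' Q l := by
  induction l generalizing P P' Q with
  | nil => simp [wedgeL, add_mul]
  | cons x l ih =>
    simp only [wedgeL, con_add, sg_add, ih]; ring

theorem wedgeL_add_right (P Q Q' : List N → R) (l : List N) :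
    wedgeL P (Q + Q') l = wedgeL P Q l + wedgeL P Q' l := by
  induction l generalizing P Q Q' with
  | nil => simp [wedgeL, mul_add]
  | cons x l ih => simp only [wedgeL, con_add, ih]; ring

theorem wedgeL_smul_left (c : R) (P Q : List N → R) (l : List N) :
    wedgeL (c • P) Q l = c * wedgeL P Q l := by
  induction l generalizing P Q with
  | nil => simp [wedgeL, mul_assoc]
  | cons x l ih =>
    have h : sg (c • P) = c • sg P := by funext l; simp [sg]; ring
    simp only [wedgeL, con_smul, h, ih]; ring

theorem wedgeL_smul_right (c : R) (P Q : List N → R) (l : List N) :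
    wedgeL P (c • Q) l = c * wedgeL P Q l := by
  induction l generalizing P Q with
  | nil => simp [wedgeL]; ring
  | cons x l ih => simp only [wedgeL, con_smul, ih]; ring

theorem wedgeL_neg_left (P Q : List N → R) (l : List N) :
    wedgeL (-P) Q l = -wedgeL P Q l := by
  rw [← neg_one_smul R P, wedgeL_smul_left]; ring

theorem wedgeL_neg_right (P Q : List N → R) (l : List N) :
    wedgeL P (-Q) l = -wedgeL P Q l := by
  rw [← neg_one_smul R Q, wedgeL_smul_right]; ring

theorem wedgeL_sub_left (P P' Q : List N → R) (l : List N) :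
    wedgeL (P - P') Q l = wedgeL P Q l - wedgeL P' Q l := by
  rw [sub_eq_add_neg, wedgeL_add_left, wedgeL_neg_left]; ring

theorem wedgeL_sub_right (P Q Q' : List N → R) (l : List N) :
    wedgeL P (Q - Q') l = wedgeL P Q l - wedgeL P Q' l := by
  rw [sub_eq_add_neg, wedgeL_add_right, wedgeL_neg_right]; ring

theorem con_wedgeL (x : N) (P Q : List N → R) :
    con x (wedgeL P Q) = wedgeL (con x P) Q + wedgeL (sg P) (con x Q) := rfl

variable [AddCommGroup N] [Module R N] {a : N → R → R} {br : N → N → N} {P Q : List N → R}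

theorem IsAlt.wedgeL (hP : IsAlt P) (hQ : IsAlt Q) : IsAlt (wedgeL P Q) where
  swap l := by
    intro x y l'
    induction l generalizing P Q with
    | nil =>
      simp only [List.nil_append, TwistedJacobi.wedgeL, con_sg, sg_sg, hP.con_con y x,
        hQ.con_con y x, wedgeL_neg_left, wedgeL_neg_right]
      ring
    | cons w l ih =>
      simp only [List.cons_append, TwistedJacobi.wedgeL, ih (hP.con w) hQ, ih hP.sg (hQ.con w)]
      ring
  add l y z := by
    induction l generalizing P Q with
    | nil =>
      simp only [List.nil_append, TwistedJacobi.wedgeL, con_apply, hP.cons_add, hQ.cons_add]; ring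
    | cons w l ih =>
      simp only [List.cons_append, TwistedJacobi.wedgeL, ih (hP.con w) hQ, ih hP.sg (hQ.con w)]
      ring
  smul l c y := by
    induction l generalizing P Q with
    | nil =>
      simp only [List.nil_append, TwistedJacobi.wedgeL, con_apply, hP.cons_smul, hQ.cons_smul]; ring
    | cons w l ih =>
      simp only [List.cons_append, TwistedJacobi.wedgeL, ih (hP.con w) hQ, ih hP.sg (hQ.con w)]
      ring

theorem lieL_wedgeL (h : IsConnection a a br) (x : N) (P Q : List N → R) :
    lieL a br x (wedgeL P Q) = wedgeL (lieL a br x P) Q + wedgeL P (lieL a br x Q) := by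
  funext l
  induction l generalizing P Q with
  | nil => simp only [lieL, wedgeL, Pi.add_apply, h.mul_right]; ring
  | cons y l ih =>
    simp only [lieL, con_wedgeL, lieL_add h.add_right, Pi.add_apply, ih, wedgeL, con_lieL,
      wedgeL_sub_left, wedgeL_sub_right, lieL_sg h.add_right]
    ring

/-- The differential is a graded derivation of the wedge product. -/
theorem extD_wedgeL (h : IsConnection a a br) (P Q : List N → R) (l : List N) :
    extD a br (wedgeL P Q) l = wedgeL (extD a br P) Q l + wedgeL (sg P) (extD a br Q) l := by
  induction l generalizing P Q with
  | nil => simp [extD, wedgeL]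
  | cons x l ih =>
    simp only [extD, con_wedgeL, lieL_wedgeL h, extD_add h.add_right, Pi.add_apply, ih, wedgeL,
      con_extD, wedgeL_sub_left, wedgeL_sub_right, con_sg, sg_sg, wedgeL_neg_left,
      extD_sg h.add_right]
    ring

end WedgeLists

/-! ### The Schouten bracket by contractions -/

noncomputable section SchoutenLists

variable {R A B : Type*} [CommRing R] [AddCommGroup A] [Module R A] [AddCommGroup B] [Module R B]
variable (pair : B →ₗ[R] A →ₗ[R] R)

/-- The element of `A` represented by the degree 1 part of `P`. -/
def hat (P : List B → R) : A := represent pair (fun b => P [b])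

variable {pair}

/-- Perfectness excludes the default value 0 in `represent`. -/
theorem pair_represent (hp : pair.IsPerfPair) (T : B →ₗ[R] R) (b : B) :
    pair b (represent pair (fun b => T b)) = T b := by
  have h : ∃ X : A, ∀ b : B, pair b X = T b := by
    obtain ⟨X, hX⟩ := hp.bijective_right.2 T
    exact ⟨X, fun b => by rw [← hX]; rfl⟩
  rw [represent, dif_pos h]
  exact h.choose_spec b

theorem ext_right (hp : pair.IsPerfPair) {X Y : A} (h : ∀ b, pair b X = pair b Y) : X = Y :=
  hp.bijective_right.1 (LinearMap.ext h)

theorem ext_left (hp : pair.IsPerfPair) {x y : B} (h : ∀ X, pair x X = pair y X) : x = y :=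
  hp.bijective_left.1 (LinearMap.ext h)

theorem pair_hat (hp : pair.IsPerfPair) {P : List B → R} (hP : IsAlt P) (b : B) :
    pair b (hat pair P) = P [b] :=
  pair_represent hp { toFun := fun b => P [b], map_add' := hP.add [], map_smul' := hP.smul [] } b

theorem hat_add (hp : pair.IsPerfPair) {P Q : List B → R} (hP : IsAlt P) (hQ : IsAlt Q) :
    hat pair (P + Q) = hat pair P + hat pair Q :=
  ext_right hp fun b => by simp [pair_hat hp, hP, hQ, hP.add' hQ]

theorem hat_neg (hp : pair.IsPerfPair) {P : List B → R} (hP : IsAlt P) :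
    hat pair (-P) = -hat pair P :=
  ext_right hp fun b => by simp [pair_hat hp, hP, hP.neg]

theorem hat_sg (hp : pair.IsPerfPair) {P : List B → R} (hP : IsAlt P) :
    hat pair (sg P) = -hat pair P :=
  ext_right hp fun b => by simp [pair_hat hp, hP, hP.sg, sg]

theorem hat_con_smul (hp : pair.IsPerfPair) {P : List B → R} (hP : IsAlt P) (c : R) (x : B) :
    hat pair (con (c • x) P) = c • hat pair (con x P) :=
  ext_right hp fun b => by simp [pair_hat hp, hP.con, hP.cons_smul]

theorem hat_con_add (hp : pair.IsPerfPair) {P : List B → R} (hP : IsAlt P) (x y : B) :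
    hat pair (con (x + y) P) = hat pair (con x P) + hat pair (con y P) :=
  ext_right hp fun b => by simp [pair_hat hp, hP.con, hP.cons_add]

/-- Skew-symmetric bilinear forms. -/
structure IsTwoForm (S : A → A → R) : Prop where
  skew : ∀ u v, S u v = -S v u
  add_left : ∀ u v w, S (u + v) w = S u w + S v w
  smul_left : ∀ (c : R) u w, S (c • u) w = c * S u w

namespace IsTwoForm

variable {S : A → A → R}

theorem add_right (h : IsTwoForm S) (u v w : A) : S u (v + w) = S u v + S u w := by
  rw [h.skew, h.add_left, h.skew v, h.skew w]; ring

theorem smul_right (h : IsTwoForm S) (c : R) (u w : A) : S u (c • w) = c * S u w := by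
  rw [h.skew, h.smul_left, h.skew w]; ring

theorem neg_left (h : IsTwoForm S) (u w : A) : S (-u) w = -S u w := by
  rw [← neg_one_smul R u, h.smul_left]; ring

theorem neg_right (h : IsTwoForm S) (u w : A) : S u (-w) = -S u w := by
  rw [← neg_one_smul R w, h.smul_right]; ring

end IsTwoForm

variable (pair)

/-- The pairing of a 2-form with one argument of `P` and one of `Q`. -/
def pairS (S : A → A → R) : (List B → R) → (List B → R) → List B → R
  | P, Q, [] => S (hat pair P) (hat pair Q)
  | P, Q, x :: l => pairS S (con x P) Q l + pairS S (sg P) (con x Q) l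

/-- The Schouten bracket on functions on lists, defined by its contractions. Here `j f` is the
modified differential of `f` and `τ x` that of `x`. -/
def schoutenL (j : R → B) (τ : B → A → A → R) : (List B → R) → (List B → R) → List B → R
  | P, Q, [] => P [j (Q [])] - Q [j (P [])]
  | P, Q, x :: l => schoutenL j τ (con x P) Q l - schoutenL j τ (sg P) (con x Q) l
      + pairS pair (τ x) (sg P) Q l

variable {pair}
variable {S S' : A → A → R} {P P' Q Q' : List B → R}

theorem con_pairS (x : B) : con x (pairS pair S P Q) =
    pairS pair S (con x P) Q + pairS pair S (sg P) (con x Q) := rfl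

theorem pairS_add_left (hp : pair.IsPerfPair) (hS : IsTwoForm S) (hP : IsAlt P) (hP' : IsAlt P')
    (l : List B) : pairS pair S (P + P') Q l = pairS pair S P Q l + pairS pair S P' Q l := by
  induction l generalizing P P' Q with
  | nil => simp only [pairS, hat_add hp hP hP', hS.add_left]
  | cons x l ih =>
    simp only [pairS, con_add, sg_add, ih (hP.con x) (hP'.con x), ih hP.sg hP'.sg]; ring

theorem pairS_add_right (hp : pair.IsPerfPair) (hS : IsTwoForm S) (hQ : IsAlt Q) (hQ' : IsAlt Q')
    (l : List B) : pairS pair S P (Q + Q') l = pairS pair S P Q l + pairS pair S P Q' l := by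
  induction l generalizing P Q Q' with
  | nil => simp only [pairS, hat_add hp hQ hQ', hS.add_right]
  | cons x l ih =>
    simp only [pairS, con_add, ih (hQ.con x) (hQ'.con x), ih hQ hQ']; ring

theorem pairS_neg_left (hp : pair.IsPerfPair) (hS : IsTwoForm S) (hP : IsAlt P)
    (l : List B) : pairS pair S (-P) Q l = -pairS pair S P Q l := by
  induction l generalizing P Q with
  | nil => simp only [pairS, hat_neg hp hP, hS.neg_left]
  | cons x l ih =>
    simp only [pairS, con_neg, sg_neg, ih (hP.con x), ih hP.sg]; ring

theorem pairS_neg_right (hp : pair.IsPerfPair) (hS : IsTwoForm S) (hQ : IsAlt Q)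
    (l : List B) : pairS pair S P (-Q) l = -pairS pair S P Q l := by
  induction l generalizing P Q with
  | nil => simp only [pairS, hat_neg hp hQ, hS.neg_right]
  | cons x l ih => simp only [pairS, con_neg, ih (hQ.con x), ih hQ]; ring

theorem pairS_sub_left (hp : pair.IsPerfPair) (hS : IsTwoForm S) (hP : IsAlt P) (hP' : IsAlt P')
    (l : List B) : pairS pair S (P - P') Q l = pairS pair S P Q l - pairS pair S P' Q l := by
  rw [sub_eq_add_neg, pairS_add_left hp hS hP hP'.neg, pairS_neg_left hp hS hP', sub_eq_add_neg]

theorem pairS_sub_right (hp : pair.IsPerfPair) (hS : IsTwoForm S) (hQ : IsAlt Q) (hQ' : IsAlt Q')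
    (l : List B) : pairS pair S P (Q - Q') l = pairS pair S P Q l - pairS pair S P Q' l := by
  rw [sub_eq_add_neg, pairS_add_right hp hS hQ hQ'.neg, pairS_neg_right hp hS hQ', sub_eq_add_neg]

theorem pairS_sub_form (S S' : A → A → R) (P Q : List B → R) (l : List B) :
    pairS pair (fun u v => S u v - S' u v) P Q l = pairS pair S P Q l - pairS pair S' P Q l := by
  induction l generalizing P Q with
  | nil => simp only [pairS]
  | cons x l ih => simp only [pairS, ih]; ring

theorem IsAlt.pairS (hp : pair.IsPerfPair) (hS : IsTwoForm S) (hP : IsAlt P) (hQ : IsAlt Q) :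
    IsAlt (pairS pair S P Q) where
  swap l := by
    intro x y l'
    induction l generalizing P Q with
    | nil =>
      simp only [List.nil_append, TwistedJacobi.pairS, con_sg, sg_sg, hP.con_con y x,
        hQ.con_con y x, pairS_neg_left hp hS (hP.con x).sg,
        pairS_neg_left hp hS (hP.con y).sg, pairS_neg_left hp hS ((hP.con y).con x),
        pairS_neg_right hp hS ((hQ.con y).con x)]
      ring
    | cons w l ih =>
      simp only [List.cons_append, TwistedJacobi.pairS, ih (hP.con w) hQ, ih hP.sg (hQ.con w)]
      ring
  add l y z := by
    induction l generalizing P Q with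
    | nil =>
      simp only [List.nil_append, TwistedJacobi.pairS, hat_con_add hp hP, hat_con_add hp hQ,
        hS.add_left, hS.add_right]
      ring
    | cons w l ih =>
      simp only [List.cons_append, TwistedJacobi.pairS, ih (hP.con w) hQ, ih hP.sg (hQ.con w)]
      ring
  smul l c y := by
    induction l generalizing P Q with
    | nil =>
      simp only [List.nil_append, TwistedJacobi.pairS, hat_con_smul hp hP, hat_con_smul hp hQ,
        hS.smul_left, hS.smul_right]
      ring
    | cons w l ih =>
      simp only [List.cons_append, TwistedJacobi.pairS, ih (hP.con w) hQ, ih hP.sg (hQ.con w)]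
      ring

variable {j : R → B} {τ : B → A → A → R}

theorem con_schoutenL (x : B) : con x (schoutenL pair j τ P Q) =
    schoutenL pair j τ (con x P) Q - schoutenL pair j τ (sg P) (con x Q)
      + pairS pair (τ x) (sg P) Q := rfl

theorem IsAlt.nil_add (hP : IsAlt P) (x y : B) : P [x + y] = P [x] + P [y] := hP.add [] x y

variable (hp : pair.IsPerfPair) (hj : ∀ f g, j (f + g) = j f + j g)
  (hτ : ∀ x, IsTwoForm (τ x))

include hp hj hτ

theorem schoutenL_add_left (hP : IsAlt P) (hP' : IsAlt P') (hQ : IsAlt Q) (l : List B) :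
    schoutenL pair j τ (P + P') Q l = schoutenL pair j τ P Q l + schoutenL pair j τ P' Q l := by
  induction l generalizing P P' Q with
  | nil => simp only [schoutenL, Pi.add_apply, hj, hQ.nil_add]; ring
  | cons x l ih =>
    simp only [schoutenL, con_add, sg_add, ih (hP.con x) (hP'.con x) hQ,
      ih hP.sg hP'.sg (hQ.con x), pairS_add_left hp (hτ x) hP.sg hP'.sg]
    ring

theorem schoutenL_add_right (hP : IsAlt P) (hQ : IsAlt Q) (hQ' : IsAlt Q') (l : List B) :
    schoutenL pair j τ P (Q + Q') l = schoutenL pair j τ P Q l + schoutenL pair j τ P Q' l := by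
  induction l generalizing P Q Q' with
  | nil => simp only [schoutenL, Pi.add_apply, hj, hP.nil_add]; ring
  | cons x l ih =>
    simp only [schoutenL, con_add, ih (hP.con x) hQ hQ',
      ih hP.sg (hQ.con x) (hQ'.con x), pairS_add_right hp (hτ x) hQ hQ']
    ring

theorem schoutenL_neg_left (hP : IsAlt P) (hQ : IsAlt Q) (l : List B) :
    schoutenL pair j τ (-P) Q l = -schoutenL pair j τ P Q l := by
  have h := schoutenL_add_left hp hj hτ hP.neg hP hQ l
  have h0 := schoutenL_add_left hp hj hτ (hP.neg.add' hP) (hP.neg.add' hP) hQ l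
  simp only [neg_add_cancel, add_zero] at h h0
  linear_combination -h - h0

theorem schoutenL_neg_right (hP : IsAlt P) (hQ : IsAlt Q) (l : List B) :
    schoutenL pair j τ P (-Q) l = -schoutenL pair j τ P Q l := by
  have h := schoutenL_add_right hp hj hτ hP hQ.neg hQ l
  have h0 := schoutenL_add_right hp hj hτ hP (hQ.neg.add' hQ) (hQ.neg.add' hQ) l
  simp only [neg_add_cancel, add_zero] at h h0
  linear_combination -h - h0

theorem schoutenL_sub_left (hP : IsAlt P) (hP' : IsAlt P') (hQ : IsAlt Q) (l : List B) :
    schoutenL pair j τ (P - P') Q l = schoutenL pair j τ P Q l - schoutenL pair j τ P' Q l := by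
  rw [sub_eq_add_neg, schoutenL_add_left hp hj hτ hP hP'.neg hQ,
    schoutenL_neg_left hp hj hτ hP' hQ, sub_eq_add_neg]

theorem schoutenL_sub_right (hP : IsAlt P) (hQ : IsAlt Q) (hQ' : IsAlt Q') (l : List B) :
    schoutenL pair j τ P (Q - Q') l = schoutenL pair j τ P Q l - schoutenL pair j τ P Q' l := by
  rw [sub_eq_add_neg, schoutenL_add_right hp hj hτ hP hQ hQ'.neg,
    schoutenL_neg_right hp hj hτ hP hQ', sub_eq_add_neg]

/-- The hypotheses are the Leibniz rules of `j` = d^φ on functions and of `τ` = d^φ on sections.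
Contracting with c • y produces derivatives of c in `j` and in `τ`; they cancel, as do the multiples
of φ by which d^φ fails to be a derivation. -/
theorem IsAlt.schoutenL {φ : B}
    (hj' : ∀ f g, j (f * g) = f • j g + g • j f - (f * g) • φ)
    (hτ_add : ∀ x y u v, τ (x + y) u v = τ x u v + τ y u v)
    (hτ_smul : ∀ c x u v, τ (c • x) u v = c * τ x u v + pair (j c - c • φ) u * pair x v
      - pair (j c - c • φ) v * pair x u)
    (hP : IsAlt P) (hQ : IsAlt Q) : IsAlt (schoutenL pair j τ P Q) where
  swap l := by
    intro x y l'
    induction l generalizing P Q with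
    | nil =>
      simp only [List.nil_append, TwistedJacobi.schoutenL, TwistedJacobi.pairS, con_sg, sg_sg,
        hP.con_con y x, hQ.con_con y x,
        schoutenL_neg_left hp hj hτ ((hP.con y).con x) hQ,
        schoutenL_neg_left hp hj hτ (hP.con x).sg (hQ.con y),
        schoutenL_neg_left hp hj hτ (hP.con y).sg (hQ.con x),
        schoutenL_neg_right hp hj hτ hP ((hQ.con y).con x),
        pairS_neg_left hp (hτ x) (hP.con y).sg, pairS_neg_left hp (hτ y) (hP.con x).sg]
      ring
    | cons w l ih =>
      have h1 := (IsAlt.pairS hp (hτ w) hP.sg hQ).swap l x y l'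
      simp only [List.cons_append, TwistedJacobi.schoutenL, ih (hP.con w) hQ,
        ih hP.sg (hQ.con w), h1]
      ring
  add l y z := by
    induction l generalizing P Q with
    | nil =>
      simp only [List.nil_append, TwistedJacobi.schoutenL, TwistedJacobi.pairS, con_apply,
        hP.cons_add, hQ.cons_add, hj, hτ_add, hP.sg.nil_add]
      ring
    | cons w l ih =>
      have h1 := (IsAlt.pairS hp (hτ w) hP.sg hQ).add l y z
      simp only [List.cons_append, TwistedJacobi.schoutenL, ih (hP.con w) hQ,
        ih hP.sg (hQ.con w), h1]
      ring
  smul l c y := by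
    induction l generalizing P Q with
    | nil =>
      simp only [List.nil_append, TwistedJacobi.schoutenL, TwistedJacobi.pairS, con_apply,
        hP.cons_smul, hQ.cons_smul, hj', hτ_smul, hat_sg hp hP, (hτ y).neg_left, map_neg,
        map_sub, map_smul, LinearMap.sub_apply, LinearMap.smul_apply, smul_eq_mul,
        pair_hat hp hP, pair_hat hp hQ, hP.sg.cons_sub, hP.sg.cons_add, hP.sg.cons_smul,
        hQ.cons_sub, hQ.cons_add, sg_nil]
      -- The pairing enters through `sg P`; this sign is what makes its dc terms opposite to those
      -- coming from `j`.
      have hs : ∀ z, TwistedJacobi.sg P [z] = -P [z] := fun z => by simp [TwistedJacobi.sg]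
      simp only [hs]
      ring
    | cons w l ih =>
      have h1 := (IsAlt.pairS hp (hτ w) hP.sg hQ).smul l c y
      simp only [List.cons_append, TwistedJacobi.schoutenL, ih (hP.con w) hQ,
        ih hP.sg (hQ.con w), h1]
      ring

end SchoutenLists

end TwistedJacobi

namespace TwistedJacobi

/-! ### The differential as a derivation of the Schouten bracket -/

noncomputable section DifferentialDerivation

variable {R A B : Type*} [CommRing R] [AddCommGroup A] [Module R A] [AddCommGroup B] [Module R B]

/-- The Lie derivative of a 2-form, for an action `ρ` on functions and `D` on sections. -/
def lieForm (ρ : B → R → R) (D : B → A → A) (x : B) (S : A → A → R) (u v : A) : R :=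
  ρ x (S u v) - S (D x u) v - S u (D x v)

/-- The relations between a bracket on `B` and the data of a Schouten bracket on its dual under which
the differential of the former is a derivation of the latter. -/
structure IsCompatible (pair : B →ₗ[R] A →ₗ[R] R) (j : R → B) (τ : B → A → A → R)
    (a ρ : B → R → R) (br : B → B → B) (D : B → A → A) : Prop extends IsConnection a ρ br where
  perfect : pair.IsPerfPair
  form : ∀ x, IsTwoForm (τ x)
  j_add : ∀ f g, j (f + g) = j f + j g
  action_j : ∀ f g, ρ (j f) g = -ρ (j g) f
  pair_D : ∀ x y u, pair y (D x u) = ρ x (pair y u) - pair (br x y) u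
  br_j : ∀ x f u v, (∀ y, pair y v = ρ y f) →
    pair (br x (j f)) u = pair (j (ρ x f)) u + τ x v u
  form_br : ∀ x y u v, τ (br x y) u v = lieForm ρ D x (τ y) u v - lieForm ρ D y (τ x) u v

variable {pair : B →ₗ[R] A →ₗ[R] R} {j : R → B} {τ : B → A → A → R}
    {a ρ : B → R → R} {br : B → B → B} {D : B → A → A} {P Q : List B → R}

theorem hat_lieL (h : IsCompatible pair j τ a ρ br D) (hP : IsAlt P) (x : B) :
    hat pair (lieL ρ br x P) = D x (hat pair P) :=
  ext_right h.perfect fun y => by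
    rw [pair_hat h.perfect (hP.lieL h.toIsConnection x), h.pair_D, pair_hat h.perfect hP,
      pair_hat h.perfect hP]
    simp [lieL]

/-- Since `D x` is dual to the bracket, L_x commutes with passing from a degree 1 function to the
section it represents (`hat_lieL`). Hence L_x is a derivation of the pairing jointly in S, P and Q.
-/
theorem lieL_pairS (h : IsCompatible pair j τ a ρ br D) {S : A → A → R} (hS : IsTwoForm S)
    (hP : IsAlt P) (hQ : IsAlt Q) (x : B) (l : List B) :
    lieL ρ br x (pairS pair S P Q) l = pairS pair S (lieL ρ br x P) Q l
      + pairS pair S P (lieL ρ br x Q) l + pairS pair (lieForm ρ D x S) P Q l := by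
  have hc := h.toIsConnection
  induction l generalizing P Q with
  | nil =>
    simp only [lieL, pairS, lieForm]
    rw [hat_lieL h hP, hat_lieL h hQ]; ring
  | cons y l ih =>
    simp only [lieL, con_pairS, lieL_add h.add_right, Pi.add_apply, ih (hP.con y) hQ,
      ih hP.sg (hQ.con y)]
    simp only [pairS, con_lieL, lieL_sg h.add_right,
      pairS_sub_left h.perfect hS ((hP.con y).lieL hc x) (hP.con _),
      pairS_sub_right h.perfect hS ((hQ.con y).lieL hc x) (hQ.con _)]
    ring

/-- The failure of the differential to be a derivation of the pairing with a 2-form. -/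
def pairDefect (pair : B →ₗ[R] A →ₗ[R] R) (ρ : B → R → R) (br : B → B → B) (S : A → A → R)
    (P Q : List B → R) (l : List B) : R :=
  extD ρ br (pairS pair S P Q) l - pairS pair S (extD ρ br P) Q l
    - pairS pair S (sg P) (extD ρ br Q) l

/-- In Cartan's formula for the three differentials the Lie derivatives of P and Q cancel and only
that of S survives. This recursion is the one met in `lieL_schoutenL`. -/
theorem pairDefect_cons (h : IsCompatible pair j τ a ρ br D) {S : A → A → R} (hS : IsTwoForm S)
    (hP : IsAlt P) (hQ : IsAlt Q) (x : B) (l : List B) :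
    pairDefect pair ρ br S P Q (x :: l) = pairS pair (lieForm ρ D x S) P Q l
      - pairDefect pair ρ br S (con x P) Q l - pairDefect pair ρ br S (sg P) (con x Q) l := by
  have hc := h.toIsConnection
  simp only [pairDefect, extD, lieL_pairS h hS hP hQ, con_pairS, extD_add h.add_right, Pi.add_apply]
  simp only [pairS, con_extD, con_sg, sg_sg, extD_sg h.add_right,
    pairS_sub_left h.perfect hS (hP.lieL hc x) ((hP.con x).extD hc),
    pairS_sub_right h.perfect hS (hQ.lieL hc x) ((hQ.con x).extD hc),
    pairS_neg_left h.perfect hS (hP.con x).sg,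
    pairS_neg_left h.perfect hS (hP.extD hc).sg]
  ring

theorem pairDefect_neg_left (h : IsCompatible pair j τ a ρ br D) {S : A → A → R} (hS : IsTwoForm S)
    (hP : IsAlt P) (l : List B) :
    pairDefect pair ρ br S (-P) Q l = -pairDefect pair ρ br S P Q l := by
  have hc := h.toIsConnection
  have h1 : pairS pair S (-P) Q = -pairS pair S P Q :=
    funext fun l => pairS_neg_left h.perfect hS hP l
  simp only [pairDefect, h1, extD_neg h.add_right, sg_neg,
    pairS_neg_left h.perfect hS (hP.extD hc), pairS_neg_left h.perfect hS hP.sg, Pi.neg_apply]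
  ring

theorem hat_extD (h : IsCompatible pair j τ a ρ br D) (hP : IsAlt P) (y : B) :
    pair y (hat pair (extD ρ br P)) = ρ y (P []) := by
  rw [pair_hat h.perfect (hP.extD h.toIsConnection)]
  simp [extD, lieL]

/-- Contracting with y brings in τ_{[x,y]} = L_x τ_y - L_y τ_x. The first term completes the
derivation rule for the pairing with τ_y; the second is the inhomogeneous term in the recursion of
`pairDefect` for τ_x. So the failure of L_x to be a derivation is that defect. -/
theorem lieL_schoutenL (h : IsCompatible pair j τ a ρ br D)
    (hP : IsAlt P) (hQ : IsAlt Q) (x : B) (l : List B) :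
    lieL ρ br x (schoutenL pair j τ P Q) l = schoutenL pair j τ (lieL ρ br x P) Q l
      + schoutenL pair j τ P (lieL ρ br x Q) l + pairDefect pair ρ br (τ x) (sg P) Q l := by
  have hc := h.toIsConnection
  have hj := h.j_add
  have hτ := h.form
  have hp := h.perfect
  induction l generalizing P Q with
  | nil =>
    -- In degree 0 the failure comes from [x, d^φ f] differing from d^φ(ρ_x f) by the contraction of
    -- τ_x with the section dual to the differential of f.
    have e1 : P [br x (j (Q []))] = P [j (ρ x (Q []))]
        + τ x (hat pair (extD ρ br Q)) (hat pair P) := by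
      rw [← pair_hat hp hP, ← pair_hat hp hP]
      exact h.br_j _ _ _ _ fun y => hat_extD h hQ y
    have e2 : Q [br x (j (P []))] = Q [j (ρ x (P []))]
        + τ x (hat pair (extD ρ br P)) (hat pair Q) := by
      rw [← pair_hat hp hQ, ← pair_hat hp hQ]
      exact h.br_j _ _ _ _ fun y => hat_extD h hP y
    simp only [lieL, schoutenL, pairDefect, pairS, extD, con_apply, sub_of_additive (h.add_right x),
      e1, e2, extD_sg h.add_right, sg_sg, hat_neg hp (hP.extD hc).sg, hat_sg hp (hP.extD hc)]
    rw [(hτ x).skew (hat pair P) (hat pair (extD ρ br Q)), neg_neg]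
    ring
  | cons y l ih =>
    rw [pairDefect_cons h (hτ x) hP.sg hQ, con_sg, pairDefect_neg_left h (hτ x) (hP.con y).sg]
    have key : pairS pair (τ (br x y)) (sg P) Q l = pairS pair (lieForm ρ D x (τ y)) (sg P) Q l
        - pairS pair (lieForm ρ D y (τ x)) (sg P) Q l := by
      rw [← pairS_sub_form]
      exact congrArg (fun S => pairS pair S (sg P) Q l)
        (funext fun u => funext fun v => h.form_br x y u v)
    simp only [lieL, con_schoutenL, lieL_add h.add_right, lieL_sub h.add_right, Pi.add_apply,
      Pi.sub_apply, ih (hP.con y) hQ, ih hP.sg (hQ.con y),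
      lieL_pairS h (hτ y) hP.sg hQ, schoutenL, con_lieL, lieL_sg h.add_right, key,
      schoutenL_sub_left hp hj hτ ((hP.con y).lieL hc x) (hP.con _) hQ,
      schoutenL_sub_right hp hj hτ hP.sg ((hQ.con y).lieL hc x) (hQ.con _), sg_sg]
    ring

/-- The differential is a derivation of the Schouten bracket. -/
theorem extD_schoutenL (h : IsCompatible pair j τ a ρ br D)
    (hP : IsAlt P) (hQ : IsAlt Q) (l : List B) :
    extD ρ br (schoutenL pair j τ P Q) l = schoutenL pair j τ (extD ρ br P) Q l
      - schoutenL pair j τ (sg P) (extD ρ br Q) l := by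
  have hc := h.toIsConnection
  have hj := h.j_add
  have hτ := h.form
  have hp := h.perfect
  induction l generalizing P Q with
  | nil =>
    have h0 : j 0 = 0 := by simpa using hj 0 0
    have hP0 : ∀ {P : List B → R}, IsAlt P → P [0] = 0 := fun {P} hP => by
      simpa using hP.smul [] 0 0
    simp only [extD, schoutenL, h0, lieL, hP0 hQ, hP0 hP.sg, sg_nil]
    -- On the empty list both sides concern functions f, g, and the claim is that ρ_{jf} g is skew
    -- in f and g.
    rw [h.action_j]; ring
  | cons x l ih =>
    -- In i_x d = L_x - d i_x, the differential of the pairing with τ_x occurs twice with opposite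
    -- signs: in the defect of L_x, and in d applied to the last term of i_x[P,Q]. What remains of
    -- the defect supplies the τ_x terms of [dP,Q] and [P,dQ].
    simp only [extD, con_schoutenL, extD_add h.add_right, extD_sub h.add_right, Pi.add_apply,
      Pi.sub_apply, ih (hP.con x) hQ, ih hP.sg (hQ.con x), lieL_schoutenL h hP hQ, pairDefect,
      schoutenL, con_extD, con_sg, sg_sg, extD_sg h.add_right,
      schoutenL_sub_left hp hj hτ (hP.lieL hc x) ((hP.con x).extD hc) hQ,
      schoutenL_neg_left hp hj hτ (hP.extD hc).sg (hQ.con x),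
      schoutenL_neg_left hp hj hτ (hP.con x).sg (hQ.extD hc),
      schoutenL_sub_right hp hj hτ hP (hQ.lieL hc x) ((hQ.con x).extD hc),
      pairS_neg_left hp (hτ x) (hP.extD hc).sg]
    ring

end DifferentialDerivation

end TwistedJacobi

namespace TwistedJacobi

/-! ### Sums over permutations and unshuffles -/

section Antisymmetrization

variable {R N : Type*} [CommRing R]

/-- The signed sum of `f` over all rearrangements of a list. -/
def asym : List N → (List N → R) → R
  | [], f => f []
  | x :: l, f => ∑ m ∈ Finset.range (l.length + 1), (-1) ^ m * asym l (fun l' => f (l'.insertIdx m x))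

theorem asym_congr (l : List N) {f g : List N → R} (h : ∀ l', l'.length = l.length → f l' = g l') :
    asym l f = asym l g := by
  induction l generalizing f g with
  | nil => exact h [] rfl
  | cons x l ih =>
    refine Finset.sum_congr rfl fun m hm => ?_
    rw [ih fun l' hl' => h _ ?_]
    rw [List.length_insertIdx_of_le_length (by rw [hl']; simpa [Nat.lt_succ_iff] using hm), hl']
    rfl

theorem asym_mul (l : List N) (c : R) (f : List N → R) :
    asym l (fun l' => c * f l') = c * asym l f := by
  induction l generalizing f with
  | nil => rfl
  | cons x l ih =>
    simp only [asym, ih, Finset.mul_sum]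
    exact Finset.sum_congr rfl fun m _ => by ring

theorem ofFn_insertNth {n : ℕ} (m : Fin (n + 1)) (x : N) (v : Fin n → N) :
    List.ofFn (m.insertNth x v : Fin (n + 1) → N) = (List.ofFn v).insertIdx m x := by
  have hm : (m : ℕ) ≤ (List.ofFn v).length := by simpa using Nat.lt_succ_iff.1 m.2
  apply List.ext_getElem
  · rw [List.length_insertIdx_of_le_length hm]; simp
  · intro i h1 h2
    have hi : i < n + 1 := by simpa using h1
    rw [List.getElem_ofFn, List.getElem_insertIdx]
    rcases lt_trichotomy i m with h | h | h
    · have : (⟨i, hi⟩ : Fin (n + 1)) = m.succAbove ⟨i, by omega⟩ := by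
        rw [Fin.succAbove_of_castSucc_lt _ _ (by simpa [Fin.lt_def] using h)]; rfl
      rw [this, Fin.insertNth_apply_succAbove, dif_pos h, List.getElem_ofFn]
    · have : (⟨i, hi⟩ : Fin (n + 1)) = m := Fin.ext h
      rw [this, Fin.insertNth_apply_same, dif_neg (by omega), dif_pos h]
    · have : (⟨i, hi⟩ : Fin (n + 1)) = m.succAbove ⟨i - 1, by omega⟩ := by
        rw [Fin.succAbove_of_le_castSucc _ _ (by simp [Fin.le_def]; omega)]
        ext; simp; omega
      rw [this, Fin.insertNth_apply_succAbove, dif_neg (by omega), dif_neg (by omega),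
        List.getElem_ofFn]

/-- A permutation of `Fin (n + 1)` is determined by the preimage m of 0 and the permutation induced
on the other points. The cycle on 0, …, m has sign (-1)^m, which is the sign of inserting the head
of a list at position m in `asym`. -/
theorem bijective_decomposeFin_mul_cycleRange (n : ℕ) :
    Function.Bijective fun p : Fin (n + 1) × Equiv.Perm (Fin n) =>
      Equiv.Perm.decomposeFin.symm (0, p.2) * Fin.cycleRange p.1 := by
  rw [Fintype.bijective_iff_injective_and_card]
  constructor
  · rintro ⟨m, s⟩ ⟨m', s'⟩ h
    have h0 : ∀ m : Fin (n + 1), ∀ s,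
        (Equiv.Perm.decomposeFin.symm (0, s) * Fin.cycleRange m : Equiv.Perm (Fin (n + 1))) m = 0 :=
      fun m s => by simp [Equiv.Perm.mul_apply]
    have hm : m = m' := by
      apply (Equiv.Perm.decomposeFin.symm (0, s) * Fin.cycleRange m : Equiv.Perm (Fin (n + 1))).injective
      rw [h0]
      exact (h0 m' s').symm.trans (congrArg (fun t : Equiv.Perm (Fin (n + 1)) => t m') h.symm)
    subst hm
    have := mul_right_cancel h
    simpa using this
  · simp [Fintype.card_perm, Nat.factorial_succ]

theorem sum_perm_eq_asym {k : ℕ} (α : Fin k → N) (f : List N → R) :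
    ∑ s : Equiv.Perm (Fin k), Equiv.Perm.sign s • f (List.ofFn fun i => α (s i))
      = asym (List.ofFn α) f := by
  induction k generalizing f with
  | zero => simp [asym]
  | succ k ih =>
    rw [← (bijective_decomposeFin_mul_cycleRange k).sum_comp, Fintype.sum_prod_type]
    have hα : α = Fin.cons (α 0) (Fin.tail α) := (Fin.cons_self_tail α).symm
    rw [hα, List.ofFn_cons, asym, List.length_ofFn, Finset.sum_range]
    refine Finset.sum_congr rfl fun m _ => ?_
    rw [← ih, Finset.mul_sum]
    refine Finset.sum_congr rfl fun s _ => ?_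
    have h1 : (fun i => (Fin.cons (α 0) (Fin.tail α) : Fin (k + 1) → N)
        ((Equiv.Perm.decomposeFin.symm (0, s) * Fin.cycleRange m) i))
        = m.insertNth (α 0) (fun i => Fin.tail α (s i)) := by
      rw [← Fin.cons_comp_cycleRange]
      funext i
      simp only [Equiv.Perm.mul_apply, Function.comp]
      refine Fin.cases ?_ (fun i => ?_) (m.cycleRange i) <;> simp
    simp only [h1, ofFn_insertNth, Equiv.Perm.sign_mul, Fin.sign_cycleRange,
      Equiv.Perm.decomposeFin.symm_sign]
    simp [mul_smul, Units.smul_def, mul_comm]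

/-- The signed sum over the distributions of a list into three blocks. -/
def unshuffle : (List N → List N → List N → R) → List N → R
  | G, [] => G [] [] []
  | G, x :: l => unshuffle (fun a c b => G (x :: a) c b) l
      + unshuffle (fun a c b => (-1) ^ a.length * G a (x :: c) b) l
      + unshuffle (fun a c b => (-1) ^ (a.length + c.length) * G a c (x :: b)) l

theorem unshuffle_zero (l : List N) : unshuffle (fun _ _ _ => (0 : R)) l = 0 := by
  induction l with
  | nil => rfl
  | cons x l ih => simp only [unshuffle, mul_zero, ih, add_zero]

theorem unshuffle_mul (c : R) (G : List N → List N → List N → R) (l : List N) :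
    unshuffle (fun x y z => c * G x y z) l = c * unshuffle G l := by
  induction l generalizing G with
  | nil => rfl
  | cons x l ih =>
    simp only [unshuffle, mul_left_comm _ c, ih]; ring

/-- Functions of three lists of lengths `p`, `r`, `q` that are alternating in each. -/
structure IsBlockAlt (p r q : ℕ) (G : List N → List N → List N → R) : Prop where
  left : ∀ a c b x m, m ≤ a.length → G (a.insertIdx m x) c b = (-1) ^ m * G (x :: a) c b
  mid : ∀ a c b x m, m ≤ c.length → G a (c.insertIdx m x) b = (-1) ^ m * G a (x :: c) b
  right : ∀ a c b x m, m ≤ b.length → G a c (b.insertIdx m x) = (-1) ^ m * G a c (x :: b)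
  left_length : ∀ a c b, a.length ≠ p → G a c b = 0
  mid_length : ∀ a c b, c.length ≠ r → G a c b = 0
  right_length : ∀ a c b, b.length ≠ q → G a c b = 0

namespace IsBlockAlt

variable {p r q : ℕ} {G : List N → List N → List N → R}

theorem cons_left (h : IsBlockAlt (p + 1) r q G) (x : N) :
    IsBlockAlt p r q (fun a c b => G (x :: a) c b) where
  left a c b y m hm := by
    have h1 := h.left (x :: a) c b y (m + 1) (by simpa using hm)
    have h2 := h.left (y :: a) c b x 1 (by simp)
    simp only [List.insertIdx_succ_cons, List.insertIdx_zero] at h1 h2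
    rw [h1, h2]; ring
  mid a c b := h.mid _ c b
  right a c b := h.right _ c b
  left_length a c b ha := h.left_length _ _ _ (by simpa using ha)
  mid_length a c b := h.mid_length _ c b
  right_length a c b := h.right_length _ c b

theorem cons_mid (h : IsBlockAlt p (r + 1) q G) (x : N) :
    IsBlockAlt p r q (fun a c b => G a (x :: c) b) where
  mid a c b y m hm := by
    have h1 := h.mid a (x :: c) b y (m + 1) (by simpa using hm)
    have h2 := h.mid a (y :: c) b x 1 (by simp)
    simp only [List.insertIdx_succ_cons, List.insertIdx_zero] at h1 h2
    rw [h1, h2]; ring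
  left a c b := h.left a _ b
  right a c b := h.right a _ b
  mid_length a c b ha := h.mid_length _ _ _ (by simpa using ha)
  left_length a c b := h.left_length a _ b
  right_length a c b := h.right_length a _ b

theorem cons_right (h : IsBlockAlt p r (q + 1) G) (x : N) :
    IsBlockAlt p r q (fun a c b => G a c (x :: b)) where
  right a c b y m hm := by
    have h1 := h.right a c (x :: b) y (m + 1) (by simpa using hm)
    have h2 := h.right a c (y :: b) x 1 (by simp)
    simp only [List.insertIdx_succ_cons, List.insertIdx_zero] at h1 h2
    rw [h1, h2]; ring
  left a c b := h.left a c _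
  mid a c b := h.mid a c _
  right_length a c b ha := h.right_length _ _ _ (by simpa using ha)
  left_length a c b := h.left_length a c _
  mid_length a c b := h.mid_length a c _

end IsBlockAlt

theorem take_insertIdx (l : List N) (x : N) (m p : ℕ) (hm : m ≤ p) :
    (l.insertIdx m x).take (p + 1) = (l.take p).insertIdx m x := by
  induction m generalizing l p with
  | zero => simp
  | succ m ih =>
    cases l with
    | nil => simp
    | cons y l =>
      obtain ⟨p, rfl⟩ : ∃ p', p = p' + 1 := ⟨p - 1, by omega⟩
      simp [List.insertIdx_succ_cons, ih l p (by omega)]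

theorem drop_insertIdx (l : List N) (x : N) (m p : ℕ) (hm : m ≤ p) (hp : p ≤ l.length) :
    (l.insertIdx m x).drop (p + 1) = l.drop p := by
  induction m generalizing l p with
  | zero => simp
  | succ m ih =>
    cases l with
    | nil => simp at hp; omega
    | cons y l =>
      obtain ⟨p, rfl⟩ : ∃ p', p = p' + 1 := ⟨p - 1, by omega⟩
      simp [List.insertIdx_succ_cons, ih l p (by omega) (by simpa using hp)]

theorem take_insertIdx_add (l : List N) (x : N) (m p : ℕ) (hp : p ≤ l.length) :
    (l.insertIdx (p + m) x).take p = l.take p := by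
  induction p generalizing l with
  | zero => simp
  | succ p ih =>
    cases l with
    | nil => simp at hp
    | cons y l =>
      rw [show p + 1 + m = p + m + 1 by omega]
      simp [List.insertIdx_succ_cons, ih l (by simpa using hp)]

theorem drop_insertIdx_add (l : List N) (x : N) (m p : ℕ) (hp : p ≤ l.length) :
    (l.insertIdx (p + m) x).drop p = (l.drop p).insertIdx m x := by
  induction p generalizing l with
  | zero => simp
  | succ p ih =>
    cases l with
    | nil => simp at hp
    | cons y l =>
      rw [show p + 1 + m = p + m + 1 by omega]
      simp [List.insertIdx_succ_cons, ih l (by simpa using hp)]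

theorem sum_asym_sign (l : List N) (n s : ℕ) (f : ℕ → List N → R) (F : List N → R)
    (h : ∀ m < n, ∀ l', l'.length = l.length → f m l' = (-1) ^ m * F l') :
    ∑ m ∈ Finset.range n, (-1) ^ (s + m) * asym l (f m) = n * ((-1) ^ s * asym l F) := by
  rw [Finset.sum_congr rfl (g := fun _ => (-1) ^ s * asym l F), Finset.sum_const, Finset.card_range,
    nsmul_eq_mul]
  intro m hm
  rw [asym_congr l (h m (Finset.mem_range.1 hm)), asym_mul, pow_add]
  have : ((-1 : R) ^ m) * (-1) ^ m = 1 := by rw [← mul_pow]; simp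
  linear_combination ((-1) ^ s * asym l F) * this

/-- The p + r + q positions for the head fall into three ranges according to the block that receives
it. Within a range, moving the head to the front of its block makes all terms equal. The number of
positions times the factorial for the shortened block is the factorial for the full block. -/
theorem asym_block (l : List N) (p r q : ℕ) {G : List N → List N → List N → R}
    (h : IsBlockAlt p r q G) (hl : l.length = p + r + q) :
    asym l (fun l' => G (l'.take p) ((l'.drop p).take r) ((l'.drop p).drop r))
      = p.factorial * r.factorial * q.factorial * unshuffle G l := by
  induction l generalizing p r q G with
  | nil =>
    obtain ⟨⟨rfl, rfl⟩, rfl⟩ : (p = 0 ∧ r = 0) ∧ q = 0 := by simp at hl; omega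
    simp [asym, unshuffle]
  | cons x l ih =>
    have hl' : l.length + 1 = p + r + q := by simpa using hl
    rw [asym, hl', Finset.sum_range_add, Finset.sum_range_add, unshuffle]
    have e1 : ∑ m ∈ Finset.range p, (-1) ^ m * asym l (fun l' =>
        G ((l'.insertIdx m x).take p) (((l'.insertIdx m x).drop p).take r)
          (((l'.insertIdx m x).drop p).drop r))
        = p.factorial * r.factorial * q.factorial * unshuffle (fun a c b => G (x :: a) c b) l := by
      -- If the block has length 0 the sum is empty, and the unshuffle term vanishes because `G`
      -- does on a block of the wrong length. The other two ranges are treated alike.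
      rcases p with _ | p
      · have : (fun a c b => G (x :: a) c b) = fun _ _ _ => 0 := by
          funext a c b; exact h.left_length _ _ _ (by simp)
        rw [this, unshuffle_zero]; simp
      · have := sum_asym_sign l (p + 1) 0 (fun m l' =>
          G ((l'.insertIdx m x).take (p + 1)) (((l'.insertIdx m x).drop (p + 1)).take r)
          (((l'.insertIdx m x).drop (p + 1)).drop r))
          (fun l' => G (x :: l'.take p) ((l'.drop p).take r) ((l'.drop p).drop r)) ?_
        · simp only [zero_add, pow_zero, one_mul] at this
          rw [this, ih p r q (h.cons_left x) (by omega), Nat.factorial_succ]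
          push_cast; ring
        · intro m hm l' hl''
          rw [take_insertIdx _ _ _ _ (by omega), drop_insertIdx _ _ _ _ (by omega) (by omega),
            h.left _ _ _ _ _ (by rw [List.length_take]; omega)]
    have e2 : ∑ m ∈ Finset.range r, (-1) ^ (p + m) * asym l (fun l' =>
        G ((l'.insertIdx (p + m) x).take p) (((l'.insertIdx (p + m) x).drop p).take r)
          (((l'.insertIdx (p + m) x).drop p).drop r))
        = p.factorial * r.factorial * q.factorial *
          unshuffle (fun a c b => (-1) ^ a.length * G a (x :: c) b) l := by
      have : (fun a c b => (-1) ^ a.length * G a (x :: c) b) =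
          fun a c b => (-1) ^ p * G a (x :: c) b := by
        funext a c b
        by_cases ha : a.length = p
        · rw [ha]
        · rw [h.left_length _ _ _ ha]; simp
      rw [this, unshuffle_mul]
      rcases r with _ | r
      · have : (fun a c b => G a (x :: c) b) = fun _ _ _ => 0 := by
          funext a c b; exact h.mid_length _ _ _ (by simp)
        rw [this, unshuffle_zero]; simp
      · have := sum_asym_sign l (r + 1) p (fun m l' =>
          G ((l'.insertIdx (p + m) x).take p) (((l'.insertIdx (p + m) x).drop p).take (r + 1))
          (((l'.insertIdx (p + m) x).drop p).drop (r + 1)))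
          (fun l' => G (l'.take p) (x :: (l'.drop p).take r) ((l'.drop p).drop r)) ?_
        · rw [this, ih p r q (h.cons_mid x) (by omega), Nat.factorial_succ]
          push_cast; ring
        · intro m hm l' hl''
          rw [take_insertIdx_add _ _ _ _ (by omega), drop_insertIdx_add _ _ _ _ (by omega),
            take_insertIdx _ _ _ _ (by omega),
            drop_insertIdx _ _ _ _ (by omega) (by rw [List.length_drop]; omega),
            h.mid _ _ _ _ _ (by rw [List.length_take, List.length_drop]; omega)]
    have e3 : ∑ m ∈ Finset.range q, (-1) ^ (p + r + m) * asym l (fun l' =>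
        G ((l'.insertIdx (p + r + m) x).take p) (((l'.insertIdx (p + r + m) x).drop p).take r)
          (((l'.insertIdx (p + r + m) x).drop p).drop r))
        = p.factorial * r.factorial * q.factorial *
          unshuffle (fun a c b => (-1) ^ (a.length + c.length) * G a c (x :: b)) l := by
      have : (fun a c b => (-1) ^ (a.length + c.length) * G a c (x :: b)) =
          fun a c b => (-1) ^ (p + r) * G a c (x :: b) := by
        funext a c b
        by_cases ha : a.length = p
        · by_cases hc : c.length = r
          · rw [ha, hc]
          · rw [h.mid_length _ _ _ hc]; simp
        · rw [h.left_length _ _ _ ha]; simp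
      rw [this, unshuffle_mul]
      rcases q with _ | q
      · have : (fun a c b => G a c (x :: b)) = fun _ _ _ => 0 := by
          funext a c b; exact h.right_length _ _ _ (by simp)
        rw [this, unshuffle_zero]; simp
      · have := sum_asym_sign l (q + 1) (p + r) (fun m l' =>
          G ((l'.insertIdx (p + r + m) x).take p) (((l'.insertIdx (p + r + m) x).drop p).take r)
          (((l'.insertIdx (p + r + m) x).drop p).drop r))
          (fun l' => G (l'.take p) ((l'.drop p).take r) (x :: (l'.drop p).drop r)) ?_
        · rw [this, ih p r q (h.cons_right x) (by omega), Nat.factorial_succ]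
          push_cast; ring
        · intro m hm l' hl''
          rw [add_assoc p r m, take_insertIdx_add _ _ _ _ (by omega),
            drop_insertIdx_add _ _ _ _ (by omega),
            take_insertIdx_add _ _ _ _ (by rw [List.length_drop]; omega),
            drop_insertIdx_add _ _ _ _ (by rw [List.length_drop]; omega),
            h.right _ _ _ _ _ (by rw [List.length_drop, List.length_drop]; omega)]
    rw [e1, e2, e3]; ring

end Antisymmetrization

end TwistedJacobi

namespace TwistedJacobi

/-! ### From functions of tuples to functions on lists -/

noncomputable section TupleLists

variable {R N : Type*} [CommRing R]

/-- A function of `p` arguments as a function on lists, supported on lists of length `p`. -/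
def toL {p : ℕ} (P : (Fin p → N) → R) (l : List N) : R :=
  if h : l.length = p then P (fun i => l.get (i.cast h.symm)) else 0

theorem toL_ofFn {p : ℕ} (P : (Fin p → N) → R) (v : Fin p → N) : toL P (List.ofFn v) = P v := by
  rw [toL, dif_pos (by simp)]
  congr 1; funext i; simp

theorem toL_of_length_ne {p : ℕ} (P : (Fin p → N) → R) {l : List N} (h : l.length ≠ p) :
    toL P l = 0 := dif_neg h

theorem eq_ofFn {p : ℕ} {l : List N} (h : l.length = p) : ∃ v : Fin p → N, l = List.ofFn v := by
  subst h; exact ⟨l.get, (List.ofFn_get l).symm⟩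

theorem toL_eq_iff {p : ℕ} (P : (Fin p → N) → R) (F : List N → R)
    (h0 : ∀ l, l.length ≠ p → F l = 0) (h : ∀ v, P v = F (List.ofFn v)) : toL P = F := by
  funext l
  by_cases hl : l.length = p
  · obtain ⟨v, rfl⟩ := eq_ofFn hl
    rw [toL_ofFn, h]
  · rw [toL_of_length_ne P hl, h0 l hl]

theorem con_toL {p : ℕ} (P : (Fin (p + 1) → N) → R) (x : N) :
    con x (toL P) = toL (contract x P) := by
  symm
  refine toL_eq_iff _ _ (fun l hl => toL_of_length_ne _ (by simpa using hl)) fun v => ?_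
  rw [con_apply, ← List.ofFn_cons, toL_ofFn]; rfl

theorem con_toL_zero (P : (Fin 0 → N) → R) (x : N) : con x (toL P) = 0 :=
  funext fun l => toL_of_length_ne _ (by simp)

theorem toL_nil (P : (Fin 0 → N) → R) (v : Fin 0 → N) : toL P [] = P v := by
  rw [← toL_ofFn P v]; simp

section Alternating

variable [AddCommGroup N] [Module R N]

theorem contract_coe {p : ℕ} (P : N [⋀^Fin (p + 1)]→ₗ[R] R) (x : N) :
    contract x P = ⇑(P.curryLeft x) := rfl

theorem isAlt_toL {p : ℕ} (P : N [⋀^Fin p]→ₗ[R] R) : IsAlt (toL P) where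
  swap l := by
    intro x y l'
    induction l generalizing p P with
    | nil =>
      simp only [List.nil_append]
      by_cases h : l'.length + 2 = p
      · subst h
        obtain ⟨v, hv⟩ := eq_ofFn (l := l') rfl
        generalize l'.length = m at v P hv
        subst hv
        rw [← List.ofFn_cons, ← List.ofFn_cons, ← List.ofFn_cons, ← List.ofFn_cons, toL_ofFn,
          toL_ofFn, ← P.map_swap _ (show (0 : Fin (m + 2)) ≠ 1 by simp)]
        congr 1; funext i
        refine Fin.cases ?_ (fun i => ?_) i
        · simp only [Function.comp, Equiv.swap_apply_left]; rfl
        · refine Fin.cases ?_ (fun i => ?_) i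
          · simp only [Function.comp, Fin.succ_zero_eq_one, Equiv.swap_apply_right]; rfl
          · rw [Function.comp, Equiv.swap_apply_of_ne_of_ne] <;> simp [Fin.ext_iff]
      · rw [toL_of_length_ne _ (by simpa using h), toL_of_length_ne _ (by simpa using h), neg_zero]
    | cons a l ih =>
      rcases p with _ | p
      · rw [toL_of_length_ne _ (by simp), toL_of_length_ne _ (by simp), neg_zero]
      · have := ih (P.curryLeft a)
        rwa [← contract_coe, ← con_toL] at this
  add l x y := by
    induction l generalizing p P with
    | nil =>
      by_cases h : p = 1
      · subst h
        have e : ∀ z : N, [] ++ [z] = List.ofFn (Function.update (fun _ : Fin 1 => (0 : N)) 0 z) := by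
          intro z; simp
        simp only [e, toL_ofFn, P.map_update_add]
      · simp [toL_of_length_ne, Ne.symm h]
    | cons a l ih =>
      rcases p with _ | p
      · simp [toL_of_length_ne]
      · have := ih (P.curryLeft a)
        rwa [← contract_coe, ← con_toL] at this
  smul l c x := by
    induction l generalizing p P with
    | nil =>
      by_cases h : p = 1
      · subst h
        have e : ∀ z : N, [] ++ [z] = List.ofFn (Function.update (fun _ : Fin 1 => (0 : N)) 0 z) := by
          intro z; simp
        simp only [e, toL_ofFn, P.map_update_smul, smul_eq_mul]
      · simp [toL_of_length_ne, Ne.symm h]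
    | cons a l ih =>
      rcases p with _ | p
      · simp [toL_of_length_ne]
      · have := ih (P.curryLeft a)
        rwa [← contract_coe, ← con_toL] at this

variable {ρ : N → R → R} {br : N → N → N}

omit [AddCommGroup N] [Module R N] in
theorem lieL_toL {p : ℕ} (P : (Fin p → N) → R) (x : N) (w : Fin p → N) :
    lieL ρ br x (toL P) (List.ofFn w)
      = ρ x (P w) - ∑ i, P (Function.update w i (br x (w i))) := by
  induction p with
  | zero => simp [lieL, toL_nil P w]
  | succ p ih =>
    rw [← Fin.cons_self_tail w, List.ofFn_cons, lieL, con_toL, ih, Fin.sum_univ_succ,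
      ← List.ofFn_cons, toL_ofFn]
    simp only [Fin.cons_zero, Fin.cons_succ, Fin.update_cons_zero, ← Fin.cons_update, contract]
    ring

/-- The classical formula for the differential of an alternating map satisfies Cartan's formula. -/
theorem differential_eq_extD {p : ℕ} (P : N [⋀^Fin p]→ₗ[R] R) (v : Fin (p + 1) → N) :
    differential ρ br P v = extD ρ br (toL P) (List.ofFn v) := by
  induction p with
  | zero =>
    simp only [differential, extD, List.ofFn_succ, List.ofFn_zero, lieL, Fin.sum_univ_succ,
      Fin.sum_univ_zero]
    rw [toL_nil P (fun l => v (Fin.succAbove 0 l))]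
    simp
  | succ p ih =>
    rw [← Fin.cons_self_tail v]
    generalize v 0 = x
    generalize Fin.tail v = w
    rw [List.ofFn_cons, extD, lieL_toL, con_toL, contract_coe, ← ih, differential, differential]
    rw [Fin.sum_univ_succ, Fin.sum_univ_succ (n := p + 1) (f := fun i => ∑ j, _)]
    have e0 : (fun l => (Fin.cons x w : Fin (p + 2) → N) (Fin.succAbove 0 l)) = w := by
      funext l; simp
    have e1 : ∀ i : Fin (p + 1), (fun l => (Fin.cons x w : Fin (p + 2) → N) (i.succ.succAbove l))
        = Fin.cons x (fun l => w (i.succAbove l)) := by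
      intro i; funext l
      refine Fin.cases ?_ (fun l => ?_) l <;> simp [Fin.succ_succAbove_succ]
    have e2 : ∀ j : Fin (p + 1), (fun l => Function.update (Fin.cons x w : Fin (p + 2) → N) 0
        (br x (w j)) (j.succ.succAbove l)) = Fin.cons (br x (w j)) (fun l => w (j.succAbove l)) := by
      intro j; funext l
      rw [Fin.update_cons_zero]
      refine Fin.cases ?_ (fun l => ?_) l <;> simp [Fin.succ_succAbove_succ]
    have e3 : ∀ i j : Fin (p + 1), ∀ z, (fun l => Function.update (Fin.cons x w : Fin (p + 2) → N)
        i.succ z (j.succ.succAbove l))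
        = Fin.cons x (fun l => Function.update w i z (j.succAbove l)) := by
      intro i j z; funext l
      rw [← Fin.cons_update]
      refine Fin.cases ?_ (fun l => ?_) l <;> simp [Fin.succ_succAbove_succ]
    -- The terms pairing the head x with a later w j have the bracket in front; moving it to slot j
    -- costs (-1)^j. Against the sign (-1)^(j+1) of the formula this leaves -1, so these terms form
    -- the bracket part of L_x P. The terms without x in a bracket or as derivation form -d(i_x P).
    have e4 : ∀ (j : Fin (p + 1)) (z : N), P (Fin.cons z (fun l => w (j.succAbove l)))
        = (-1) ^ (j : ℕ) * P (Function.update w j z) := by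
      intro j z
      have h1 := P.neg_one_pow_smul_map_insertNth j z (j.removeNth w)
      rw [Fin.insertNth_removeNth] at h1
      refine Eq.trans h1.symm ?_
      rw [zsmul_eq_mul]; push_cast; rfl
    have e8 : ∀ j : Fin (p + 1), P (fun l => Function.update (Fin.cons x w : Fin (p + 2) → N) 0
        (br x (w j)) (j.succ.succAbove l)) = (-1) ^ (j : ℕ) * P (Function.update w j (br x (w j))) :=
      fun j => by rw [e2, e4]
    have e5 : ∀ j : ℕ, ((-1 : R) ^ j) * (-1) ^ j = 1 := fun j => by rw [← mul_pow]; simp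
    have e6 : ∀ j : Fin (p + 1), (-1 : R) ^ ((j : ℕ) + 1) * ((-1) ^ (j : ℕ) *
        P (Function.update w j (br x (w j)))) = - P (Function.update w j (br x (w j))) := by
      intro j
      rw [pow_succ]
      linear_combination (-P (Function.update w j (br x (w j)))) * e5 j
    simp only [e0, e1, Fin.sum_univ_succ (n := p + 1) (f := fun j => ite _ _ _), Fin.cons_zero,
      Fin.cons_succ, e8, e3, Fin.val_zero, Fin.val_succ, lt_self_iff_false, if_false,
      Fin.succ_pos, if_true, Fin.not_lt_zero, Fin.succ_lt_succ_iff, zero_add, e6]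
    simp only [← contract_coe, contract, pow_succ, pow_zero, one_mul, mul_neg, mul_one, neg_mul,
      Finset.sum_neg_distrib]
    have e7 : ∀ i j : Fin (p + 1), ∀ y : R, (if i < j then -y else 0) = -(if i < j then y else 0) := by
      intro i j y; split <;> simp
    simp only [e7, Finset.sum_neg_distrib]
    ring

omit [AddCommGroup N] [Module R N] in
-- The term θ ∧ P has the shape of the derivative terms of the differential, so it is absorbed by
-- adding the multiplication by θ(u) to the action of u. This is why actions with a zeroth-order
-- part are allowed throughout.
theorem modDifferential_eq (act : N → R → R) (θ : N → R) {p : ℕ} (P : (Fin p → N) → R) :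
    modDifferential act br θ P = differential (fun u f => act u f + f * θ u) br P := by
  funext v
  simp only [modDifferential, differential, oneWedge]
  rw [add_right_comm, ← Finset.sum_add_distrib]
  congr 1
  exact Finset.sum_congr rfl fun i _ => by ring

end Alternating

section Products

variable [Algebra ℝ R]

theorem ofFn_take {k p : ℕ} (h : p ≤ k) (v : Fin k → N) :
    (List.ofFn v).take p = List.ofFn (fun i : Fin p => v ⟨i, by omega⟩) := by
  apply List.ext_getElem
  · simp [h]
  · intro i h1 h2; simp

theorem ofFn_drop {k p q : ℕ} (h : p + q = k) (v : Fin k → N) :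
    (List.ofFn v).drop p = List.ofFn (fun i : Fin q => v ⟨p + i, by omega⟩) := by
  apply List.ext_getElem
  · simp; omega
  · intro i h1 h2; simp

theorem inv_factorial_smul (p r q : ℕ) (x : R) :
    ((p.factorial * q.factorial : ℝ)⁻¹) • ((p.factorial * r.factorial * q.factorial : R) * x)
      = (r.factorial : R) * x := by
  have h1 : (p.factorial : ℝ) ≠ 0 := by exact_mod_cast p.factorial_ne_zero
  have h2 : (q.factorial : ℝ) ≠ 0 := by exact_mod_cast q.factorial_ne_zero
  have h3 : (p.factorial * r.factorial * q.factorial : R)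
      = algebraMap ℝ R (p.factorial * q.factorial) * r.factorial := by
    simp; ring
  rw [h3, Algebra.smul_def, ← mul_assoc, ← mul_assoc, ← map_mul,
    inv_mul_cancel₀ (mul_ne_zero h1 h2), map_one, one_mul]

/-- Normalised sums over permutations of products of three blocks. -/
theorem sum_perm_block {k p r q : ℕ} (hk : p + r + q = k) {G : List N → List N → List N → R}
    (h : IsBlockAlt p r q G) (hr : r ≤ 1) (v : Fin k → N) (F : Equiv.Perm (Fin k) → R)
    (hF : ∀ s, F s = G (List.ofFn fun i : Fin p => v (s ⟨i, by omega⟩))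
      (List.ofFn fun i : Fin r => v (s ⟨p + i, by omega⟩))
      (List.ofFn fun i : Fin q => v (s ⟨p + r + i, by omega⟩))) :
    ((p.factorial * q.factorial : ℝ)⁻¹) • ∑ s : Equiv.Perm (Fin k), Equiv.Perm.sign s • F s
      = unshuffle G (List.ofFn v) := by
  have h1 := sum_perm_eq_asym v
    (fun l' => G (l'.take p) ((l'.drop p).take r) ((l'.drop p).drop r))
  rw [asym_block _ p r q h (by simp [hk])] at h1
  have h2 : ∀ s : Equiv.Perm (Fin k), F s = G ((List.ofFn fun i => v (s i)).take p)
      (((List.ofFn fun i => v (s i)).drop p).take r)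
      (((List.ofFn fun i => v (s i)).drop p).drop r) := by
    intro s
    rw [hF, ofFn_take (by omega), ofFn_drop (q := r + q) (by omega), ofFn_take (by omega),
      ofFn_drop (q := q) rfl]
    simp only [add_assoc]
  simp only [h2, h1]
  rw [inv_factorial_smul]
  -- The normalisation omits r!, which is 1 for a middle block of length at most 1.
  interval_cases r <;> simp

omit [Algebra ℝ R] in
-- Two-block products are three-block ones supported on an empty middle block, so that the wedge
-- product and the Schouten bracket share one unshuffle formula.
theorem unshuffle_wedge (P Q : List N → R) (l : List N) :
    unshuffle (fun a c b => if c = [] then P a * Q b else 0) l = wedgeL P Q l := by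
  induction l generalizing P Q with
  | nil => simp [unshuffle, wedgeL]
  | cons x l ih =>
    simp only [unshuffle, wedgeL, ← ih, List.cons_ne_nil, if_false, mul_zero, unshuffle_zero,
      add_zero]
    congr 2
    funext a c b
    by_cases hc : c = [] <;> simp [hc, sg, mul_assoc]

variable [AddCommGroup N] [Module R N]

omit [Algebra ℝ R] in
theorem isBlockAlt_wedge {p q : ℕ} (P : N [⋀^Fin p]→ₗ[R] R) (Q : N [⋀^Fin q]→ₗ[R] R) :
    IsBlockAlt p 0 q (fun a c b => if c = [] then toL P a * toL Q b else 0) where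
  left a c b x m hm := by
    simp only [(isAlt_toL P).insertIdx x a m hm]; split <;> ring
  mid a c b x m hm := by
    rw [if_neg (fun h => by simpa [List.length_insertIdx_of_le_length hm] using congrArg List.length h)]
    simp
  right a c b x m hm := by
    simp only [(isAlt_toL Q).insertIdx x b m hm]; split <;> ring
  left_length a c b h := by simp [toL_of_length_ne P h]
  mid_length a c b h := by simp at h; simp [h]
  right_length a c b h := by simp [toL_of_length_ne Q h]

theorem wedge_eq_wedgeL {p q k : ℕ} (h : p + q = k) (P : N [⋀^Fin p]→ₗ[R] R)
    (Q : N [⋀^Fin q]→ₗ[R] R) (v : Fin k → N) :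
    wedge h P Q v = wedgeL (toL P) (toL Q) (List.ofFn v) := by
  rw [← unshuffle_wedge, wedge]
  exact sum_perm_block (r := 0) (by omega) (isBlockAlt_wedge P Q) (by omega) v _
    fun s => by simp [toL_ofFn]

end Products

end TupleLists

end TwistedJacobi

namespace TwistedJacobi

/-! ### The modified Schouten bracket as a sum over unshuffles -/

noncomputable section SchoutenLink

variable {R A B : Type*} [CommRing R] [AddCommGroup A] [Module R A] [AddCommGroup B] [Module R B]
variable (pair : B →ₗ[R] A →ₗ[R] R) (act : A → R → R) (br : A → A → A) (φ : B)

/-- The action `u ↦ act u + φ(u)` of sections on functions. -/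
def modAct (u : A) (f : R) : R := act u f + f * pair φ u

/-- The modified differential of a function. -/
def jet (f : R) : B := represent pair.flip (fun u => modAct pair act φ u f)

/-- The modified differential of a section of the dual. -/
def modD (x : B) (u v : A) : R :=
  modAct pair act φ u (pair x v) - modAct pair act φ v (pair x u) - pair x (br u v)

variable {pair act br φ}

theorem isPerfPair_flip (hp : pair.IsPerfPair) : pair.flip.IsPerfPair :=
  ⟨hp.bijective_right, by rw [LinearMap.flip_flip]; exact hp.bijective_left⟩

theorem pair_represent_flip (hp : pair.IsPerfPair) {T : A → R} (h1 : ∀ u v, T (u + v) = T u + T v)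
    (h2 : ∀ (c : R) u, T (c • u) = c * T u) (u : A) : pair (represent pair.flip T) u = T u :=
  pair_represent (isPerfPair_flip hp) { toFun := T, map_add' := h1, map_smul' := h2 } u

section Connection

variable (hp : pair.IsPerfPair) (hA : IsConnection act act br)

include hA in
theorem modAct_isConnection (φ : B) : IsConnection act (modAct pair act φ) br where
  add_right x f g := by simp only [modAct, hA.add_right]; ring
  mul_right x f g := by simp only [modAct, hA.mul_right]; ring
  add_left x y f := by simp only [modAct, hA.add_left, map_add]; ring
  smul_left c x f := by simp only [modAct, hA.smul_left, map_smul, smul_eq_mul]; ring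
  skew := hA.skew
  br_add := hA.br_add
  br_smul := hA.br_smul

include hp hA

theorem pair_jet (f : R) (u : A) : pair (jet pair act φ f) u = modAct pair act φ u f := by
  have h := modAct_isConnection (pair := pair) hA φ
  exact pair_represent_flip hp (fun u v => h.add_left u v f) (fun c u => h.smul_left c u f) u

theorem jet_add (f g : R) : jet pair act φ (f + g) = jet pair act φ f + jet pair act φ g :=
  ext_left hp fun u => by
    simp only [map_add, LinearMap.add_apply, pair_jet hp hA,
      (modAct_isConnection hA φ).add_right]

theorem jet_mul (f g : R) : jet pair act φ (f * g)
    = f • jet pair act φ g + g • jet pair act φ f - (f * g) • φ :=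
  ext_left hp fun u => by
    simp only [map_add, map_sub, map_smul, LinearMap.add_apply, LinearMap.sub_apply,
      LinearMap.smul_apply, smul_eq_mul, pair_jet hp hA, modAct, hA.mul_right]
    ring

omit hp in
theorem modD_isTwoForm (x : B) : IsTwoForm (modD pair act br φ x) where
  skew u v := by simp only [modD, hA.skew u v, map_neg]; ring
  add_left u v w := by
    simp only [modD, modAct, hA.skew _ w, hA.br_add, hA.add_left, map_add, map_neg, hA.add_right]
    ring
  smul_left c u w := by
    simp only [modD, modAct, hA.skew _ w, hA.br_smul, hA.smul_left, map_add, map_neg, map_smul,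
      smul_eq_mul, hA.mul_right]
    ring

theorem modD_smul (c : R) (x : B) (u v : A) : modD pair act br φ (c • x) u v
    = c * modD pair act br φ x u v + pair (jet pair act φ c - c • φ) u * pair x v
      - pair (jet pair act φ c - c • φ) v * pair x u := by
  simp only [modD, map_sub, map_smul, LinearMap.sub_apply, LinearMap.smul_apply, smul_eq_mul,
    pair_jet hp hA, modAct, hA.mul_right]
  ring

omit hp in
theorem modD_add (x y : B) (u v : A) : modD pair act br φ (x + y) u v
    = modD pair act br φ x u v + modD pair act br φ y u v := by
  simp only [modD, map_add, LinearMap.add_apply, modAct, hA.add_right]; ring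

end Connection

section Unshuffle

variable {S : A → A → R} {τ : B → A → A → R} {j : R → B} {P Q : List B → R}

theorem pair_represent_head (hp : pair.IsPerfPair) (hQ : IsAlt Q) (l : List B) (x : B) :
    pair x (represent pair (fun y => Q (y :: l))) = Q (x :: l) :=
  pair_represent hp { toFun := fun y => Q (y :: l), map_add' := fun x y => hQ.cons_add x y l,
                      map_smul' := fun c x => hQ.cons_smul c x l } x

theorem pair_represent_last (hp : pair.IsPerfPair) (hP : IsAlt P) (l : List B) (x : B) :
    pair x (represent pair (fun y => P (l ++ [y]))) = P (l ++ [x]) :=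
  pair_represent hp { toFun := fun y => P (l ++ [y]), map_add' := hP.add l,
                      map_smul' := hP.smul l } x

theorem represent_last_sg (hp : pair.IsPerfPair) (hP : IsAlt P) (l : List B) :
    represent pair (fun y => sg P (l ++ [y]))
      = ((-1 : R) ^ (l.length + 1)) • represent pair (fun y => P (l ++ [y])) :=
  ext_right hp fun x => by
    rw [pair_represent_last hp hP.sg, map_smul, pair_represent_last hp hP]; simp [sg]

theorem represent_head_swap (hp : pair.IsPerfPair) (hQ : IsAlt Q) (x : B) (l : List B) :
    represent pair (fun y => con x Q (y :: l)) = - represent pair (fun y => Q (y :: x :: l)) :=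
  ext_right hp fun y => by
    rw [pair_represent_head hp (hQ.con x), map_neg, pair_represent_head hp hQ]
    simpa using hQ.swap [] x y l

/-- The free argument is last in P but first in Q. Bringing x past the free slot of Q costs a sign,
which with the (-1)^|a| of the unshuffle is the value at `a ++ [y]` of the sign in `sg P`. -/
theorem unshuffle_pairS (hp : pair.IsPerfPair) (hS : IsTwoForm S) (hP : IsAlt P) (hQ : IsAlt Q)
    (l : List B) :
    unshuffle (fun a c b => if c = [] then S (represent pair fun y => P (a ++ [y]))
      (represent pair fun y => Q (y :: b)) else 0) l = pairS pair S P Q l := by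
  induction l generalizing P Q with
  | nil => simp [unshuffle, pairS, hat]
  | cons x l ih =>
    simp only [unshuffle, pairS, ← ih (hP.con x) hQ, ← ih hP.sg (hQ.con x), List.cons_ne_nil,
      if_false, mul_zero, unshuffle_zero, add_zero]
    congr 2
    funext a c b
    by_cases hc : c = []
    · simp only [hc, if_true, represent_last_sg hp hP, represent_head_swap hp hQ, hS.smul_left,
        hS.neg_right, List.length_nil, add_zero]
      ring
    · simp [hc]


theorem neg_one_pow_smul_add (hj : ∀ f g, j (f + g) = j f + j g) (n : ℕ) (f : R) :
    j ((-1) ^ n * f) = (-1 : R) ^ n • j f := by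
  have hneg : ∀ f, j (-f) = -j f := (AddMonoidHom.mk' j hj).map_neg
  rcases neg_one_pow_eq_or R n with h | h <;> simp [h, hneg]

variable (pair τ) in
/-- The pairing of the form `τ x` with one argument of `P` and one of `Q`, by blocks. -/
def formBlock (P Q : List B → R) (a : List B) : List B → List B → R
  | [x], b => τ x (represent pair fun y => P (a ++ [y])) (represent pair fun y => Q (y :: b))
  | _, _ => 0

theorem formBlock_of_length_ne {P Q : List B → R} (a : List B) {c : List B} (b : List B)
    (h : c.length ≠ 1) : formBlock pair τ P Q a c b = 0 := by
  rcases c with _ | ⟨z, _ | ⟨w, c⟩⟩ <;> simp [formBlock] at h ⊢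

theorem unshuffle_neg {N : Type*} (G : List N → List N → List N → R) (l : List N) :
    unshuffle (fun x y z => -G x y z) l = -unshuffle G l := by
  simpa using unshuffle_mul (-1) G l

/-- The three sums in the classical formula for the Schouten bracket. -/
theorem unshuffle_schoutenL (hp : pair.IsPerfPair) (hj : ∀ f g, j (f + g) = j f + j g)
    (hτ : ∀ x, IsTwoForm (τ x)) (hP : IsAlt P) (hQ : IsAlt Q) (l : List B) :
    unshuffle (fun a c b => if c = [] then P (a ++ [j (Q b)]) else 0) l
      - unshuffle (fun a c b => if c = [] then Q (j (P a) :: b) else 0) l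
      - unshuffle (formBlock pair τ P Q) l = schoutenL pair j τ P Q l := by
  induction l generalizing P Q with
  | nil => simp [unshuffle, schoutenL, formBlock]
  | cons x l ih =>
    rw [schoutenL, ← ih (hP.con x) hQ, ← ih hP.sg (hQ.con x),
      ← unshuffle_pairS hp (hτ x) hP.sg hQ]
    simp only [unshuffle, List.cons_ne_nil, if_false, mul_zero, unshuffle_zero, add_zero]
    -- Each sum splits according to the block that receives x. The left block gives i_x P. The right
    -- block gives i_x Q, with its sign absorbed in `sg P` (`e1`, `e2`, `e4`). The one-element
    -- middle block occurs only in the third sum and gives the pairing with τ_x (`e3`).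
    have e1 : unshuffle (fun a c b => (-1) ^ (a.length + c.length) *
        (if c = [] then P (a ++ [j (Q (x :: b))]) else 0)) l
        = - unshuffle (fun a c b => if c = [] then sg P (a ++ [j (con x Q b)]) else 0) l := by
      rw [← unshuffle_neg]
      congr 1; funext a c b
      by_cases hc : c = [] <;> simp [hc, sg, pow_succ]
    have e2 : unshuffle (fun a c b => (-1) ^ (a.length + c.length) *
        (if c = [] then Q (j (P a) :: x :: b) else 0)) l
        = - unshuffle (fun a c b => if c = [] then con x Q (j (sg P a) :: b) else 0) l := by
      rw [← unshuffle_neg]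
      congr 1; funext a c b
      by_cases hc : c = []
      · simp only [hc, if_true, sg, neg_one_pow_smul_add hj, (hQ.con x).cons_smul, con_apply]
        have := hQ.swap [] x (j (P a)) b
        simp only [List.nil_append] at this
        rw [this]; simp
      · simp [hc]
    have e3 : unshuffle (fun a c b => (-1) ^ a.length * formBlock pair τ P Q a (x :: c) b) l = - unshuffle (fun a c b => if c = [] then
          τ x (represent pair fun y => sg P (a ++ [y])) (represent pair fun y => Q (y :: b))
          else 0) l := by
      rw [← unshuffle_neg]
      congr 1; funext a c b
      rcases c with _ | ⟨z, c⟩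
      · simp only [formBlock, if_true, represent_last_sg hp hP, (hτ x).smul_left]; ring
      · simp [formBlock]
    have e4 : unshuffle (fun a c b => (-1) ^ (a.length + c.length) * formBlock pair τ P Q a c (x :: b)) l = - unshuffle (formBlock pair τ (sg P) (con x Q)) l := by
      rw [← unshuffle_neg]
      congr 1; funext a c b
      rcases c with _ | ⟨z, _ | ⟨w, c⟩⟩
      · simp [formBlock]
      · simp only [formBlock, represent_last_sg hp hP, represent_head_swap hp hQ,
          (hτ z).smul_left, (hτ z).neg_right, List.length_singleton]
        ring
      · simp [formBlock]
    have e5 : (fun a c b => formBlock pair τ P Q (x :: a) c b) = formBlock pair τ (con x P) Q := rfl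
    rw [e1, e2, e3, e4, e5]
    simp only [con_apply, List.cons_append]
    ring

end Unshuffle

section Blocks

variable {τ : B → A → A → R} {j : R → B} {p q : ℕ}
  (P : B [⋀^Fin (p + 1)]→ₗ[R] R) (Q : B [⋀^Fin (q + 1)]→ₗ[R] R)

omit [AddCommGroup B] in
theorem insertIdx_append (l l' : List B) (x : B) (m : ℕ) (hm : m ≤ l.length) :
    l.insertIdx m x ++ l' = (l ++ l').insertIdx m x := by
  induction m generalizing l with
  | zero => simp
  | succ m ih =>
    cases l with
    | nil => simp at hm
    | cons y l => simp [List.insertIdx_succ_cons, ih l (by simpa using hm)]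

omit [AddCommGroup B] in
theorem insertIdx_ne_nil (l : List B) (x : B) (m : ℕ) (hm : m ≤ l.length) : l.insertIdx m x ≠ [] :=
  fun h => by simpa [List.length_insertIdx_of_le_length hm] using congrArg List.length h

theorem IsAlt.insertIdx_append {P : List B → R} (hP : IsAlt P) (a l : List B) (x : B) (m : ℕ)
    (hm : m ≤ a.length) : P (a.insertIdx m x ++ l) = (-1) ^ m * P (x :: a ++ l) := by
  rw [TwistedJacobi.insertIdx_append _ _ _ _ hm, hP.insertIdx _ _ _ (by simp; omega)]; rfl

theorem isBlockAlt_first (hj : ∀ f g, j (f + g) = j f + j g) : IsBlockAlt p 0 (q + 1)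
    (fun a c b => if c = [] then toL P (a ++ [j (toL Q b)]) else 0) where
  left a c b x m hm := by
    simp only [(isAlt_toL P).insertIdx_append _ _ _ _ hm]; split <;> ring
  mid a c b x m hm := by simp [insertIdx_ne_nil c x m hm]
  right a c b x m hm := by
    simp only [(isAlt_toL Q).insertIdx x b m hm, neg_one_pow_smul_add hj, (isAlt_toL P).smul]
    split <;> ring
  left_length a c b h := by simp [toL_of_length_ne P (l := a ++ [j (toL Q b)]) (by simpa using h)]
  mid_length a c b h := by simp at h; simp [h]
  right_length a c b h := by
    have h0 : j 0 = 0 := by simpa using hj 0 0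
    have := (isAlt_toL P).smul a 0 0
    simp only [zero_smul, zero_mul] at this
    simp [toL_of_length_ne Q h, h0, this]

theorem isBlockAlt_second (hj : ∀ f g, j (f + g) = j f + j g) : IsBlockAlt (p + 1) 0 q
    (fun a c b => if c = [] then toL Q (j (toL P a) :: b) else 0) where
  left a c b x m hm := by
    simp only [(isAlt_toL P).insertIdx x a m hm, neg_one_pow_smul_add hj, (isAlt_toL Q).cons_smul]
    split <;> ring
  mid a c b x m hm := by simp [insertIdx_ne_nil c x m hm]
  right a c b x m hm := by
    have h1 := ((isAlt_toL Q).con (j (toL P a))).insertIdx x b m hm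
    simp only [con_apply] at h1
    simp only [h1]; split <;> ring
  left_length a c b h := by
    have h0 : j 0 = 0 := by simpa using hj 0 0
    have := (isAlt_toL Q).cons_smul 0 0 b
    simp only [zero_smul, zero_mul] at this
    simp [toL_of_length_ne P h, h0, this]
  mid_length a c b h := by simp at h; simp [h]
  right_length a c b h := by simp [toL_of_length_ne Q (l := j (toL P a) :: b) (by simpa using h)]

theorem isBlockAlt_third (hp : pair.IsPerfPair) (hτ : ∀ x, IsTwoForm (τ x)) :
    IsBlockAlt p 1 q (formBlock pair τ (toL P) (toL Q)) where
  left a c b x m hm := by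
    have h1 : (represent pair fun y => toL P (a.insertIdx m x ++ [y]))
        = (-1 : R) ^ m • represent pair fun y => toL P (x :: a ++ [y]) :=
      ext_right hp fun z => by
        rw [pair_represent_last hp (isAlt_toL P), map_smul, pair_represent_last hp (isAlt_toL P),
          (isAlt_toL P).insertIdx_append _ _ _ _ hm, smul_eq_mul]
    rcases c with _ | ⟨z, _ | ⟨w, c⟩⟩
    · simp [formBlock]
    · simp only [formBlock, h1, (hτ z).smul_left]
    · simp [formBlock]
  mid a c b x m hm := by
    rcases c with _ | ⟨z, c⟩
    · have : m = 0 := by simpa using hm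
      simp [this]
    · have h1 : ((z :: c).insertIdx m x).length ≠ 1 := by
        rw [List.length_insertIdx_of_le_length hm]; simp
      rw [formBlock_of_length_ne _ _ h1, formBlock_of_length_ne _ _ (by simp), mul_zero]
  right a c b x m hm := by
    have h1 : (represent pair fun y => toL Q (y :: b.insertIdx m x))
        = (-1 : R) ^ m • represent pair fun y => toL Q (y :: x :: b) :=
      ext_right hp fun z => by
        rw [pair_represent_head hp (isAlt_toL Q), map_smul, pair_represent_head hp (isAlt_toL Q),
          smul_eq_mul]
        exact ((isAlt_toL Q).con z).insertIdx x b m hm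
    rcases c with _ | ⟨z, _ | ⟨w, c⟩⟩
    · simp [formBlock]
    · simp only [formBlock, h1, (hτ z).smul_right]
    · simp [formBlock]
  left_length a c b h := by
    have h1 : (represent pair fun y => toL P (a ++ [y])) = (0 : R) • 0 :=
      ext_right hp fun z => by
        rw [pair_represent_last hp (isAlt_toL P), toL_of_length_ne P (by simpa using h)]; simp
    rcases c with _ | ⟨z, _ | ⟨w, c⟩⟩
    · rfl
    · simp only [formBlock, h1, (hτ z).smul_left, zero_mul]
    · rfl
  mid_length a c b h := formBlock_of_length_ne _ _ h
  right_length a c b h := by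
    have h1 : (represent pair fun y => toL Q (y :: b)) = (0 : R) • 0 :=
      ext_right hp fun z => by
        rw [pair_represent_head hp (isAlt_toL Q), toL_of_length_ne Q (by simpa using h)]; simp
    rcases c with _ | ⟨z, _ | ⟨w, c⟩⟩
    · rfl
    · simp only [formBlock, h1, (hτ z).smul_right, zero_mul]
    · rfl

end Blocks

end SchoutenLink

end TwistedJacobi

namespace TwistedJacobi

/-! ### Identification of the modified Schouten bracket -/

noncomputable section ModSchouten

variable {R A B : Type*} [CommRing R] [Algebra ℝ R] [AddCommGroup A] [Module R A] [AddCommGroup B]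
  [Module R B] {pair : B →ₗ[R] A →ₗ[R] R} {act : A → R → R} {br : A → A → A} {φ : B}

theorem ofFn_snoc {N : Type*} {p : ℕ} (v : Fin p → N) (x : N) :
    List.ofFn (Fin.snoc v x : Fin (p + 1) → N) = List.ofFn v ++ [x] := by
  rw [List.ofFn_succ']; simp

omit [Algebra ℝ R] [AddCommGroup B] [Module R B] in
theorem toL_append_singleton {p : ℕ} (P : (Fin (p + 1) → B) → R) (v : Fin p → B) (x : B) :
    toL P (List.ofFn v ++ [x]) = P (Fin.snoc v x) := by
  rw [← ofFn_snoc, toL_ofFn]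

omit [Algebra ℝ R] [AddCommGroup B] [Module R B] in
theorem toL_cons {p : ℕ} (P : (Fin (p + 1) → B) → R) (v : Fin p → B) (x : B) :
    toL P (x :: List.ofFn v) = P (Fin.cons x v) := by
  rw [← List.ofFn_cons, toL_ofFn]

omit [Algebra ℝ R] [AddCommGroup B] [Module R B] in
theorem wedgeL_zero_left (Q : List B → R) (l : List B) : wedgeL 0 Q l = 0 := by
  simpa using wedgeL_smul_left 0 0 Q l

omit [Algebra ℝ R] [AddCommGroup B] [Module R B] in
theorem wedgeL_zero_right (P : List B → R) (l : List B) : wedgeL P 0 l = 0 := by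
  simpa using wedgeL_smul_right 0 P 0 l

omit [Algebra ℝ R] [AddCommGroup B] [Module R B] in
theorem wedgeL_toL_zero_right (P : List B → R) (Q : (Fin 0 → B) → R) (l : List B) :
    wedgeL P (toL Q) l = P l * toL Q [] := by
  induction l generalizing P with
  | nil => rfl
  | cons x l ih => rw [wedgeL, con_toL_zero, wedgeL_zero_right, ih]; simp

omit [Algebra ℝ R] [AddCommGroup B] [Module R B] in
theorem wedgeL_toL_zero_left (P : (Fin 0 → B) → R) (Q : List B → R) (l : List B) :
    wedgeL (toL P) Q l = toL P [] * Q l := by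
  have hs : sg (toL P) = toL P := by
    funext l
    rcases l with _ | ⟨x, l⟩
    · simp [sg]
    · simp [sg, toL_of_length_ne P (l := x :: l) (by simp)]
  induction l generalizing Q with
  | nil => rfl
  | cons x l ih => rw [wedgeL, con_toL_zero, wedgeL_zero_left, hs, ih]; simp

section DegreeZero

variable {τ : B → A → A → R} {j : R → B} {P Q : List B → R}

omit [Algebra ℝ R]

theorem isAlt_zero : IsAlt (0 : List B → R) := ⟨by simp, by simp, by simp⟩

theorem pairS_of_con_right (hp : pair.IsPerfPair) {S : A → A → R} (hS : IsTwoForm S)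
    (hQ : IsAlt Q) (h : ∀ x, con x Q = 0) (l : List B) : pairS pair S P Q l = 0 := by
  have h0 : ∀ P : List B → R, ∀ l, pairS pair S P 0 l = 0 := fun P l => by
    have := pairS_add_right (P := P) hp hS isAlt_zero (isAlt_zero (R := R)) l
    simpa using this
  induction l generalizing P with
  | nil =>
    have : hat pair Q = (0 : R) • 0 := ext_right hp fun b => by
      rw [pair_hat hp hQ]; simpa using congrFun (h b) []
    rw [pairS, this, hS.smul_right, zero_mul]
  | cons x l ih => rw [pairS, h, h0, ih, add_zero]

theorem pairS_of_con_left (hp : pair.IsPerfPair) {S : A → A → R} (hS : IsTwoForm S)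
    (hP : IsAlt P) (h : ∀ x, con x P = 0) (l : List B) : pairS pair S P Q l = 0 := by
  have h0 : ∀ Q : List B → R, ∀ l, pairS pair S 0 Q l = 0 := fun Q l => by
    have := pairS_add_left (Q := Q) hp hS isAlt_zero (isAlt_zero (R := R)) l
    simpa using this
  induction l generalizing P Q with
  | nil =>
    have : hat pair P = (0 : R) • 0 := ext_right hp fun b => by
      rw [pair_hat hp hP]; simpa using congrFun (h b) []
    rw [pairS, this, hS.smul_left, zero_mul]
  | cons x l ih =>
    rw [pairS, h, h0, ih hP.sg (fun y => by rw [con_sg, h]; funext l; simp [sg]), add_zero]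

variable (hp : pair.IsPerfPair) (hj : ∀ f g, j (f + g) = j f + j g) (hτ : ∀ x, IsTwoForm (τ x))
include hp hj hτ

/-- A field all of whose contractions vanish is a function, and the recursion then only follows P.
This and its mirror image match the separate clauses of `schouten` in degree 0. -/
theorem schoutenL_of_con_right (hP : IsAlt P) (hQ : IsAlt Q) (h : ∀ x, con x Q = 0) (l : List B) :
    schoutenL pair j τ P Q l = P (l ++ [j (Q [])]) := by
  have h0 : ∀ {P : List B → R}, IsAlt P → ∀ l, schoutenL pair j τ P 0 l = 0 := fun {P} hP l => by
    simpa using schoutenL_add_right hp hj hτ hP isAlt_zero (isAlt_zero (R := R)) l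
  induction l generalizing P with
  | nil =>
    have : Q [j (P [])] = 0 := congrFun (h (j (P []))) []
    rw [schoutenL, this, sub_zero, List.nil_append]
  | cons x l ih =>
    rw [schoutenL, h, h0 hP.sg, pairS_of_con_right hp (hτ x) hQ h, ih (hP.con x)]
    simp

theorem schoutenL_of_con_left (hP : IsAlt P) (hQ : IsAlt Q) (h : ∀ x, con x P = 0) (l : List B) :
    schoutenL pair j τ P Q l = -Q (j (P []) :: l) := by
  have h0 : ∀ {Q : List B → R}, IsAlt Q → ∀ l, schoutenL pair j τ 0 Q l = 0 := fun {Q} hQ l => by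
    simpa using schoutenL_add_left hp hj hτ isAlt_zero (isAlt_zero (R := R)) hQ l
  have hs : ∀ {P : List B → R}, (∀ x, con x P = 0) → ∀ x, con x (sg P) = 0 := fun {P} h x => by
    rw [con_sg, h]; funext l; simp [sg]
  induction l generalizing P Q with
  | nil =>
    have : P [j (Q [])] = 0 := congrFun (h (j (Q []))) []
    rw [schoutenL, this, zero_sub]
  | cons x l ih =>
    rw [schoutenL, h, h0 hQ, pairS_of_con_left hp (hτ x) hP.sg (hs h), ih hP.sg (hQ.con x) (hs h),
      sg_nil]
    have := hQ.swap [] x (j (P [])) l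
    simp only [List.nil_append] at this
    simp [this]

end DegreeZero

variable (hp : pair.IsPerfPair) (hA : IsConnection act act br)
include hp hA

omit [Algebra ℝ R] in
theorem represent_flip_act (φ : B) (f : R) :
    represent pair.flip (fun X => act X f) = jet pair act φ f - f • φ :=
  ext_left hp fun u => by
    rw [pair_represent_flip hp (fun u v => hA.add_left u v f) (fun c u => hA.smul_left c u f)]
    simp [pair_jet hp hA, modAct]

/-- The summands of the modified Schouten bracket. -/
theorem modSchouten_summand {p q : ℕ} (P : B [⋀^Fin (p + 1)]→ₗ[R] R) (Q : B [⋀^Fin (q + 1)]→ₗ[R] R)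
    (a : Fin p → B) (c : B) (b : Fin q → B) :
    (p.factorial * (q + 1).factorial : ℝ)⁻¹ • P (Fin.snoc a
        (represent pair.flip fun X => act X (Q (Fin.cons c b))))
      - ((p + 1).factorial * q.factorial : ℝ)⁻¹ • Q (Fin.cons
        (represent pair.flip fun X => act X (P (Fin.snoc a c))) b)
      - (p.factorial * q.factorial : ℝ)⁻¹ •
        (act (represent pair fun β => P (Fin.snoc a β)) (pair c (represent pair fun β => Q (Fin.cons β b)))
          - act (represent pair fun β => Q (Fin.cons β b))
            (pair c (represent pair fun β => P (Fin.snoc a β)))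
          - pair c (br (represent pair fun β => P (Fin.snoc a β))
            (represent pair fun β => Q (Fin.cons β b))))
      + (((p + 1 : ℕ) : ℝ) - 1) • ((p + 1).factorial * q.factorial : ℝ)⁻¹ •
        (P (Fin.snoc a c) * Q (Fin.cons φ b))
      + ((-1) ^ (p + 1) * (((q + 1 : ℕ) : ℝ) - 1)) • (p.factorial * (q + 1).factorial : ℝ)⁻¹ •
        (P (Fin.cons φ a) * Q (Fin.cons c b))
    = (p.factorial * (q + 1).factorial : ℝ)⁻¹ • P (Fin.snoc a (jet pair act φ (Q (Fin.cons c b))))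
      - ((p + 1).factorial * q.factorial : ℝ)⁻¹ • Q (Fin.cons (jet pair act φ (P (Fin.snoc a c))) b)
      - (p.factorial * q.factorial : ℝ)⁻¹ • modD pair act br φ c
          (represent pair fun β => P (Fin.snoc a β)) (represent pair fun β => Q (Fin.cons β b)) := by
  have hX : ∀ x, pair x (represent pair fun β => P (Fin.snoc a β)) = P (Fin.snoc a x) := fun x => by
    simpa only [toL_append_singleton] using
      pair_represent_last hp (isAlt_toL P) (List.ofFn a) x
  have hY : ∀ x, pair x (represent pair fun β => Q (Fin.cons β b)) = Q (Fin.cons x b) := fun x => by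
    simpa only [toL_cons] using pair_represent_head hp (isAlt_toL Q) (List.ofFn b) x
  have h1 : ∀ (x : B) (f : R), P (Fin.snoc a (x - f • φ))
      = P (Fin.snoc a x) - f * P (Fin.snoc a φ) := fun x f => by
    rw [← hX, ← hX, ← hX]; simp
  have h2 : ∀ (x : B) (f : R), Q (Fin.cons (x - f • φ) b)
      = Q (Fin.cons x b) - f * Q (Fin.cons φ b) := fun x f => by
    rw [← hY, ← hY, ← hY]; simp
  have h3 := (isAlt_toL P).cons_eq φ (List.ofFn a)
  rw [toL_cons, toL_append_singleton, List.length_ofFn] at h3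
  rw [represent_flip_act hp hA φ, represent_flip_act hp hA φ, h1, h2, h3]
  simp only [modD, modAct, hX, hY]
  generalize act _ _ = D1
  generalize act _ _ = D2
  generalize (pair c) _ = D3
  generalize P (Fin.snoc a φ) = P1
  generalize Q (Fin.cons φ b) = Q1
  have e1 : ((-1 : R) ^ p) * (-1) ^ p = 1 := by rw [← mul_pow]; simp
  -- The two parts of a coefficient (degree - 1): the degree times the normalisation of the wedge is
  -- 1/(p! q!), the weight of the φ ∧ c part of d^φ c, and the -1 comes from the multiple of φ in
  -- d^φ of a function.
  have e2 : ((p + 1 : ℕ) : ℝ) * ((p + 1).factorial * q.factorial : ℝ)⁻¹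
      = (p.factorial * q.factorial : ℝ)⁻¹ := by
    rw [Nat.factorial_succ]
    have := Nat.factorial_ne_zero p
    have := Nat.factorial_ne_zero q
    push_cast
    field_simp
  have e3 : ((q + 1 : ℕ) : ℝ) * (p.factorial * (q + 1).factorial : ℝ)⁻¹
      = (p.factorial * q.factorial : ℝ)⁻¹ := by
    rw [Nat.factorial_succ]
    have := Nat.factorial_ne_zero p
    have := Nat.factorial_ne_zero q
    push_cast
    field_simp
  rw [← e3] at e2 ⊢
  have e4 := congrArg (algebraMap ℝ R) e2
  simp only [Algebra.smul_def, map_mul, map_sub, map_pow, map_neg, map_one] at e4 ⊢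
  linear_combination (P (Fin.snoc a c) * Q1) * e4 - ((algebraMap ℝ R ((q + 1 : ℕ) : ℝ) - 1)
    * algebraMap ℝ R (p.factorial * (q + 1).factorial : ℝ)⁻¹ * P1 * Q (Fin.cons c b)) * e1

/-- The modified Schouten bracket is characterised by its contractions. -/
theorem modSchouten_eq_schoutenL {p q k : ℕ} (h : p + q = k + 1) (P : B [⋀^Fin p]→ₗ[R] R)
    (Q : B [⋀^Fin q]→ₗ[R] R) (α : Fin k → B) :
    modSchouten pair act br φ h P Q α
      = schoutenL pair (jet pair act φ) (modD pair act br φ) (toL P) (toL Q) (List.ofFn α) := by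
  have hj := jet_add (φ := φ) hp hA
  have hτ := modD_isTwoForm (pair := pair) (φ := φ) hA
  have hd := represent_flip_act hp hA φ
  rcases p with _ | p
  · rcases q with _ | q
    · omega
    · obtain rfl : q = k := by omega
      rw [schoutenL_of_con_left hp hj hτ (isAlt_toL P) (isAlt_toL Q) (con_toL_zero _), toL_cons,
        modSchouten, schouten, hd, toL_nil P Fin.elim0]
      have hw : ∀ hh, wedge (k := q) hh P (contract φ Q) α = P Fin.elim0 * Q (Fin.cons φ α) :=
        fun hh => by
          rw [contract_coe, wedge_eq_wedgeL, wedgeL_toL_zero_left, toL_nil P Fin.elim0, toL_ofFn]; rfl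
      simp only [wedgeContract, contractWedge, hw]
      have := (isAlt_toL Q).con_sub (jet pair act φ (P Fin.elim0)) (P Fin.elim0 • φ)
      have := congrFun this (List.ofFn α)
      simp only [con_apply, Pi.sub_apply, (isAlt_toL Q).cons_smul, toL_cons] at this
      simp only [Fin.eta, this]
      simp
      ring
  · rcases q with _ | q
    · obtain rfl : p = k := by omega
      rw [schoutenL_of_con_right hp hj hτ (isAlt_toL P) (isAlt_toL Q) (con_toL_zero _),
        toL_append_singleton, modSchouten, schouten, hd, toL_nil Q Fin.elim0]
      have hw : ∀ hh, wedge (k := p) hh (contract φ P) Q α = P (Fin.cons φ α) * Q Fin.elim0 :=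
        fun hh => by
          rw [contract_coe, wedge_eq_wedgeL, wedgeL_toL_zero_right, toL_nil Q Fin.elim0, toL_ofFn]
          rfl
      simp only [wedgeContract, contractWedge, hw]
      have h1 := (isAlt_toL P).mid_add (List.ofFn α) (jet pair act φ (Q Fin.elim0))
        ((-Q Fin.elim0) • φ) []
      rw [(isAlt_toL P).smul, toL_append_singleton, toL_append_singleton, toL_append_singleton,
        neg_smul, ← sub_eq_add_neg] at h1
      have h2 := (isAlt_toL P).cons_eq φ (List.ofFn α)
      rw [toL_cons, toL_append_singleton, List.length_ofFn] at h2
      simp only [Fin.eta, h1, h2]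
      have h3 : ((-1 : R) ^ p) * (-1) ^ p = 1 := by rw [← mul_pow]; simp
      have h4 : ((-1 : ℝ) ^ (p + 1) * (((0 : ℕ) : ℝ) - 1)) = (-1) ^ p := by push_cast; ring
      rw [h4]
      have h5 : ∀ x : R, ((-1 : ℝ) ^ p) • x = (-1) ^ p * x := fun x => by
        rw [Algebra.smul_def]; simp
      rw [h5]
      simp only [Pi.zero_apply, smul_zero]
      linear_combination (P (Fin.snoc α φ) * Q Fin.elim0) * h3
    · have hk : p + (q + 1) = k := by omega
      -- In positive degrees both sides become sums over permutations and are compared summand by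
      -- summand; the φ terms turn every d of the classical formula into d^φ.
      rw [← unshuffle_schoutenL hp hj hτ (isAlt_toL P) (isAlt_toL Q)]
      rw [← sum_perm_block (r := 0) (by omega) (isBlockAlt_first P Q hj) (by omega) α
          (fun s => P (Fin.snoc (fun i : Fin p => α (s ⟨i, by omega⟩))
            (jet pair act φ (Q (fun i : Fin (q + 1) => α (s ⟨p + i, by omega⟩))))))
          (fun s => by simp only [if_pos, List.ofFn_zero, toL_append_singleton, toL_ofFn, add_zero]),
        ← sum_perm_block (r := 0) (by omega) (isBlockAlt_second P Q hj) (by omega) α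
          (fun s => Q (Fin.cons (jet pair act φ (P (fun i : Fin (p + 1) => α (s ⟨i, by omega⟩))))
            (fun i : Fin q => α (s ⟨p + 1 + i, by omega⟩))))
          (fun s => by simp only [if_pos, List.ofFn_zero, toL_cons, toL_ofFn, add_zero]),
        ← sum_perm_block (r := 1) (by omega) (isBlockAlt_third P Q hp hτ) (by omega) α
          (fun s => modD pair act br φ (α (s ⟨p, by omega⟩))
            (represent pair fun y => P (Fin.snoc (fun i : Fin p => α (s ⟨i, by omega⟩)) y))
            (represent pair fun y => Q (Fin.cons y (fun i : Fin q => α (s ⟨p + 1 + i, by omega⟩)))))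
          (fun s => by
            simp only [List.ofFn_succ, List.ofFn_zero, formBlock, toL_append_singleton, Fin.val_zero,
              add_zero]
            simp only [toL_cons])]
      simp only [modSchouten, wedgeContract, contractWedge, wedge, Finset.smul_sum]
      rw [schouten]
      simp only [← Finset.sum_add_distrib, ← Finset.sum_sub_distrib]
      refine Finset.sum_congr rfl fun s _ => ?_
      simp only [smul_comm _ (Equiv.Perm.sign s), ← smul_add, ← smul_sub]
      congr 1
      have e1 : (fun j : Fin (q + 1) => α (s ⟨p + j, by omega⟩))
          = Fin.cons (α (s ⟨p, by omega⟩)) (fun i : Fin q => α (s ⟨p + 1 + i, by omega⟩)) := by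
        funext j
        refine Fin.cases rfl (fun i => ?_) j
        simp only [Fin.cons_succ, Fin.val_succ]
        congr 3; omega
      have e2 : (fun i : Fin (p + 1) => α (s ⟨i, by omega⟩))
          = Fin.snoc (fun i : Fin p => α (s ⟨i, by omega⟩)) (α (s ⟨p, by omega⟩)) := by
        funext j
        refine Fin.lastCases ?_ (fun i => ?_) j
        · simp
        · simp
      simp only [e1, e2, contract]
      exact modSchouten_summand hp hA P Q _ _ _

end ModSchouten

end TwistedJacobi

namespace TwistedJacobi

/-! ### Brackets deformed by a closed 3-form -/

noncomputable section TwistedStructure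

variable {R A B : Type*} [CommRing R] [AddCommGroup A] [Module R A] [AddCommGroup B] [Module R B]

/-- A closed 3-form, for the differential modified by `op`. -/
structure IsClosedForm (op : A → R → R) (br : A → A → A) (Φ : A → A → A → R) : Prop where
  skew_left : ∀ u v w, Φ u v w = -Φ v u w
  skew_right : ∀ u v w, Φ u v w = -Φ u w v
  add_left : ∀ u u' v w, Φ (u + u') v w = Φ u v w + Φ u' v w
  smul_left : ∀ (c : R) u v w, Φ (c • u) v w = c * Φ u v w
  closed : ∀ u v w z, op u (Φ v w z) - op v (Φ u w z) + op w (Φ u v z) - op z (Φ u v w)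
    - Φ (br u v) w z + Φ (br u w) v z - Φ (br u z) v w - Φ (br v w) u z + Φ (br v z) u w
    - Φ (br w z) u v = 0

namespace IsClosedForm

variable {op : A → R → R} {br : A → A → A} {Φ : A → A → A → R} (h : IsClosedForm op br Φ)
include h

theorem cycle (u v w : A) : Φ u v w = Φ v w u := by
  rw [h.skew_left, h.skew_right v u w, neg_neg]

theorem add_right (u v w w' : A) : Φ u v (w + w') = Φ u v w + Φ u v w' := by
  rw [← h.cycle, h.add_left, h.cycle w, h.cycle w']

theorem smul_right (c : R) (u v w : A) : Φ u v (c • w) = c * Φ u v w := by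
  rw [← h.cycle, h.smul_left, h.cycle w]

theorem sub_left (u u' v w : A) : Φ (u - u') v w = Φ u v w - Φ u' v w := by
  rw [sub_eq_add_neg, h.add_left, ← neg_one_smul R u', h.smul_left]; ring

end IsClosedForm

namespace IsConnection

variable {a ρ : A → R → R} {br : A → A → A} (h : IsConnection a ρ br)
include h

theorem br_neg (u v : A) : br u (-v) = -br u v := (AddMonoidHom.mk' _ (h.br_add u)).map_neg v

theorem br_sub (u v w : A) : br u (v - w) = br u v - br u w :=
  (AddMonoidHom.mk' _ (h.br_add u)).map_sub v w

theorem br_sub_left (u v w : A) : br (u - v) w = br u w - br v w := by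
  rw [h.skew, h.br_sub, h.skew u, h.skew v]; abel

end IsConnection

/-- A Lie algebra `A` acting on functions, with a closed 1-form `φ`, a closed 3-form `Φ`, a skew map
`s` from the dual, and the brackets `brA` and `brB` on `A` and `B` deformed by `s` and `Φ`, such that
`s` intertwines `brB` and the bracket of `A`. -/
structure IsTwistedStructure (pair : B →ₗ[R] A →ₗ[R] R) (act : A → R → R) (br : A → A → A) (φ : B)
    (s : B → A) (Φ : A → A → A → R) (brA : A → A → A) (brB : B → B → B) : Prop
    extends IsConnection act act br where
  perfect : pair.IsPerfPair
  act_br : ∀ u v f, act (br u v) f = act u (act v f) - act v (act u f)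
  jacobi : ∀ u v w, br (br u v) w = br u (br v w) - br v (br u w)
  closed_one : ∀ u v, pair φ (br u v) = act u (pair φ v) - act v (pair φ u)
  sharp_skew : ∀ x y, pair x (s y) = -pair y (s x)
  form : IsClosedForm (modAct pair act φ) br Φ
  pair_brA : ∀ x u v, pair x (brA u v) = pair x (br u v) + Φ u v (s x)
  pair_brB : ∀ x y v, pair (brB x y) v = modAct pair act φ (s x) (pair y v) - pair y (br (s x) v)
    - modAct pair act φ (s y) (pair x v) + pair x (br (s y) v) - modAct pair act φ v (pair y (s x))
    + Φ (s x) (s y) v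
  sharp_brB : ∀ x y, s (brB x y) = br (s x) (s y)

namespace IsTwistedStructure

variable {pair : B →ₗ[R] A →ₗ[R] R} {act : A → R → R} {br : A → A → A} {φ : B}
  {s : B → A} {Φ : A → A → A → R} {brA : A → A → A} {brB : B → B → B}
  (h : IsTwistedStructure pair act br φ s Φ brA brB)
include h

local notation "op" => modAct pair act φ

theorem op_connection : IsConnection act op br := modAct_isConnection h.toIsConnection φ

/-- The curvature of the action twisted by φ is dφ, which vanishes. -/
theorem op_br (u v : A) (f : R) : op (br u v) f = op u (op v f) - op v (op u f) := by
  simp only [modAct, h.act_br, h.closed_one, h.add_right, h.mul_right]; ring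

theorem sharp_add (x y : B) : s (x + y) = s x + s y :=
  ext_right h.perfect fun b => by
    rw [h.sharp_skew, map_add, LinearMap.add_apply, map_add, h.sharp_skew b x, h.sharp_skew b y]; ring

theorem sharp_smul (c : R) (x : B) : s (c • x) = c • s x :=
  ext_right h.perfect fun b => by
    rw [h.sharp_skew, map_smul, LinearMap.smul_apply, map_smul, h.sharp_skew b x]; simp

theorem op_neg (u : A) (f : R) : op u (-f) = -op u f := neg_of_additive (h.op_connection.add_right u) f

theorem op_sub (u : A) (f g : R) : op u (f - g) = op u f - op u g :=
  sub_of_additive (h.op_connection.add_right u) f g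

/-- The deformed bracket on `A` is again a connection. -/
theorem connection_brA : IsConnection act act brA where
  add_right := h.add_right
  mul_right := h.mul_right
  add_left := h.add_left
  smul_left := h.smul_left
  skew u v := ext_right h.perfect fun b => by
    rw [h.pair_brA, map_neg, h.pair_brA, h.skew, h.form.skew_left]; simp; ring
  br_add u v w := ext_right h.perfect fun b => by
    simp only [h.pair_brA, map_add, h.br_add, h.form.cycle u, h.form.add_left]; ring
  br_smul u c v := ext_right h.perfect fun b => by
    simp only [h.pair_brA, map_add, map_smul, h.br_smul, h.form.cycle u, h.form.smul_left,
      smul_eq_mul]; ring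

theorem modD_brA (x : B) (u v : A) : modD pair act brA φ x u v
    = op u (pair x v) - op v (pair x u) - pair x (br u v) - Φ u v (s x) := by
  rw [modD, h.pair_brA]; ring

local notation "tau" => modD pair act brA φ

theorem isTwoForm_tau (x : B) : IsTwoForm (tau x) := modD_isTwoForm h.connection_brA x

/-- Forming τ with the deformed bracket on A absorbs the twist Φ(sx, sy, ·). In this form the
bracket is treated as in the untwisted case. -/
theorem pair_brB_eq (x y : B) (v : A) :
    pair (brB x y) v = op (s x) (pair y v) - pair y (br (s x) v) - tau x (s y) v := by
  rw [h.pair_brB, h.modD_brA, h.sharp_skew x y, h.op_neg, h.form.cycle (s x)]; ring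

/-- The deformed bracket on `B` is a connection. -/
theorem connection_brB : IsConnection (fun x => act (s x)) (fun x => op (s x)) brB where
  add_right _ := h.op_connection.add_right _
  mul_right _ := h.op_connection.mul_right _
  add_left x y f := by rw [h.sharp_add, h.op_connection.add_left]
  smul_left c x f := by rw [h.sharp_smul, h.op_connection.smul_left]
  skew x y := ext_left h.perfect fun v => by
    rw [h.pair_brB, map_neg, LinearMap.neg_apply, h.pair_brB, h.sharp_skew x y, h.op_neg,
      h.form.skew_left]; ring
  br_add x y z := ext_left h.perfect fun v => by
    simp only [h.pair_brB_eq, map_add, LinearMap.add_apply, h.sharp_add, (h.isTwoForm_tau x).add_left,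
      h.op_connection.add_right]; ring
  br_smul x c y := ext_left h.perfect fun v => by
    simp only [h.pair_brB_eq, map_add, map_smul, LinearMap.add_apply, LinearMap.smul_apply,
      h.sharp_smul, (h.isTwoForm_tau x).smul_left, h.op_connection.mul_right, smul_eq_mul]; ring

/-- This is d^φ L = L d^φ with corrections from Φ. Since `s` is a morphism, the corrections assemble
into closedness of Φ on (sx, sy, u, v); the rest is flatness of the action and the Jacobi identity
paired with x and with y. -/
theorem tau_brB (x y : B) (u v : A) : tau (brB x y) u v
    = op (s x) (tau y u v) - tau y (br (s x) u) v - tau y u (br (s x) v)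
      - (op (s y) (tau x u v) - tau x (br (s y) u) v - tau x u (br (s y) v)) := by
  have e1 := congrArg (pair x) (h.jacobi (s y) u v)
  have e2 := congrArg (pair y) (h.jacobi (s x) u v)
  have e := h.form.closed (s x) (s y) u v
  simp only [map_sub] at e1 e2
  simp only [h.modD_brA, h.pair_brB_eq, h.sharp_brB, h.op_sub, h.op_br]
  simp only [← h.form.cycle (s _)] at e ⊢
  linear_combination e + e1 - e2 - h.form.skew_left (s y) (br (s x) u) v
    + h.form.cycle (br (s x) v) (s y) u + h.form.skew_left (s x) (br (s y) u) v
    - h.form.cycle (br (s y) v) (s x) u + h.form.cycle (br (s x) (s y)) u v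

/-- The Lie derivative along a section of `B`. -/
def lieSection (pair : B →ₗ[R] A →ₗ[R] R) (act : A → R → R) (br : A → A → A) (φ : B) (s : B → A)
    (brA : A → A → A) (x : B) (u : A) : A :=
  br (s x) u + s (represent pair.flip (modD pair act brA φ x u))

theorem pair_represent_tau (x : B) (u v : A) :
    pair (represent pair.flip (tau x u)) v = tau x u v :=
  pair_represent_flip h.perfect ((h.isTwoForm_tau x).add_right u)
    (fun c => (h.isTwoForm_tau x).smul_right c u) v

/-- The operator dual to {x, ·} is D_x u = [sx, u] + s(i_u τ x). Its second summand is dictated by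
the term i_{sy} τ x of the bracket and the skewness of `s`. -/
theorem isCompatible : IsCompatible pair (jet pair act φ) tau (fun x => act (s x))
    (fun x => op (s x)) brB (lieSection pair act br φ s brA) where
  __ := h.connection_brB
  perfect := h.perfect
  form := h.isTwoForm_tau
  j_add := jet_add h.perfect h.toIsConnection
  action_j f g := by
    simp only [← pair_jet h.perfect h.toIsConnection]
    rw [h.sharp_skew]
  pair_D x y u := by
    rw [lieSection, map_add, h.sharp_skew, h.pair_represent_tau, h.pair_brB_eq,
      (h.isTwoForm_tau x).skew]; ring
  br_j x f u v hv := by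
    -- Here v is d_*^W f, and the skewness of `s` turns ⟨d^φ f, s b⟩ into -⟨b, s d^φ f⟩.
    have : v = -s (jet pair act φ f) := ext_right h.perfect fun b => by
      rw [hv, map_neg, h.sharp_skew, neg_neg, pair_jet h.perfect h.toIsConnection]
    rw [this, (h.isTwoForm_tau x).neg_left, h.pair_brB_eq]
    simp only [pair_jet h.perfect h.toIsConnection, h.op_br]
    ring
  form_br x y u v := by
    rw [h.tau_brB]
    -- The second summand of D contributes four terms quadratic in τ. Moving `s` across the pairing
    -- identifies them in pairs of opposite sign, and `tau_brB` remains.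
    have e : ∀ x y u v, tau y (s (represent pair.flip (tau x u))) v
        = tau x u (s (represent pair.flip (tau y v))) := fun x y u v => by
      rw [(h.isTwoForm_tau y).skew, ← h.pair_represent_tau y, h.sharp_skew, h.pair_represent_tau x,
        neg_neg]
    simp only [lieForm, lieSection, (h.isTwoForm_tau _).add_left, (h.isTwoForm_tau _).add_right]
    linear_combination e x y u v - e y x u v

/-- With {x, ·} = L_{sx} - i_{s(·)} τ x, the Leibniz form of the identity reduces to flatness of the
action, the Jacobi identity on A, s{x,y} = [sx,sy], and the formula for τ{x,y}. -/
theorem jacobi_brB (x y z : B) :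
    brB (brB x y) z + brB (brB y z) x + brB (brB z x) y = 0 := by
  have hc := h.connection_brB
  have key : brB (brB x y) z = brB x (brB y z) - brB y (brB x z) := ext_left h.perfect fun v => by
    rw [map_sub, LinearMap.sub_apply]
    simp only [h.pair_brB_eq _ _ v, h.sharp_brB, h.tau_brB, h.op_br]
    simp only [h.pair_brB_eq, h.op_sub, h.jacobi, map_sub]
    ring
  rw [key, hc.skew (brB y z), hc.skew (brB z x), hc.skew z x]
  have : brB y (-brB x z) = -brB y (brB x z) := hc.br_neg y _
  rw [this]; abel

/-- The section `Φ(u, v, ·)` of the dual. -/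
theorem pair_represent_form (u v w : A) : pair (represent pair.flip (Φ u v)) w = Φ u v w :=
  pair_represent_flip h.perfect (h.form.add_right u v) (fun c => h.form.smul_right c u v) w

theorem brA_eq (u v : A) : brA u v = br u v - s (represent pair.flip (Φ u v)) :=
  ext_right h.perfect fun b => by
    rw [h.pair_brA, map_sub, h.sharp_skew, h.pair_represent_form]; ring

/-- Replacing the bracket by the deformed one adds six terms Φ(sΦ(u,v,·), w, z). Skewness of `s`
makes each the negative of the one with {u,v} and {w,z} exchanged, and the six cancel in three
pairs. -/
theorem closed_brA (u v w z : A) :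
    op u (Φ v w z) - op v (Φ u w z) + op w (Φ u v z) - op z (Φ u v w)
    - Φ (brA u v) w z + Φ (brA u w) v z - Φ (brA u z) v w - Φ (brA v w) u z + Φ (brA v z) u w
    - Φ (brA w z) u v = 0 := by
  have hs : ∀ u v w z, Φ (s (represent pair.flip (Φ u v))) w z
      = -Φ (s (represent pair.flip (Φ w z))) u v := fun u v w z => by
    rw [h.form.cycle, ← h.pair_represent_form, h.sharp_skew, h.pair_represent_form,
      h.form.cycle (s _)]
  simp only [h.brA_eq, h.form.sub_left, hs u v, hs u w, hs u z]
  linear_combination h.form.closed u v w z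

/-- The last group is d_*^W w evaluated at (Φ(u,v,·), x), the contraction that appears in the
Jacobiator. Isolating it leaves only terms linear in Φ. -/
theorem pair_brA_brA (u v w : A) (x : B) : pair x (brA (brA u v) w) = pair x (br (br u v) w)
    + Φ (br u v) w (s x) - Φ u v (br (s x) w) - op w (Φ u v (s x))
    - (op (s (represent pair.flip (Φ u v))) (pair x w) - op (s x) (Φ u v w)
      - pair (brB (represent pair.flip (Φ u v)) x) w) := by
  rw [h.pair_brA, h.pair_brB, h.pair_represent_form, h.pair_represent_form, h.sharp_skew x,
    h.pair_represent_form, h.op_neg, h.brA_eq, h.br_sub_left, map_sub, h.form.sub_left,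
    h.form.skew_right (s (represent pair.flip (Φ u v)))]
  ring

/-- The Jacobiator of the deformed bracket on `A`. -/
theorem jacobiator_brA (u v w : A) (x : B) :
    pair x (brA (brA u v) w + brA (brA v w) u + brA (brA w u) v) = -op (s x) (Φ u v w)
      - ((op (s (represent pair.flip (Φ u v))) (pair x w) - op (s x) (Φ u v w)
          - pair (brB (represent pair.flip (Φ u v)) x) w)
        + (op (s (represent pair.flip (Φ v w))) (pair x u) - op (s x) (Φ v w u)
          - pair (brB (represent pair.flip (Φ v w)) x) u)
        + (op (s (represent pair.flip (Φ w u))) (pair x v) - op (s x) (Φ w u v)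
          - pair (brB (represent pair.flip (Φ w u)) x) v)) := by
  simp only [map_add, h.pair_brA_brA]
  -- Summed cyclically, the terms linear in Φ are closedness with fourth argument sx. The term
  -- -ρ_{sx} Φ(u,v,w) is left over and is -d_*^W of the function Φ(u,v,w).
  have e := h.form.closed u v w (s x)
  have e1 := congrArg (pair x) (h.jacobi u v w)
  rw [map_sub] at e1
  have hv : op v (Φ w u (s x)) = -op v (Φ u w (s x)) := by rw [h.form.skew_left, h.op_neg]
  have hb : ∀ u v w : A, pair x (br (br u v) w) = -pair x (br w (br u v)) := fun u v w => by
    rw [h.skew, map_neg]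
  have hc : pair x (br v (br w u)) = -pair x (br v (br u w)) := by
    rw [h.skew w u, h.br_neg, map_neg]
  have hd : Φ (br w u) v (s x) = -Φ (br u w) v (s x) := by
    rw [h.skew w u, ← neg_one_smul R, h.form.smul_left]; ring
  have hf : ∀ u v w, Φ v w (br (s x) u) = -Φ (br u (s x)) v w := fun u v w => by
    rw [← h.form.cycle, h.skew (s x), ← neg_one_smul R, h.form.smul_left]; ring
  rw [hb v w u, hb w u v, hc, hd, hv, hf, hf, hf, h.form.skew_right (br v (s x)) w]
  linear_combination e1 - e

end IsTwistedStructure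

end TwistedStructure

end TwistedJacobi

namespace TwistedJacobi

/-! ### Degrees -/

noncomputable section Degree

variable {R N : Type*} [CommRing R]

/-- Functions on lists that vanish away from the lists of length `d`. -/
def HasDegree (d : ℤ) (P : List N → R) : Prop := ∀ l : List N, (l.length : ℤ) ≠ d → P l = 0

variable {d e : ℤ} {P Q : List N → R}

theorem hasDegree_toL {p : ℕ} (P : (Fin p → N) → R) : HasDegree p (toL P) := fun _ hl =>
  toL_of_length_ne _ (by exact_mod_cast hl)

namespace HasDegree

theorem con (hP : HasDegree d P) (x : N) : HasDegree (d - 1) (con x P) := fun l hl =>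
  hP _ (by simp only [List.length_cons, Nat.cast_add, Nat.cast_one]; omega)

theorem sg (hP : HasDegree d P) : HasDegree d (sg P) := fun l hl => by
  rw [TwistedJacobi.sg, hP l hl, mul_zero]

theorem wedgeL (hP : HasDegree d P) (hQ : HasDegree e Q) : HasDegree (d + e) (wedgeL P Q) := by
  intro l
  induction l generalizing d e P Q with
  | nil =>
    intro hl
    rw [TwistedJacobi.wedgeL]
    by_cases hd : ((0 : ℕ) : ℤ) = d
    · rw [hQ [] (by simp at hl hd ⊢; omega), mul_zero]
    · rw [hP [] hd, zero_mul]
  | cons x l ih =>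
    intro hl
    simp only [List.length_cons, Nat.cast_add, Nat.cast_one] at hl
    rw [TwistedJacobi.wedgeL, ih (hP.con x) hQ (by omega), ih hP.sg (hQ.con x) (by omega), add_zero]

variable {ρ : N → R → R} {br : N → N → N} (hρ : ∀ x f g, ρ x (f + g) = ρ x f + ρ x g)

include hρ in
theorem lieL (hP : HasDegree d P) (x : N) : HasDegree d (lieL ρ br x P) := by
  intro l
  induction l generalizing d P with
  | nil => exact fun hl => by rw [TwistedJacobi.lieL, hP [] hl, zero_of_additive (hρ x)]
  | cons y l ih =>
    intro hl
    rw [TwistedJacobi.lieL, hP _ (by simpa using hl), ih (hP.con y), sub_zero]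
    simp only [List.length_cons, Nat.cast_add, Nat.cast_one] at hl
    omega

include hρ in
theorem extD (hP : HasDegree d P) : HasDegree (d + 1) (extD ρ br P) := by
  intro l
  induction l generalizing d P with
  | nil => exact fun _ => rfl
  | cons y l ih =>
    intro hl
    simp only [List.length_cons, Nat.cast_add, Nat.cast_one] at hl
    rw [TwistedJacobi.extD, hP.lieL hρ y l (by omega), ih (hP.con y) (by omega), sub_zero]

variable {A : Type*} [AddCommGroup A] [Module R A] [AddCommGroup N] [Module R N]
  {pair : N →ₗ[R] A →ₗ[R] R} (hp : pair.IsPerfPair)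
include hp

theorem hat_eq_zero (hP : HasDegree d P) (hP' : IsAlt P) (hd : d ≠ 1) : hat pair P = 0 :=
  ext_right hp fun b => by rw [pair_hat hp hP', hP [b] (by simpa using hd.symm), map_zero]

theorem pairS {S : A → A → R} (hS : IsTwoForm S) (hP : HasDegree d P) (hQ : HasDegree e Q)
    (hP' : IsAlt P) (hQ' : IsAlt Q) : HasDegree (d + e - 2) (pairS pair S P Q) := by
  intro l
  induction l generalizing d e P Q with
  | nil =>
    intro hl
    rw [TwistedJacobi.pairS]
    by_cases hd : d = 1
    · rw [hQ.hat_eq_zero hp hQ' (by simp at hl; omega), ← zero_smul R (0 : A), hS.smul_right, zero_mul]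
    · rw [hP.hat_eq_zero hp hP' hd, ← zero_smul R (0 : A), hS.smul_left, zero_mul]
  | cons x l ih =>
    intro hl
    simp only [List.length_cons, Nat.cast_add, Nat.cast_one] at hl
    rw [TwistedJacobi.pairS, ih (hP.con x) hQ (hP'.con x) hQ' (by omega),
      ih hP.sg (hQ.con x) hP'.sg (hQ'.con x) (by omega), add_zero]

theorem schoutenL {j : R → N} {τ : N → A → A → R} (hj : ∀ f g, j (f + g) = j f + j g)
    (hτ : ∀ x, IsTwoForm (τ x)) (hP : HasDegree d P) (hQ : HasDegree e Q)
    (hP' : IsAlt P) (hQ' : IsAlt Q) : HasDegree (d + e - 1) (schoutenL pair j τ P Q) := by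
  intro l
  induction l generalizing d e P Q with
  | nil =>
    have h0 : j 0 = 0 := by simpa using hj 0 0
    have key : ∀ {d e : ℤ} {P Q : List N → R}, HasDegree d P → HasDegree e Q → IsAlt P →
        0 ≠ d + e - 1 → P [j (Q [])] = 0 := fun {d e P Q} hP hQ hP' hl => by
      by_cases hd : d = 1
      · rw [hQ [] (by simp; omega), h0]; simpa using hP'.smul [] 0 0
      · exact hP _ (by simpa using Ne.symm hd)
    intro hl
    simp only [List.length_nil, Nat.cast_zero] at hl
    rw [TwistedJacobi.schoutenL, key hP hQ hP' hl, key hQ hP hQ' (by omega), sub_zero]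
  | cons x l ih =>
    intro hl
    simp only [List.length_cons, Nat.cast_add, Nat.cast_one] at hl
    rw [TwistedJacobi.schoutenL, ih (hP.con x) hQ (hP'.con x) hQ' (by omega),
      ih hP.sg (hQ.con x) hP'.sg (hQ'.con x) (by omega),
      hP.sg.pairS hp (hτ x) hQ hP'.sg hQ' l (by omega)]
    simp

end HasDegree

end Degree

/-! ### Return to alternating maps -/

noncomputable section Bundling

variable {R N : Type*} [CommRing R] [Algebra ℝ R] [AddCommGroup N] [Module R N]

theorem HasDegree.exists_toL {P : List N → R} {k : ℕ} (hP : HasDegree k P) (hP' : IsAlt P) :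
    ∃ T : N [⋀^Fin k]→ₗ[R] R, toL T = P := by
  obtain ⟨T, hT⟩ := hP'.exists_alternatingMap k
  exact ⟨T, toL_eq_iff _ _ (fun l hl => hP l (by exact_mod_cast hl)) hT⟩

omit [Algebra ℝ R] [AddCommGroup N] [Module R N] in
theorem coe_eq_of_toL {k : ℕ} {P Q : (Fin k → N) → R} (h : toL P = toL Q) : P = Q :=
  funext fun v => by rw [← toL_ofFn P, h, toL_ofFn]

variable {a ρ : N → R → R} {br : N → N → N}

omit [Algebra ℝ R] in
theorem toL_differential (h : IsConnection a ρ br) {k : ℕ} (P : N [⋀^Fin k]→ₗ[R] R) :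
    toL (differential ρ br P) = extD ρ br (toL P) :=
  toL_eq_iff _ _ (fun l hl => (hasDegree_toL P).extD h.add_right l (by exact_mod_cast hl))
    (differential_eq_extD P)

/-- The differential of an alternating map is alternating. -/
theorem exists_differential (h : IsConnection a ρ br) {k : ℕ} (P : N [⋀^Fin k]→ₗ[R] R) :
    ∃ T : N [⋀^Fin (k + 1)]→ₗ[R] R, ⇑T = differential ρ br P := by
  obtain ⟨T, hT⟩ := ((hasDegree_toL P).extD (br := br) h.add_right).exists_toL (k := k + 1)
    ((isAlt_toL P).extD h)
  exact ⟨T, coe_eq_of_toL (by rw [hT, toL_differential h])⟩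

omit [Algebra ℝ R] [AddCommGroup N] [Module R N] in
theorem sg_toL {k : ℕ} (P : (Fin k → N) → R) : sg (toL P) = (-1 : R) ^ k • toL P := by
  funext l
  by_cases hl : l.length = k
  · simp [sg, hl]
  · simp [sg, toL_of_length_ne P hl]

/-- The differential is a graded derivation of the wedge product. -/
theorem differential_wedge (h : IsConnection ρ ρ br) {k l : ℕ} (P : N [⋀^Fin k]→ₗ[R] R)
    (Q : N [⋀^Fin l]→ₗ[R] R) (v : Fin (k + l + 1) → N) :
    differential ρ br (wedge rfl P Q) v =
      wedge (show (k + 1) + l = k + l + 1 by omega) (differential ρ br P) Q v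
        + (-1) ^ k * wedge (show k + (l + 1) = k + l + 1 by omega) P (differential ρ br Q) v := by
  obtain ⟨T, hT⟩ := ((hasDegree_toL P).wedgeL (hasDegree_toL Q)).exists_toL (k := k + l)
    ((isAlt_toL P).wedgeL (isAlt_toL Q))
  have hT' : wedge rfl P Q = ⇑T :=
    funext fun w => by rw [wedge_eq_wedgeL, ← hT, toL_ofFn]
  obtain ⟨P', hP'⟩ := exists_differential h P
  obtain ⟨Q', hQ'⟩ := exists_differential h Q
  rw [hT', differential_eq_extD, hT, extD_wedgeL h, ← toL_differential h P, ← toL_differential h Q,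
    ← hP', ← hQ', wedge_eq_wedgeL, wedge_eq_wedgeL, sg_toL, wedgeL_smul_left]

variable {A : Type*} [AddCommGroup A] [Module R A] {pair : N →ₗ[R] A →ₗ[R] R} {act : A → R → R}
  {brA : A → A → A} {φ : N} {D : N → A → A} {θ : N → R}

omit [Algebra ℝ R] [AddCommGroup N] [Module R N] in
theorem modDifferential_eq_differential (h : ∀ x f, a x f + f * θ x = ρ x f) {k : ℕ}
    (P : (Fin k → N) → R) : modDifferential a br θ P = differential ρ br P := by
  rw [modDifferential_eq]; congr 1; funext x f; exact h x f

variable (hA : IsConnection act act brA)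
  (h : IsCompatible pair (jet pair act φ) (modD pair act brA φ) a ρ br D)
  (hθ : ∀ x f, a x f + f * θ x = ρ x f)
include hA h hθ

/-- The differential is a derivation of the modified Schouten bracket. -/
theorem modDifferential_modSchouten {p q k : ℕ} (hk : p + q = k + 1) (P : N [⋀^Fin p]→ₗ[R] R)
    (Q : N [⋀^Fin q]→ₗ[R] R) (β : Fin (k + 1) → N) :
    modDifferential a br θ (modSchouten pair act brA φ hk P Q) β =
      modSchouten pair act brA φ (show (p + 1) + q = (k + 1) + 1 by omega)
        (modDifferential a br θ P) Q β
      + (-1) ^ (p + 1) * modSchouten pair act brA φ (show p + (q + 1) = (k + 1) + 1 by omega)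
        P (modDifferential a br θ Q) β := by
  have hc := h.toIsConnection
  have hp := h.perfect
  have hj := h.j_add
  have hτ := h.form
  -- The bracket must first be known to be a multivector, since the classical formula for d is
  -- identified with the recursive one only on alternating maps.
  obtain ⟨T, hT⟩ := ((show ((p : ℤ) + q - 1) = k by omega) ▸
    (hasDegree_toL P).schoutenL hp hj hτ (hasDegree_toL Q) (isAlt_toL P) (isAlt_toL Q)).exists_toL
    (IsAlt.schoutenL hp hj hτ (jet_mul hp hA) (modD_add hA) (modD_smul hp hA)
      (isAlt_toL P) (isAlt_toL Q))
  have hT' : modSchouten pair act brA φ hk P Q = ⇑T :=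
    funext fun w => by rw [modSchouten_eq_schoutenL hp hA, ← hT, toL_ofFn]
  obtain ⟨P', hP'⟩ := exists_differential hc P
  obtain ⟨Q', hQ'⟩ := exists_differential hc Q
  simp only [modDifferential_eq_differential hθ]
  rw [hT', differential_eq_extD, hT, extD_schoutenL h (isAlt_toL P) (isAlt_toL Q),
    ← toL_differential hc P, ← toL_differential hc Q, ← hP', ← hQ', modSchouten_eq_schoutenL hp hA,
    modSchouten_eq_schoutenL hp hA, sg_toL]
  rcases neg_one_pow_eq_or R p with e | e
  · simp [pow_succ, e, sub_eq_add_neg]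
  · simp [pow_succ, e, schoutenL_neg_left hp hj hτ (isAlt_toL P) (isAlt_toL Q')]

theorem modSchouten_modDifferential_zero (P Q : N [⋀^Fin 0]→ₗ[R] R) (β : Fin 0 → N) :
    modSchouten pair act brA φ (show 1 + 0 = 0 + 1 by omega) (modDifferential a br θ P) Q β
      + (-1) ^ (0 + 1) * modSchouten pair act brA φ (show 0 + 1 = 0 + 1 by omega)
        P (modDifferential a br θ Q) β = 0 := by
  have hc := h.toIsConnection
  obtain ⟨P', hP'⟩ := exists_differential hc P
  obtain ⟨Q', hQ'⟩ := exists_differential hc Q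
  have e := extD_schoutenL h (isAlt_toL P) (isAlt_toL Q) []
  rw [← toL_differential hc P, ← toL_differential hc Q, ← hP', ← hQ', sg_toL, pow_zero,
    one_smul] at e
  simp only [modDifferential_eq_differential hθ]
  rw [← hP', ← hQ', modSchouten_eq_schoutenL h.perfect hA, modSchouten_eq_schoutenL h.perfect hA,
    List.ofFn_zero, zero_add, pow_one, neg_one_mul, ← sub_eq_add_neg, ← e]
  rfl

end Bundling

end TwistedJacobi

namespace TwistedJacobi

/-! ### Vector fields, local frames and duality -/

noncomputable section VectorFields

open Filter
open scoped Topology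

variable {n : ℕ} {M : Type*} [TopologicalSpace M] [ChartedSpace (EuclideanSpace ℝ (Fin n)) M]
  [IsManifold (𝓡 n) ∞ M]

theorem lieBracket_swap (X Y : VecField n M) : lieBracket X Y = -lieBracket Y X := by
  ext1 x
  exact VectorField.mlieBracket_swap_apply

theorem lieBracket_jacobi (X Y Z : VecField n M) : lieBracket (lieBracket X Y) Z
    = lieBracket X (lieBracket Y Z) - lieBracket Y (lieBracket X Z) := by
  have : IsManifold (𝓡 n) (minSmoothness ℝ 3) M := by
    rw [minSmoothness_of_isRCLikeNormedField]
    exact IsManifold.of_le (n := ∞) (by norm_cast)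
  have hs : ∀ X : VecField n M, ContMDiff (𝓡 n) (𝓡 n).tangent (minSmoothness ℝ 2)
      (fun x => (⟨x, X x⟩ : TangentBundle (𝓡 n) M)) := fun X => by
    rw [minSmoothness_of_isRCLikeNormedField]
    exact X.contMDiff.of_le (by norm_cast)
  have e := VectorField.leibniz_identity_mlieBracket (hs X) (hs Y) (hs Z)
  rw [eq_sub_iff_add_eq]
  ext1 x
  exact (congrFun e x).symm

/-- Expanding the Jacobi identity for X, Y and fZ leaves the difference of the two sides times Z,
which is therefore zero for every Z. -/
theorem lieD_bracket (X Y : VecField n M) (f : SmoothFun n M) :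
    lieD (lieBracket X Y) f = lieD X (lieD Y f) - lieD Y (lieD X f) := by
  have key : ∀ Z : VecField n M,
      (lieD (lieBracket X Y) f - (lieD X (lieD Y f) - lieD Y (lieD X f))) • Z = 0 := fun Z => by
    have e := lieBracket_jacobi X Y (f • Z)
    simp only [lieBracket_smul_right, lieBracket_add_right, lieBracket_jacobi X Y Z, smul_sub] at e
    rw [sub_smul, sub_smul, sub_eq_zero]
    have := sub_eq_zero.2 e
    rw [← sub_eq_zero, ← this]
    abel
  ext x
  -- A field with Z x ≠ 0 can be cancelled. If none exists, every derivative of a function vanishes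
  -- at x.
  by_cases h : ∃ Z : VecField n M, Z x ≠ 0
  · obtain ⟨Z, hZ⟩ := h
    have := congrArg (fun W : VecField n M => W x) (key Z)
    exact sub_eq_zero.1 ((smul_eq_zero.1 this).resolve_right hZ)
  · push Not at h
    have h0 : ∀ (Z : VecField n M) (g : SmoothFun n M), lieD Z g x = 0 := fun Z g => by
      rw [lieD_apply, h Z, map_zero]
    change lieD _ f x = lieD X (lieD Y f) x - lieD Y (lieD X f) x
    rw [h0, h0, h0, sub_zero]

theorem sum_apply {ι : Type*} (t : Finset ι) (X : ι → VecField n M) (x : M) :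
    (∑ i ∈ t, X i) x = ∑ i ∈ t, X i x :=
  map_sum (AddMonoidHom.mk' (fun X : VecField n M => X x) fun _ _ => rfl) X t

omit [IsManifold (𝓡 n) ∞ M] in
theorem fun_sum_apply {ι : Type*} (t : Finset ι) (f : ι → SmoothFun n M) (x : M) :
    (∑ i ∈ t, f i) x = ∑ i ∈ t, f i x :=
  map_sum (AddMonoidHom.mk' (fun f : SmoothFun n M => f x) fun _ _ => rfl) f t

variable [T2Space M]

/-- A bump function as a smooth function. -/
def bump (c : M) (f : SmoothBumpFunction (𝓡 n) c) : SmoothFun n M := ⟨f, f.contMDiff⟩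

/-- Frames of the tangent bundle near a point, extended by bump functions. -/
theorem exists_frame (c : M) : ∃ (χ : SmoothFun n M) (e : Fin n → VecField n M)
    (α : Fin n → OneForm n M), (∀ᶠ x in 𝓝 c, χ x = 1) ∧
    (∀ i Y Z x, Y x = Z x → α i Y x = α i Z x) ∧ ∀ Y, χ • Y = ∑ i, α i Y • e i := by
  obtain ⟨f⟩ : Nonempty (SmoothBumpFunction (𝓡 n) c) := inferInstance
  let t := trivializationAt (EuclideanSpace ℝ (Fin n)) (TangentSpace (𝓡 n) : M → Type _) c
  let b : Module.Basis (Fin n) ℝ (EuclideanSpace ℝ (Fin n)) := (EuclideanSpace.basisFun (Fin n) ℝ).toBasis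
  have ht : t.baseSet = (chartAt (EuclideanSpace ℝ (Fin n)) c).source := rfl
  have hf : tsupport f ⊆ t.baseSet := f.tsupport_subset_chartAt_source
  have hcoeff : ∀ (Y : VecField n M) (i : Fin n),
      ContMDiff (𝓡 n) 𝓘(ℝ, ℝ) ∞ (fun x => f x * t.localFrameCoeff (𝓡 n) b i x (Y x)) := fun Y i => by
    refine f.contMDiff_smul (g := fun x => t.localFrameCoeff (𝓡 n) b i x (Y x)) ?_
    exact contMDiffOn_baseSet_localFrameCoeff (e := t) b Y.contMDiff.contMDiffOn i
  let e : Fin n → VecField n M := fun i =>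
    ⟨fun x => f x • t.localFrame b i x, f.contMDiff.contMDiffOn.smul_section_of_tsupport t.open_baseSet hf
      (t.contMDiffOn_localFrame_baseSet ∞ b i)⟩
  let α : Fin n → OneForm n M := fun i =>
    { toFun := fun Y => ⟨fun x => f x * t.localFrameCoeff (𝓡 n) b i x (Y x), hcoeff Y i⟩
      map_add' := fun Y Z => by
        ext x
        change f x * t.localFrameCoeff (𝓡 n) b i x (Y x + Z x) = _
        rw [map_add, mul_add]; rfl
      map_smul' := fun g Y => by
        ext x
        change f x * t.localFrameCoeff (𝓡 n) b i x (g x • Y x) = g x * (f x * _)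
        rw [map_smul, smul_eq_mul]; ring }
  -- The cutoff is the square of the bump function: one factor extends the coefficients, the other
  -- the frame vectors.
  refine ⟨bump c f * bump c f, e, α, ?_, fun i Y Z x h => ?_, fun Y => ?_⟩
  · filter_upwards [f.eventuallyEq_one] with x hx
    change f x * f x = 1
    rw [hx]; simp
  · change f x * t.localFrameCoeff (𝓡 n) b i x (Y x) = f x * t.localFrameCoeff (𝓡 n) b i x (Z x)
    rw [h]
  · ext1 x
    have hsum : (∑ i, α i Y • e i) x = ∑ i, (f x * t.localFrameCoeff (𝓡 n) b i x (Y x)) •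
        (f x • t.localFrame b i x) := by
      exact sum_apply _ _ x
    rw [hsum]
    change (f x * f x) • Y x = _
    by_cases hx : x ∈ t.baseSet
    · conv_lhs => rw [t.eq_sum_localFrameCoeff_smul (I := 𝓡 n) (b := b) (s := Y) hx]
      rw [Finset.smul_sum]
      refine Finset.sum_congr rfl fun i _ => ?_
      simp only [smul_smul]; congr 1; ring
    · have : f x = 0 := by
        by_contra h0
        exact hx (f.support_subset_source h0)
      simp [this]

/-- The value of a 1-form at a point only depends on the value of the vector field there. -/
theorem oneForm_congr (β : OneForm n M) {Y Z : VecField n M} {x : M} (h : Y x = Z x) :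
    β Y x = β Z x := by
  obtain ⟨χ, e, α, hχ, hα, he⟩ := exists_frame (n := n) x
  have key : ∀ Z : VecField n M, β Z x = ∑ i, α i Z x * β (e i) x := fun Z => by
    have := congrArg (fun W : VecField n M => β W x) (he Z)
    simp only [map_smul, map_sum, smul_eq_mul] at this
    rw [fun_sum_apply] at this
    rw [show β Z x = χ x * β Z x by rw [hχ.self_of_nhds, one_mul]]
    exact this
  rw [key Y, key Z]
  exact Finset.sum_congr rfl fun i _ => by rw [hα i Y Z x h]

/-- The pairing of 1-forms with vector fields is perfect. -/
theorem isPerfPair_id :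
    (LinearMap.id : OneForm n M →ₗ[SmoothFun n M] OneForm n M).IsPerfPair := by
  -- Near a point, the vector field representing a functional T on 1-forms is ∑ T(αᵢ) eᵢ, as on a
  -- free module with dual bases.
  have hfr : ∀ (χ : SmoothFun n M) (e : Fin n → VecField n M) (α : Fin n → OneForm n M),
      (∀ Y, χ • Y = ∑ i, α i Y • e i) → ∀ (T : OneForm n M →ₗ[SmoothFun n M] SmoothFun n M) β,
      χ * T β = β (∑ i, T (α i) • e i) := by
    intro χ e α h T β
    have : χ • β = ∑ i, β (e i) • α i := by
      ext1 Y
      simp only [LinearMap.smul_apply, LinearMap.sum_apply]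
      rw [← map_smul, h, map_sum]
      exact Finset.sum_congr rfl fun i _ => by rw [map_smul, smul_eq_mul, smul_eq_mul, mul_comm]
    rw [← smul_eq_mul, ← map_smul, this, map_sum, map_sum]
    exact Finset.sum_congr rfl fun i _ => by
      rw [map_smul, map_smul, smul_eq_mul, smul_eq_mul, mul_comm]
  have hinj : ∀ (X Y : VecField n M) (x : M), (∀ β : OneForm n M, β X x = β Y x) → X x = Y x := by
    intro X Y x h
    obtain ⟨χ, e, α, hχ, -, he⟩ := exists_frame (n := n) x
    have key : ∀ Z : VecField n M, Z x = ∑ i, α i Z x • e i x := fun Z => by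
      have := congrArg (fun W : VecField n M => W x) (he Z)
      simp only [sum_apply, smul_apply, hχ.self_of_nhds, one_smul] at this
      exact this
    rw [key X, key Y]
    simp only [h]
  refine ⟨Function.bijective_id, fun X Y h => ?_, fun T => ?_⟩
  · ext1 x
    exact hinj X Y x fun β => congrArg (fun f => f x) (LinearMap.congr_fun h β)
  · choose χ e α hχ hα he using exists_frame (n := n) (M := M)
    have hT : ∀ (c x : M) β, χ c x = 1 → T β x = β (∑ i, T (α c i) • e c i) x := fun c x β h => by
      rw [← hfr (χ c) (e c) (α c) (he c) T β]
      change _ = χ c x * _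
      rw [h, one_mul]
    have hloc : ∀ c x, χ c x = 1 →
        (∑ i, T (α x i) • e x i : VecField n M) x = (∑ i, T (α c i) • e c i : VecField n M) x :=
      fun c x h => hinj _ _ x fun β => by rw [← hT c x β h, ← hT x x β (hχ x).self_of_nhds]
    -- The local representatives agree where the cutoff is 1, because 1-forms separate tangent
    -- vectors. The field taking at x the value of the representative for x is thus smooth, near c
    -- being the one for c.
    refine ⟨⟨fun x => (∑ i, T (α x i) • e x i : VecField n M) x, fun c => ?_⟩, ?_⟩
    · refine ((∑ i, T (α c i) • e c i : VecField n M).contMDiff c).congr_of_eventuallyEq ?_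
      filter_upwards [hχ c] with x hx
      rw [hloc c x hx]
    · ext β x
      rw [hT x x β (hχ x).self_of_nhds]
      exact oneForm_congr β rfl

end VectorFields

end TwistedJacobi

namespace TwistedJacobi

/-! ### Differentials of 2-forms and brackets of bivectors -/

noncomputable section FormCalculus

variable {R A B : Type*} [CommRing R] [AddCommGroup A] [Module R A] [AddCommGroup B] [Module R B]

/-- The differential of a 2-form. -/
def dTwo (op : A → R → R) (br : A → A → A) (S : A → A → R) (u v w : A) : R :=
  op u (S v w) - op v (S u w) + op w (S u v) - S (br u v) w + S (br u w) v - S (br v w) u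

/-- The differential of a 2-form is a closed 3-form, if the action is flat. -/
theorem isClosedForm_dTwo {act op : A → R → R} {br : A → A → A} (h : IsConnection act op br)
    (hop : ∀ u v f, op (br u v) f = op u (op v f) - op v (op u f))
    (hjac : ∀ u v w, br (br u v) w = br u (br v w) - br v (br u w)) {S : A → A → R}
    (hS : IsTwoForm S) : IsClosedForm op br (dTwo op br S) where
  skew_left u v w := by
    simp only [dTwo, h.skew v u, hS.neg_left, hS.skew v u, neg_of_additive (h.add_right w)]
    ring
  skew_right u v w := by
    simp only [dTwo, h.skew w v, hS.neg_left, hS.skew w v, neg_of_additive (h.add_right u)]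
    ring
  add_left u u' v w := by
    simp only [dTwo, h.skew (u + u'), h.br_add, hS.add_left, hS.add_right, h.add_right, h.add_left,
      hS.neg_left, h.skew u, h.skew u']
    ring
  smul_left c u v w := by
    simp only [dTwo, h.skew (c • u), h.br_smul, hS.add_left, hS.smul_left, hS.smul_right,
      h.mul_right, h.smul_left, hS.neg_left, h.skew u]
    ring
  closed u v w z := by
    -- The iterated brackets in d² S cancel by the Jacobi identity, used once for each choice of the
    -- argument z left outside.
    have e : ∀ u v w z, S (br (br u v) w) z - S (br (br u w) v) z + S (br (br v w) u) z = 0 :=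
      fun u v w z => by
        rw [hjac, h.skew (br u w) v, h.skew (br v w) u]
        simp only [sub_eq_add_neg, hS.add_left, hS.neg_left]
        ring
    simp only [dTwo, h.add_right, sub_of_additive (h.add_right _), hop]
    linear_combination e u v w z - e u v z w + e u w z v - e v w z u
      + hS.skew (br u v) (br w z) - hS.skew (br u w) (br v z) + hS.skew (br u z) (br v w)

theorem toL_pair {N : Type*} (P : (Fin 2 → N) → R) (x y : N) : toL P [x, y] = P ![x, y] := by
  rw [← toL_ofFn P]; simp

theorem toL_triple {N : Type*} (P : (Fin 3 → N) → R) (x y z : N) :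
    toL P [x, y, z] = P ![x, y, z] := by
  rw [← toL_ofFn P]; simp

theorem isTwoForm_of_alternating (P : A [⋀^Fin 2]→ₗ[R] R) : IsTwoForm fun u v => P ![u, v] where
  skew u v := by
    simpa only [toL_pair, List.nil_append] using (isAlt_toL P).swap [] u v []
  add_left u v w := by
    simpa only [toL_pair] using (isAlt_toL P).cons_add u v [w]
  smul_left c u w := by
    simpa only [toL_pair] using (isAlt_toL P).cons_smul c u [w]

/-- The Schouten bracket of a bivector with itself. -/
theorem schoutenL_bivector {pair : B →ₗ[R] A →ₗ[R] R} {act : A → R → R} {br : A → A → A} {φ : B}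
    (hp : pair.IsPerfPair) (hA : IsConnection act act br) {s : B → A}
    (P : B [⋀^Fin 2]→ₗ[R] R) (hs : ∀ x y, pair y (s x) = P ![x, y]) (x y z : B) :
    schoutenL pair (jet pair act φ) (modD pair act br φ) (toL P) (toL P) [x, y, z]
      = 2 * (pair z (br (s x) (s y)) + (modAct pair act φ (s x) (pair y (s z))
        - pair y (br (s x) (s z)) - modAct pair act φ (s y) (pair x (s z)) + pair x (br (s y) (s z))
        - modAct pair act φ (s z) (pair y (s x)))) := by
  have hP := isAlt_toL P
  have h1 : ∀ x, toL P [x] = 0 := fun x => toL_of_length_ne P (by simp)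
  have h0 : toL P [] = 0 := toL_of_length_ne P (by simp)
  have h3 : ∀ x y z, toL P [x, y, z] = 0 := fun x y z => toL_of_length_ne P (by simp)
  have h4 : ∀ x y z w, toL P [x, y, z, w] = 0 := fun x y z w => toL_of_length_ne P (by simp)
  have hx : ∀ x, hat pair (con x (toL P)) = s x := fun x => ext_right hp fun b => by
    rw [pair_hat hp (hP.con x), hs, con_apply, toL_pair]
  have hxy : ∀ x y, hat pair (con x (con y (toL P))) = 0 := fun x y => ext_right hp fun b => by
    rw [pair_hat hp ((hP.con y).con x), con_apply, con_apply, h3, map_zero]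
  have hn : hat pair (toL P) = 0 := ext_right hp fun b => by
    rw [pair_hat hp hP, h1, map_zero]
  have hτ := modD_isTwoForm (pair := pair) (φ := φ) hA
  have hc := hP.con
  have hcc := fun x y => (hP.con x).con y
  have hz : ∀ x u, modD pair act br φ x u 0 = 0 := fun x u => by
    rw [← zero_smul R (0 : A), (hτ x).smul_right, zero_mul]
  have h2 : ∀ x y, toL P [x, y] = pair y (s x) := fun x y => by rw [hs, toL_pair]
  have hsk : ∀ x y, pair x (s y) = -pair y (s x) := fun x y => by
    rw [hs, hs]; exact (isTwoForm_of_alternating P).skew _ _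
  have hop : ∀ u f, modAct pair act φ u (-f) = -modAct pair act φ u f := fun u =>
    neg_of_additive ((modAct_isConnection hA φ).add_right u)
  simp only [schoutenL, pairS, con_sg, sg_neg, sg_sg, con_neg, neg_neg, neg_zero, hat_neg hp (hc _),
    hat_sg hp hP, hat_sg hp (hcc _ _), hat_neg hp (hcc _ _).sg, hx, hxy, hn, hz,
    (hτ _).neg_left, (hτ _).skew (s y) (s x), (hτ _).skew (s z) (s x), (hτ _).skew (s z) (s y)]
  simp only [con_apply, Pi.neg_apply, sg, List.length_cons, List.length_nil, h1, h3, h4, h2,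
    pair_jet hp hA, modD, hsk x y, hsk x z, hsk y z, hop]
  simp only [zero_add, pow_zero, pow_one, one_mul, mul_zero]
  ring

/-- Wedge products of 1-forms and alternating maps are alternating. -/
theorem exists_oneWedge [Algebra ℝ R] (θ : A →ₗ[R] R) {k : ℕ} (P : A [⋀^Fin k]→ₗ[R] R) :
    ∃ T : A [⋀^Fin (k + 1)]→ₗ[R] R, ⇑T = oneWedge θ P := by
  -- The operator θ ∧ · is the differential for the zero bracket and the action of x by
  -- multiplication with θ(x), so it preserves alternating maps.
  have h : IsConnection (fun (_ : A) (_ : R) => (0 : R)) (fun x f => f * θ x) (fun _ _ => 0) :=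
    { add_right := fun x f g => by ring
      mul_right := fun x f g => by ring
      add_left := fun x y f => by rw [map_add]; ring
      smul_left := fun c x f => by rw [map_smul, smul_eq_mul]; ring
      skew := by simp
      br_add := by simp
      br_smul := by simp }
  obtain ⟨T, hT⟩ := exists_differential h P
  refine ⟨T, ?_⟩
  rw [hT]
  funext v
  have h0 : ∀ i j : Fin (k + 1), i < j →
      P (fun l => Function.update v i 0 (j.succAbove l)) = 0 := fun i j hij => by
    obtain ⟨l, hl⟩ := Fin.exists_succAbove_eq hij.ne
    exact P.map_coord_zero l (by rw [hl, Function.update_self])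
  simp only [differential, oneWedge]
  rw [Finset.sum_eq_zero (s := Finset.univ) (f := fun i => ∑ j, _) fun i _ =>
    Finset.sum_eq_zero fun j _ => by
      split_ifs with hij
      · rw [h0 i j hij, mul_zero]
      · rfl, add_zero]
  exact Finset.sum_congr rfl fun i _ => by ring

/-- Pairs of forms are sections of the exterior powers. -/
theorem exists_pairField [Algebra ℝ R] {k : ℕ} (P : A [⋀^Fin (k + 1)]→ₗ[R] R)
    (Q : A [⋀^Fin k]→ₗ[R] R) :
    ∃ T : (A × R) [⋀^Fin (k + 1)]→ₗ[R] R, ⇑T = pairField P Q := by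
  obtain ⟨T, hT⟩ := exists_oneWedge (LinearMap.snd R A R) (Q.compLinearMap (LinearMap.fst R A R))
  refine ⟨P.compLinearMap (LinearMap.fst R A R) + T, ?_⟩
  funext v
  rw [AlternatingMap.add_apply, hT]
  rfl

end FormCalculus

/-! ### The algebroid TM × ℝ and its dual -/

noncomputable section Manifold

variable {n : ℕ} {M : Type*} [TopologicalSpace M] [ChartedSpace (EuclideanSpace ℝ (Fin n)) M]
  [IsManifold (𝓡 n) ∞ M]

theorem lieD_add_left (X Y : VecField n M) (f : SmoothFun n M) :
    lieD (X + Y) f = lieD X f + lieD Y f := map_add (dFun f) X Y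

theorem lieD_smul_left (g : SmoothFun n M) (X : VecField n M) (f : SmoothFun n M) :
    lieD (g • X) f = g * lieD X f := map_smul (dFun f) g X

theorem isConnection_lieBracket :
    IsConnection (R := SmoothFun n M) (N := VecField n M) lieD lieD lieBracket where
  add_right := lieD_add
  mul_right X f g := by rw [lieD_mul]; ring
  add_left := lieD_add_left
  smul_left := lieD_smul_left
  skew := lieBracket_swap
  br_add := lieBracket_add_right
  br_smul X f Y := by rw [lieBracket_smul_right, add_comm]

theorem lieD_neg (X : VecField n M) (f : SmoothFun n M) : lieD X (-f) = -lieD X f :=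
  neg_of_additive (lieD_add X) f

theorem lieD_sub (X : VecField n M) (f g : SmoothFun n M) : lieD X (f - g) = lieD X f - lieD X g :=
  sub_of_additive (lieD_add X) f g

theorem pairR_apply (u : CotR n M) (v : TanR n M) : pairR n M u v = u.1 v.1 + u.2 * v.2 := rfl

theorem isConnection_bracketR :
    IsConnection (R := SmoothFun n M) (N := TanR n M) (actBy proj) (actBy proj) bracketR where
  add_right u f g := lieD_add _ f g
  mul_right u f g := isConnection_lieBracket.mul_right _ f g
  add_left u v f := lieD_add_left _ _ f
  smul_left c u f := lieD_smul_left c _ f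
  skew u v := by
    simp only [bracketR, Prod.neg_mk, neg_sub]
    rw [lieBracket_swap]
  br_add u v w := by
    simp only [bracketR, Prod.fst_add, Prod.snd_add, lieBracket_add_right, lieD_add, lieD_add_left,
      Prod.mk_add_mk]
    congr 1; ring
  br_smul u f v := by
    simp only [bracketR, Prod.smul_fst, Prod.smul_snd, lieBracket_smul_right, lieD_mul,
      lieD_smul_left, Prod.smul_mk, smul_eq_mul, actBy, proj]
    ext1
    · simp [add_comm]
    · simp; ring

theorem bracketR_jacobi (u v w : TanR n M) : bracketR (bracketR u v) w
    = bracketR u (bracketR v w) - bracketR v (bracketR u w) := by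
  simp only [bracketR, Prod.mk_sub_mk, lieBracket_jacobi u.1 v.1 w.1, lieD_sub, lieD_bracket]
  congr 1; ring

variable [T2Space M]

theorem pairR_isPerfPair : (pairR n M).IsPerfPair := by
  have hp := isPerfPair_id (n := n) (M := M)
  refine ⟨⟨fun u v h => ?_, fun T => ?_⟩, ⟨fun u v h => ?_, fun T => ?_⟩⟩
  · have e : ∀ w, pairR n M u w = pairR n M v w := LinearMap.congr_fun h
    ext1
    · exact LinearMap.ext fun X => by simpa [pairR_apply] using e (X, 0)
    · simpa [pairR_apply] using e (0, 1)
  · refine ⟨(T.comp (LinearMap.inl _ _ _), T (0, 1)), LinearMap.ext fun w => ?_⟩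
    have e : w = (w.1, 0) + w.2 • (0, 1) := by ext1 <;> simp
    rw [pairR_apply]
    conv_rhs => rw [e, map_add, map_smul]
    simp [mul_comm]
  · have e : ∀ w, pairR n M w u = pairR n M w v := LinearMap.congr_fun h
    ext1
    · exact hp.bijective_right.1 (LinearMap.ext fun β => by simpa [pairR_apply] using e (β, 0))
    · simpa [pairR_apply] using e (0, 1)
  · obtain ⟨X, hX⟩ := hp.bijective_right.2 (T.comp (LinearMap.inl _ _ _))
    have hX' : ∀ β : OneForm n M, β X = T (β, 0) := LinearMap.congr_fun hX
    refine ⟨(X, T (0, 1)), LinearMap.ext fun w => ?_⟩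
    have e : w = (w.1, 0) + w.2 • (0, 1) := by ext1 <;> simp
    change pairR n M w _ = _
    rw [pairR_apply, hX']
    conv_rhs => rw [e, map_add, map_smul]
    simp

theorem apply_sharp (Λ : OneForm n M [⋀^Fin 2]→ₗ[SmoothFun n M] SmoothFun n M)
    (α β : OneForm n M) : β (sharp Λ α) = Λ ![α, β] := by
  have hS := isTwoForm_of_alternating Λ
  exact pair_represent isPerfPair_id { toFun := fun β => Λ ![α, β], map_add' := hS.add_right α,
                                       map_smul' := fun c => hS.smul_right c α } β

end Manifold

end TwistedJacobi

namespace TwistedJacobi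

/-! ### Twisted Jacobi structures -/

noncomputable section Twisted

variable {n : ℕ} {M : Type*} [TopologicalSpace M] [ChartedSpace (EuclideanSpace ℝ (Fin n)) M]
  [IsManifold (𝓡 n) ∞ M]

theorem exists_twistForm (om : VecField n M [⋀^Fin 2]→ₗ[SmoothFun n M] SmoothFun n M) :
    ∃ T : TanR n M [⋀^Fin 3]→ₗ[SmoothFun n M] SmoothFun n M, ⇑T = twistForm om := by
  obtain ⟨P, hP⟩ := exists_differential isConnection_lieBracket om
  obtain ⟨T, hT⟩ := exists_pairField P om
  exact ⟨T, by rw [hT, hP]; rfl⟩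

theorem modAct_pairR (u : TanR n M) (f : SmoothFun n M) :
    modAct (pairR n M) (actBy proj) (0, 1) u f = lieD u.1 f + f * u.2 := by
  simp [modAct, actBy, proj, pairR_apply]

theorem modAct_bracketR (u v : TanR n M) (f : SmoothFun n M) :
    modAct (pairR n M) (actBy proj) (0, 1) (bracketR u v) f
      = modAct (pairR n M) (actBy proj) (0, 1) u (modAct (pairR n M) (actBy proj) (0, 1) v f)
      - modAct (pairR n M) (actBy proj) (0, 1) v (modAct (pairR n M) (actBy proj) (0, 1) u f) := by
  simp only [modAct_pairR, bracketR, lieD_bracket, lieD_add, lieD_mul]; ring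

/-- The pair (dω, ω) is the (0,1)-differential of (ω, 0): the second entry comes from wedging with
(0,1). Its closedness thus requires nothing of ω. -/
theorem twistForm_apply (om : VecField n M [⋀^Fin 2]→ₗ[SmoothFun n M] SmoothFun n M)
    (u v w : TanR n M) : twistForm om ![u, v, w]
      = dTwo (modAct (pairR n M) (actBy proj) (0, 1)) bracketR (fun u v => om ![u.1, v.1]) u v w := by
  have h : dForm om ![u.1, v.1, w.1] = dTwo lieD lieBracket (fun X Y => om ![X, Y]) u.1 v.1 w.1 := by
    rw [dForm, differential_eq_extD]
    have hS := isTwoForm_of_alternating om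
    have e1 := hS.skew v.1 (lieBracket u.1 w.1)
    have e2 := hS.skew u.1 (lieBracket v.1 w.1)
    simp only [dTwo]
    simp only [List.ofFn_succ, List.ofFn_zero, Matrix.cons_val_zero, Matrix.cons_val_succ, extD,
      lieL, con_apply, toL_pair, sub_zero]
    linear_combination e2 - e1
  have e : twistForm om ![u, v, w] = dForm om ![u.1, v.1, w.1]
      + (u.2 * om ![v.1, w.1] - v.2 * om ![u.1, w.1] + w.2 * om ![u.1, v.1]) := by
    rw [twistForm, pairField, oneWedge, Fin.sum_univ_three]
    have h1 : (fun i => (![u, v, w] i).1) = ![u.1, v.1, w.1] := by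
      funext i; fin_cases i <;> rfl
    have h2 : (fun i : Fin 2 => (![u, v, w] ((0 : Fin 3).succAbove i)).1) = ![v.1, w.1] := by
      funext i; fin_cases i <;> rfl
    have h3 : (fun i : Fin 2 => (![u, v, w] ((1 : Fin 3).succAbove i)).1) = ![u.1, w.1] := by
      funext i; fin_cases i <;> rfl
    have h4 : (fun i : Fin 2 => (![u, v, w] ((2 : Fin 3).succAbove i)).1) = ![u.1, v.1] := by
      funext i; fin_cases i <;> rfl
    rw [h1, h2, h3, h4]
    simp
    ring
  rw [e, h]
  simp only [dTwo, modAct_pairR, bracketR]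
  ring

theorem isClosedForm_twistForm (om : VecField n M [⋀^Fin 2]→ₗ[SmoothFun n M] SmoothFun n M) :
    IsClosedForm (modAct (pairR n M) (actBy proj) (0, 1)) bracketR
      (fun u v w => twistForm om ![u, v, w]) := by
  have hS := isTwoForm_of_alternating om
  have : (fun u v w => twistForm om ![u, v, w])
      = dTwo (modAct (pairR n M) (actBy proj) (0, 1)) bracketR (fun u v => om ![u.1, v.1]) := by
    funext u v w; exact twistForm_apply om u v w
  rw [this]
  exact isClosedForm_dTwo (modAct_isConnection isConnection_bracketR _) modAct_bracketR
    bracketR_jacobi ⟨fun u v => hS.skew _ _, fun u v w => hS.add_left _ _ _,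
      fun c u w => hS.smul_left c _ _⟩

theorem biField_apply (Λ : OneForm n M [⋀^Fin 2]→ₗ[SmoothFun n M] SmoothFun n M) (E : VecField n M)
    (x y : CotR n M) : biField Λ E ![x, y] = Λ ![x.1, y.1] + x.2 * y.1 E - y.2 * x.1 E := by
  rw [biField, pairField, oneWedge, Fin.sum_univ_two]
  have h1 : (fun i => (![x, y] i).1) = ![x.1, y.1] := by
    funext i; fin_cases i <;> rfl
  rw [h1]
  simp
  ring

theorem exists_biField (Λ : OneForm n M [⋀^Fin 2]→ₗ[SmoothFun n M] SmoothFun n M)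
    (E : VecField n M) :
    ∃ T : CotR n M [⋀^Fin 2]→ₗ[SmoothFun n M] SmoothFun n M, ⇑T = biField Λ E := by
  exact exists_pairField Λ
    { toFun := fun α => α 0 E
      map_update_add' := fun m i x y => by
        obtain rfl : i = 0 := Subsingleton.elim _ _
        simp
      map_update_smul' := fun m i c x => by
        obtain rfl : i = 0 := Subsingleton.elim _ _
        simp
      map_eq_zero_of_eq' := fun v i j _ hij => (hij (Subsingleton.elim _ _)).elim }

variable [T2Space M]

theorem pairR_sharpR (Λ : OneForm n M [⋀^Fin 2]→ₗ[SmoothFun n M] SmoothFun n M) (E : VecField n M)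
    (x y : CotR n M) : pairR n M y (sharpR Λ E x) = biField Λ E ![x, y] := by
  rw [pairR_apply, sharpR, map_add, map_smul, apply_sharp, biField_apply, smul_eq_mul]
  ring

/-- The explicit components γ and r assemble into L_{sx} y - L_{sy} x - d⟨y, sx⟩, with all operators
modified by (0,1). After this, Λ and E enter only through `sharpR`. -/
theorem pairR_jacobiBracket (Λ : OneForm n M [⋀^Fin 2]→ₗ[SmoothFun n M] SmoothFun n M)
    (E : VecField n M) (x y : CotR n M) (v : TanR n M) :
    pairR n M (jacobiBracket Λ E x y) v
      = modAct (pairR n M) (actBy proj) (0, 1) (sharpR Λ E x) (pairR n M y v)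
        - pairR n M y (bracketR (sharpR Λ E x) v)
        - modAct (pairR n M) (actBy proj) (0, 1) (sharpR Λ E y) (pairR n M x v)
        + pairR n M x (bracketR (sharpR Λ E y) v)
        - modAct (pairR n M) (actBy proj) (0, 1) v (pairR n M y (sharpR Λ E x)) := by
  have he : ∀ (α : OneForm n M) (g : SmoothFun n M), Λ ![α, dFun g] = lieD (sharp Λ α) g :=
    fun α g => (apply_sharp Λ α (dFun g)).symm
  have hl : ∀ (X : VecField n M) (β : OneForm n M) (Y : VecField n M),
      lieDeriv X β Y = lieD X (β Y) - β (lieBracket X Y) := fun _ _ _ => rfl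
  have hd : ∀ (f : SmoothFun n M) (X : VecField n M), dFun f X = lieD X f := fun _ _ => rfl
  have hb : ∀ (X Y Z : VecField n M) (f : SmoothFun n M), lieBracket (X + f • Y) Z
      = lieBracket X Z + f • lieBracket Y Z - lieD Z f • Y := fun X Y Z f => by
    rw [lieBracket_swap, lieBracket_add_right, lieBracket_smul_right, lieBracket_swap Z X,
      lieBracket_swap Z Y, smul_neg]
    abel
  simp only [modAct_pairR, pairR_apply, jacobiBracket, sharpR, bracketR, hb, map_add, map_sub,
    map_smul, smul_eq_mul, lieD_add_left, lieD_smul_left, lieD_add, lieD_mul, lieD_neg,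
    LinearMap.add_apply, LinearMap.sub_apply, LinearMap.smul_apply, apply_sharp, he, hl, hd]
  ring

theorem isTwistedStructure {Λ : OneForm n M [⋀^Fin 2]→ₗ[SmoothFun n M] SmoothFun n M}
    {E : VecField n M} {om : VecField n M [⋀^Fin 2]→ₗ[SmoothFun n M] SmoothFun n M}
    (h : IsTwistedJacobi Λ E om) :
    IsTwistedStructure (pairR n M) (actBy proj) bracketR (0, 1) (sharpR Λ E)
      (fun u v w => twistForm om ![u, v, w]) (bracketR' Λ E om) (twistedBracket Λ E om) := by
  have hp := pairR_isPerfPair (n := n) (M := M)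
  have hA := isConnection_bracketR (n := n) (M := M)
  have hΦ := isClosedForm_twistForm om
  obtain ⟨P, hP⟩ := exists_biField Λ E
  have hs : ∀ x y, pairR n M y (sharpR Λ E x) = P ![x, y] := fun x y => by rw [pairR_sharpR, hP]
  have hsk : ∀ x y, pairR n M x (sharpR Λ E y) = -pairR n M y (sharpR Λ E x) := fun x y => by
    rw [hs, hs]; exact (isTwoForm_of_alternating P).skew _ _
  have hr : ∀ u v w, pairR n M (represent (pairR n M).flip (fun w => twistForm om ![u, v, w])) w
      = twistForm om ![u, v, w] := fun u v =>
    pair_represent_flip hp (hΦ.add_right u v) (fun c => hΦ.smul_right c u v)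
  have hB : ∀ x y v, pairR n M (twistedBracket Λ E om x y) v = pairR n M (jacobiBracket Λ E x y) v
      + twistForm om ![sharpR Λ E x, sharpR Λ E y, v] := fun x y v => by
    rw [twistedBracket, map_add, LinearMap.add_apply, hr]
  exact {
    hA with
    perfect := hp
    act_br := fun u v f => lieD_bracket u.1 v.1 f
    jacobi := bracketR_jacobi
    closed_one := fun u v => by simp [pairR_apply, bracketR, actBy, proj]
    sharp_skew := hsk
    form := hΦ
    pair_brA := fun x u v => by rw [bracketR', map_sub, hsk, hr, sub_neg_eq_add]
    pair_brB := fun x y v => by rw [hB, pairR_jacobiBracket]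
    sharp_brB := fun x y => ext_right hp fun z => by
      -- Only here is the twisted Jacobi condition used. With v = sz, the value of the Schouten
      -- bracket is twice ⟨z, [sx,sy]⟩ + ⟨{x,y}, sz⟩. Dividing by 2 and moving `s` across the
      -- pairing gives [sx,sy] = s{x,y}^ω.
      have e := h ![x, y, z]
      rw [← hP, modSchouten_eq_schoutenL hp hA,
        show List.ofFn ![x, y, z] = [x, y, z] by simp, schoutenL_bivector hp hA P hs,
        ← pairR_jacobiBracket] at e
      rw [hsk, hB]
      have e1 : (fun i => sharpR Λ E (![x, y, z] i)) = ![sharpR Λ E x, sharpR Λ E y, sharpR Λ E z] := by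
        funext i; fin_cases i <;> rfl
      rw [e1] at e
      have e2 := congrArg (fun f : SmoothFun n M => (2⁻¹ : ℝ) • f) e
      have e3 : ∀ f : SmoothFun n M, (2⁻¹ : ℝ) • (2 * f) = f := fun f => by
        rw [two_mul, ← two_smul ℝ f, smul_smul]
        norm_num
      simp only [e3] at e2
      linear_combination -e2 }

end Twisted

end TwistedJacobi

namespace TwistedJacobi

/-! ### Differentials in low degree -/

section SmallDegree

variable {R N : Type*} [CommRing R] {ρ : N → R → R} {br : N → N → N}

theorem differential_function (f : R) (x : N) :
    differential ρ br (fun _ : Fin 0 → N => f) ![x] = ρ x f := by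
  simp [differential]

theorem differential_oneForm (g : N → R) (x y : N) :
    differential ρ br (fun v : Fin 1 → N => g (v 0)) ![x, y]
      = ρ x (g y) - ρ y (g x) - g (br x y) := by
  simp [differential, Fin.sum_univ_two, Fin.succAbove]
  ring

theorem toL_add {k : ℕ} (P Q : (Fin k → N) → R) : toL (P + Q) = toL P + toL Q := by
  funext l
  by_cases hl : l.length = k
  · simp [toL, hl]
  · simp [toL, hl]

theorem differential_add [AddCommGroup N] [Module R N]
    (h : ∀ x f g, ρ x (f + g) = ρ x f + ρ x g) {k : ℕ} (P Q : N [⋀^Fin k]→ₗ[R] R) :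
    differential ρ br (⇑P + ⇑Q) = differential ρ br P + differential ρ br Q := by
  funext v
  change differential ρ br (⇑(P + Q)) v = _
  rw [differential_eq_extD, show toL ⇑(P + Q) = toL P + toL Q from toL_add P Q, extD_add h,
    Pi.add_apply, Pi.add_apply, differential_eq_extD, differential_eq_extD]

end SmallDegree

end TwistedJacobi

/-! ### The theorem -/

open TwistedJacobi

theorem theoremp7p1 {n : ℕ} {M : Type*} [TopologicalSpace M]
    [ChartedSpace (EuclideanSpace ℝ (Fin n)) M] [IsManifold (𝓡 n) ∞ M] [T2Space M]
    (Λ : TwistedJacobi.OneForm n M [⋀^Fin 2]→ₗ[TwistedJacobi.SmoothFun n M]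
      TwistedJacobi.SmoothFun n M)
    (E : TwistedJacobi.VecField n M)
    (om : TwistedJacobi.VecField n M [⋀^Fin 2]→ₗ[TwistedJacobi.SmoothFun n M]
      TwistedJacobi.SmoothFun n M)
    (h : TwistedJacobi.IsTwistedJacobi Λ E om) :
    TwistedJacobi.IsQuasiJacobiBialgebroid (TwistedJacobi.pairR n M)
      (TwistedJacobi.bracketR' Λ E om) TwistedJacobi.proj ((0, 1) : TwistedJacobi.CotR n M)
      (TwistedJacobi.twistedBracket Λ E om)
      (fun u => TwistedJacobi.proj (TwistedJacobi.sharpR Λ E u))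
      ((-E, 0) : TwistedJacobi.TanR n M)
      (TwistedJacobi.twistForm om) ∧
    TwistedJacobi.IsDPrime Λ E om (fun _ η =>
      TwistedJacobi.differential (TwistedJacobi.actBy TwistedJacobi.proj)
        (TwistedJacobi.bracketR' Λ E om) η) := by
  have T := isTwistedStructure h
  have hA := T.connection_brA
  have hB := T.connection_brB
  obtain ⟨Φ, hΦ⟩ := exists_twistForm om
  -- The section W is the pullback of φ under s. It is a cocycle because φ is closed and s is a
  -- morphism, and d_*^W belongs to the action pulled back along s.
  have hW : ∀ x, pairR n M x (-E, 0) = pairR n M (0, 1) (sharpR Λ E x) := fun x => by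
    simp [pairR_apply, sharpR]
  have hθ : ∀ x f, actBy (fun u => proj (sharpR Λ E u)) x f + f * pairR n M x (-E, 0)
      = modAct (pairR n M) (actBy proj) (0, 1) (sharpR Λ E x) f := fun x f => by
    rw [hW]; rfl
  refine ⟨?_, ?_⟩
  · refine
      { dual := T.perfect
        lieAlgebroid := ?_
        cocycle := ?_
        isForm := ⟨Φ, hΦ⟩
        anchored := ?_
        anchor_bracket := fun X Y => rfl
        jacobi := ?_
        differential_phi := ?_
        differential_form := ?_
        derivation := fun p q k hk P Q β =>
          modDifferential_modSchouten hA T.isCompatible hθ hk P Q β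
        derivation_zero := modSchouten_modDifferential_zero hA T.isCompatible hθ }
    · exact
        { anchor_linear :=
            ⟨fun x y => by rw [T.sharp_add]; rfl, fun c x => by rw [T.sharp_smul]; rfl⟩
          skew := hB.skew
          add_right := hB.br_add
          leibniz := hB.br_smul
          jacobi := T.jacobi_brB
          anchor_bracket := fun x y => by rw [T.sharp_brB]; rfl }
    · funext v
      obtain ⟨x, y, rfl⟩ : ∃ x y, v = ![x, y] := ⟨v 0, v 1, by ext i : 1; fin_cases i <;> rfl⟩
      rw [differential_oneForm (fun b => pairR n M b (-E, 0))]
      simp only [hW, T.sharp_brB, T.closed_one]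
      exact sub_self _
    · exact
        { anchor_linear := ⟨fun _ _ => rfl, fun _ _ => rfl⟩
          skew := hA.skew
          add_right := hA.br_add
          leibniz := hA.br_smul }
    · intro X Y Z β
      have hd : ∀ (W : TanR n M) (x y : CotR n M), differential
          (fun x => modAct (pairR n M) (actBy proj) (0, 1) (sharpR Λ E x)) (twistedBracket Λ E om)
          (fun b : Fin 1 → CotR n M => pairR n M (b 0) W) ![x, y] = _ := fun W =>
        differential_oneForm fun b => pairR n M b W
      have hr : ∀ U V W : TanR n M, pairR n M (represent (pairR n M).flip
          fun S => twistForm om ![U, V, S]) W = twistForm om ![U, V, W] := T.pair_represent_form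
      simp only [modDifferential_eq_differential hθ, differential_function, hd, hr]
      exact T.jacobiator_brA X Y Z β
    · intro X Y
      -- The deformed differential of φ is -Φ(X, Y, sφ), and sφ = -W.
      have hs : sharpR Λ E (0, 1) = (-1 : SmoothFun n M) • (-E, 0) :=
        ext_right T.perfect fun b => by
          rw [T.sharp_skew, ← hW, map_smul, smul_eq_mul, neg_one_mul]
      have e1 : twistForm om ![X, Y, (-1 : SmoothFun n M) • (-E, 0)]
          = -1 * twistForm om ![X, Y, (-E, 0)] := T.form.smul_right _ _ _ _
      have e2 : twistForm om ![(-E, 0), X, Y] = twistForm om ![X, Y, (-E, 0)] := T.form.cycle _ _ _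
      rw [differential_oneForm (fun x => pairR n M (0, 1) x), T.pair_brA, T.closed_one, hs, e1, e2]
      ring
    · rw [modDifferential_eq_differential (ρ := modAct (pairR n M) (actBy proj) (0, 1))
        (fun _ _ => rfl)]
      funext v
      have e := T.closed_brA (v 0) (v 1) (v 2) (v 3)
      rw [← hΦ, differential_eq_extD, hΦ, Pi.zero_apply, ← e]
      have e1 : ∀ u v w, twistForm om ![u, v, w] = -twistForm om ![v, u, w] := T.form.skew_left
      have e3 : ∀ u v w, twistForm om ![u, v, w] = twistForm om ![v, w, u] := T.form.cycle
      rw [show List.ofFn v = [v 0, v 1, v 2, v 3] by simp only [List.ofFn_succ, List.ofFn_zero]; rfl]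
      simp only [extD, lieL, con_apply, toL_triple, sub_zero]
      -- The recursion leaves each bracket in the slot where it arises, while `closed_brA` has it
      -- first; the corrections only permute arguments of Φ.
      linear_combination e3 (bracketR' Λ E om (v 0) (v 3)) (v 1) (v 2)
        - e1 (v 1) (bracketR' Λ E om (v 0) (v 2)) (v 3)
        - e3 (bracketR' Λ E om (v 1) (v 3)) (v 0) (v 2)
        + e1 (v 0) (bracketR' Λ E om (v 1) (v 2)) (v 3)
        + e3 (bracketR' Λ E om (v 2) (v 3)) (v 0) (v 1)
  · exact
      { on_functions := fun f v => by
          rw [differential_function]; simp [pairR_apply, actBy, proj, dFun]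
        on_oneForms := fun u v w => by
          have e : twistForm om ![sharpR Λ E u, v, w] = twistForm om ![v, w, sharpR Λ E u] :=
            T.form.cycle _ _ _
          rw [differential_oneForm (fun x => pairR n M u x),
            differential_oneForm (fun x => pairR n M u x), T.pair_brA, e]
          ring
        additive := fun k η ζ => differential_add hA.add_right η ζ
        graded_leibniz := fun k l η ζ v => differential_wedge hA η ζ v }
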